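/- Let $(X,\mathsf d)$ be a complete separable metric space and let $\mathfrak m$ be a nonnegative Borel measure on $X$ with full support such that, for some $o\in X$ and $\kappa\ge 0$, $\mathfrak m(\{x:\mathsf d(x,o)<r\})\le e^{\kappa r^2}$ for every $r>0$. Let $$\mathsf{Ch}(f)=\inf\Big\{\liminf_{n\to\infty}\tfrac12\int_X|\mathrm Df_n|^2\,d\mathfrak m:\ f_n\in \mathrm{Lip}_b(X)\cap L^2(X,\mathfrak m),\ f_n\to f\text{ in }L^2(X,\mathfrak m)\Big\}\in[0,\infty]$$ be the Cheeger energy on $L^2(X,\mathfrak m)$. Here $\mathrm{Lip}_b(X)$ is the set of bounded Lipschitz functions, and $|\mathrm Df|(x)=\limsup_{y\to x}|f(y)-f(x)|/\mathsf d(x,y)$, with $|\mathrm Df|(x)=0$ if $x$ is isolated. For every $f\in L^2(X,\mathfrak m)$ there is a unique curve $t\mapsto \mathsf P_tf\in L^2(X,\mathfrak m)$, $t\ge 0$, locally absolutely continuous in $(0,\infty)$, with $\mathsf P_0f=f$, $\mathsf P_tf\to f$ as $t\downarrow0$, and $\frac{d}{dt}\mathsf P_tf\in-\partial\mathsf{Ch}(\mathsf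 P_tf)$ for a.e. $t>0$. For every $t\ge0$ the restriction of $\mathsf P_t$ to $L^1\cap L^2(X,\mathfrak m)$ takes values in $L^1(X,\mathfrak m)$ and has a unique continuous extension to a map $L^1(X,\mathfrak m)\to L^1(X,\mathfrak m)$, still denoted by $\mathsf P_t$ (the heat flow). It satisfies $\mathsf P_tf\ge0$ whenever $f\ge0$. Let $F:[0,\infty)\to[0,\infty]$ be convex and lower semicontinuous with $F(1)=0$, and put $F'(\infty)=\lim_{r\to\infty}F(r)/r$. For finite measures $\mu_0,\mu_1$ with Lebesgue decomposition $\mu_0=\varrho\mu_1+\mu_0^\perp$, put $$\mathscr F(\mu_0\mid\mu_1)=\int_X F(\varrho)\,d\mu_1+F'(\infty)\,\mu_0^\perp(X)\qquad(\infty\cdot0=0).$$ For nonnegative $f,g\in L^1(X,\mathfrak m)$ write $\mathscr F(f\mid g)=\mathscr F(f\mathfrak m\mid g\mathfrak m)$. Then, for every such $F$, all nonnegative $f,g\in L^1(X,\mathfrak m)$ and every $t\ge0$, $$\mathscr F(\mathsf P_tf\mid\mathsf P_tg)\le\mathscr F(f\mid g).$$ In particular, $\mathsf{KL}(\mathsf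 P_tf\,\mathfrak m\mid\mathsf P_tg\,\mathfrak m)\le\mathsf{KL}(f\mathfrak m\mid g\mathfrak m)$, where $\mathsf{KL}(\mu_0\mid\mu_1)=\int_X(\varrho\log\varrho-\varrho+1)\,d\mu_1$ if $\mu_0=\varrho\mu_1$, and $\mathsf{KL}(\mu_0\mid\mu_1)=+\infty$ otherwise. -/

import Mathlib

open MeasureTheory Filter Topology
open scoped ENNReal NNReal

noncomputable section

namespace MetricHeat

variable {X : Type*} [MetricSpace X] [MeasurableSpace X]

/-- Volume growth condition: for some `o` and `κ ≥ 0`, `m (B_r(o)) ≤ exp (κ r²)` for all `r > 0`. -/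
def VolumeGrowth (m : Measure X) : Prop :=
  ∃ (o : X) (κ : ℝ), 0 ≤ κ ∧
    ∀ r : ℝ, 0 < r → m (Metric.ball o r) ≤ ENNReal.ofReal (Real.exp (κ * r ^ 2))

/-- The local slope `|Df|(x) = limsup_{y → x} |f y - f x| / d(y, x)`. At an isolated point the
filter `𝓝[≠] x` is `⊥`, and the limsup in `[0, ∞]` is `0`. -/
def slope (f : X → ℝ) (x : X) : ℝ≥0∞ :=
  limsup (fun y => edist (f y) (f x) / edist y x) (𝓝[≠] x)

/-- `Lip_b(X)`: bounded Lipschitz functions. -/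
def IsLipBdd (f : X → ℝ) : Prop :=
  (∃ K : ℝ≥0, LipschitzWith K f) ∧ ∃ C : ℝ, ∀ x, |f x| ≤ C

/-- Sequences in `Lip_b(X) ∩ L²` that converge to `f` in `L²`. -/
def IsLipApprox (m : Measure X) (f : Lp ℝ 2 m) (φ : ℕ → X → ℝ) : Prop :=
  (∀ n, IsLipBdd (φ n) ∧ MemLp (φ n) 2 m) ∧
    Tendsto (fun n => eLpNorm (fun x => φ n x - f x) 2 m) atTop (𝓝 0)

/-- The Cheeger energy on `L²`: the relaxation of `½ ∫ |Df|² dm` from `Lip_b(X)`. -/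
def cheeger (m : Measure X) (f : Lp ℝ 2 m) : ℝ≥0∞ :=
  ⨅ (φ : ℕ → X → ℝ) (_ : IsLipApprox m f φ),
    liminf (fun n => (1 / 2 : ℝ≥0∞) * ∫⁻ x, slope (φ n) x ^ 2 ∂m) atTop

/-- `l ∈ ∂Ch(f)`, the `L²` subdifferential at a point `f` of the domain of `Ch`
(test functions `g` with `Ch(g) = ∞` impose no condition). -/
def IsSubgradient (m : Measure X) (f l : Lp ℝ 2 m) : Prop :=
  cheeger m f ≠ ∞ ∧ ∀ g : Lp ℝ 2 m, cheeger m g ≠ ∞ →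
    inner ℝ l (g - f) ≤ (cheeger m g).toReal - (cheeger m f).toReal

/-- `u`, on `[0, ∞)`, is an `L²` gradient flow curve of `Ch` that starts from `f`: it is locally
absolutely continuous in `(0, ∞)`, tends to `f` at `0`, and `u' ∈ -∂Ch(u)` a.e.
Values at negative times are irrelevant. -/
structure IsGradientFlow (m : Measure X) (f : Lp ℝ 2 m) (u : ℝ → Lp ℝ 2 m) : Prop where
  init : u 0 = f
  tendsto_init : Tendsto u (𝓝[>] 0) (𝓝 f)
  locally_ac : ∀ a b : ℝ, 0 < a → a ≤ b → AbsolutelyContinuousOnInterval u a b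
  inclusion : ∀ᵐ t ∂(volume.restrict (Set.Ioi (0 : ℝ))),
    ∃ l : Lp ℝ 2 m, HasDerivAt u (-l) t ∧ IsSubgradient m (u t) l

/-- The heat flow `P_t` in `L²`: the value at `t ≥ 0` of the gradient flow curve from `f`. -/
def heatFlowL2 (m : Measure X) (t : ℝ) (f : Lp ℝ 2 m) : Lp ℝ 2 m :=
  Classical.epsilon (fun u : ℝ → Lp ℝ 2 m => IsGradientFlow m f u) t

/-- `T : L¹ → L¹` is continuous and agrees with the `L²` heat flow `P_t` on `L¹ ∩ L²`. -/
def IsL1Extension (m : Measure X) (t : ℝ) (T : Lp ℝ 1 m → Lp ℝ 1 m) : Prop :=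
  Continuous T ∧ ∀ (f : Lp ℝ 1 m) (f' : Lp ℝ 2 m), f =ᵐ[m] f' → T f =ᵐ[m] heatFlowL2 m t f'

/-- The heat flow `P_t` in `L¹`, `t ≥ 0`: the continuous extension of `P_t` from `L¹ ∩ L²`. -/
def heatFlow (m : Measure X) (t : ℝ) : Lp ℝ 1 m → Lp ℝ 1 m :=
  Classical.epsilon (fun T => IsL1Extension m t T)

/-- Csiszár density functions `F : [0, ∞) → [0, ∞]`. -/
structure IsCsiszarDensity (F : ℝ≥0 → ℝ≥0∞) : Prop where
  convex : ConvexOn ℝ≥0 Set.univ F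
  lsc : LowerSemicontinuous F
  map_one : F 1 = 0

/-- `F'(∞) = lim_{r → ∞} F(r) / r`; the limit exists in `[0, ∞]` for a Csiszár density. -/
def recession (F : ℝ≥0 → ℝ≥0∞) : ℝ≥0∞ :=
  limsup (fun r : ℝ≥0 => F r / (r : ℝ≥0∞)) atTop

/-- The Csiszár divergence `∫ F(ϱ) dμ₁ + F'(∞) μ₀^⊥(Ω)` of finite measures, where
`μ₀ = ϱ μ₁ + μ₀^⊥` is the Lebesgue decomposition (and `∞ * 0 = 0`). -/
def csiszarDiv {Ω : Type*} [MeasurableSpace Ω] (F : ℝ≥0 → ℝ≥0∞) (μ₀ μ₁ : Measure Ω) : ℝ≥0∞ :=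
  ∫⁻ x, F (μ₀.rnDeriv μ₁ x).toNNReal ∂μ₁ + recession F * μ₀.singularPart μ₁ Set.univ

/-- The measure `f m` for a nonnegative `f ∈ L¹`. -/
def densityMeasure (m : Measure X) (f : Lp ℝ 1 m) : Measure X :=
  m.withDensity (fun x => ENNReal.ofReal (f x))

end MetricHeat

end

/-! The heart of the matter is the inequality `∫ (α P_t f - β P_t g)⁺ ≤ ∫ (α f - β g)⁺` for all real
`α`, `β`. It splits into two facts: `P_t` contracts the integral of the positive part of a
difference, and `P_t` is homogeneous of degree one. `Ch` need not be a quadratic form, so `P_t` may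
fail to be additive, and additivity is never used.

Contraction comes from an exchange argument. If `0 ≤ θ' ≤ 1`, then replacing `(w, z)` by `(w - θ(w -
z), z + θ(w - z))` turns the slopes into convex combinations of the old ones with swapped weights.
Convexity of the square then shows that the sum of the energies does not grow (`energy_exchange_le`,
`cheeger_exchange_le`). Used as a competitor in the subgradient inequalities of two resolvents
(`inner_exchange_le`), with `θ'` bounded and a rescaled `θ` tending to the indicator of `(0, ∞)`, it
gives `lintegral_sub_resolvent_le`. The bound passes to the flow through the implicit Euler scheme
and to `L¹` by density. Homogeneity holds because `Ch` is homogeneous of degree two.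

The divergence is the integral of the perspective `b F(a / b)` of `F`, a supremum of affine
expressions `c a - F*(c) b`. Convexity of the conjugate `F*` allows such a supremum over a grid of
slopes to be written as a sum of hinges `(α a - β b)⁺` (`hingeSum_eq`). Each hinge functional
decreases along the flow, and Fatou's lemma concludes (`lintegral_persp_le`).

Well-posedness is the Hilbert space theory of gradient flows: Euler schemes converge to a curve
satisfying an evolution variational inequality (EVI), which makes it locally Lipschitz, hence a.e.
differentiable, hence a gradient flow curve. Monotonicity of the subdifferential gives uniqueness.
-/

namespace MetricHeat

/-! ### Subdifferentials and resolvents of convex functionals on a Hilbert space. -/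

section Abstract

variable {H : Type*} [NormedAddCommGroup H] [InnerProductSpace ℝ H]

/-- The subdifferential of `φ : H → [0, ∞]`. -/
def IsSubgrad (φ : H → ℝ≥0∞) (f l : H) : Prop :=
  φ f ≠ ∞ ∧ ∀ g : H, φ g ≠ ∞ → inner ℝ l (g - f) ≤ (φ g).toReal - (φ f).toReal

/-- Convex lower semicontinuous functionals that vanish at `0` and have dense domain. -/
structure IsEnergy (φ : H → ℝ≥0∞) : Prop where
  convex : ∀ x y : H, ∀ s : ℝ, 0 ≤ s → s ≤ 1 →
    φ ((1 - s) • x + s • y) ≤ ENNReal.ofReal (1 - s) * φ x + ENNReal.ofReal s * φ y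
  lsc : LowerSemicontinuous φ
  map_zero : φ 0 = 0
  dense_dom : Dense {x | φ x ≠ ∞}

variable {φ : H → ℝ≥0∞}

theorem IsSubgrad.monotone {f g k l : H} (hf : IsSubgrad φ f k) (hg : IsSubgrad φ g l) :
    0 ≤ inner ℝ (k - l) (f - g) := by
  have h1 := hf.2 g hg.1
  have h2 := hg.2 f hf.1
  have e : inner ℝ (k - l) (f - g) = - inner ℝ k (g - f) - inner ℝ l (f - g) := by
    rw [inner_sub_left, ← neg_sub g f, inner_neg_right]
  linarith

/-- One step of the implicit Euler scheme in the form of an evolution variational inequality. -/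
theorem IsSubgrad.evi {τ : ℝ} (hτ : 0 < τ) {f w : H} (h : IsSubgrad φ w (τ⁻¹ • (f - w)))
    {g : H} (hg : φ g ≠ ∞) :
    ‖w - g‖ ^ 2 - ‖f - g‖ ^ 2 + ‖w - f‖ ^ 2 ≤ 2 * τ * ((φ g).toReal - (φ w).toReal) := by
  have h1 := h.2 g hg
  rw [real_inner_smul_left] at h1
  have h2 : inner ℝ (f - w) (g - w) ≤ τ * ((φ g).toReal - (φ w).toReal) := by
    have := mul_le_mul_of_nonneg_left h1 hτ.le
    rwa [← mul_assoc, mul_inv_cancel₀ hτ.ne', one_mul] at this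
  have e : ‖f - g‖ ^ 2 = ‖f - w‖ ^ 2 + 2 * inner ℝ (f - w) (w - g) + ‖w - g‖ ^ 2 := by
    rw [← norm_add_sq_real]; congr 2; abel
  have e2 : inner ℝ (f - w) (w - g) = - inner ℝ (f - w) (g - w) := by
    rw [← inner_neg_right, neg_sub]
  rw [norm_sub_rev w f]
  linarith

theorem IsSubgrad.resolvent_nonexpansive {τ : ℝ} (hτ : 0 < τ) {f g w z : H}
    (hw : IsSubgrad φ w (τ⁻¹ • (f - w))) (hz : IsSubgrad φ z (τ⁻¹ • (g - z))) :
    ‖w - z‖ ≤ ‖f - g‖ := by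
  have h := hw.monotone hz
  rw [← smul_sub, real_inner_smul_left] at h
  have h1 : 0 ≤ inner ℝ (f - w - (g - z)) (w - z) := nonneg_of_mul_nonneg_right h (by positivity)
  have e : f - w - (g - z) = (f - g) - (w - z) := by abel
  rw [e, inner_sub_left, real_inner_self_eq_norm_sq] at h1
  have h2 := real_inner_le_norm (f - g) (w - z)
  by_contra! hc
  have : 0 < ‖w - z‖ := (norm_nonneg _).trans_lt hc
  nlinarith

theorem IsSubgrad.resolvent_unique {τ : ℝ} (hτ : 0 < τ) {f w z : H}
    (hw : IsSubgrad φ w (τ⁻¹ • (f - w))) (hz : IsSubgrad φ z (τ⁻¹ • (f - z))) : w = z := by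
  have := hw.resolvent_nonexpansive hτ hz
  rw [sub_self, norm_zero] at this
  exact sub_eq_zero.1 (norm_le_zero_iff.1 this)

theorem IsEnergy.convex_toReal (hφ : IsEnergy φ) {x y : H} (hx : φ x ≠ ∞) (hy : φ y ≠ ∞) {s : ℝ}
    (h0 : 0 ≤ s) (h1 : s ≤ 1) : φ ((1 - s) • x + s • y) ≠ ∞ ∧
      (φ ((1 - s) • x + s • y)).toReal ≤ (1 - s) * (φ x).toReal + s * (φ y).toReal := by
  have h := hφ.convex x y s h0 h1
  have hf : ENNReal.ofReal (1 - s) * φ x + ENNReal.ofReal s * φ y ≠ ∞ :=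
    ENNReal.add_ne_top.2 ⟨ENNReal.mul_ne_top ENNReal.ofReal_ne_top hx,
      ENNReal.mul_ne_top ENNReal.ofReal_ne_top hy⟩
  refine ⟨ne_top_of_le_ne_top hf h, ?_⟩
  have := ENNReal.toReal_mono hf h
  rwa [ENNReal.toReal_add (ENNReal.mul_ne_top ENNReal.ofReal_ne_top hx)
    (ENNReal.mul_ne_top ENNReal.ofReal_ne_top hy), ENNReal.toReal_mul, ENNReal.toReal_mul,
    ENNReal.toReal_ofReal (by linarith), ENNReal.toReal_ofReal h0] at this

/-- Lower semicontinuity along sequences, for the real values of `φ`. -/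
theorem IsEnergy.toReal_le_of_tendsto (hφ : IsEnergy φ) {x : ℕ → H} {y : H} {c : ℕ → ℝ} {d : ℝ}
    (hx : Tendsto x atTop (𝓝 y)) (hc : Tendsto c atTop (𝓝 d))
    (h : ∀ᶠ n in atTop, φ (x n) ≠ ∞ ∧ (φ (x n)).toReal ≤ c n) :
    φ y ≠ ∞ ∧ (φ y).toReal ≤ d := by
  have h1 : φ y ≤ ENNReal.ofReal d := by
    refine le_of_forall_lt fun a ha => ?_
    obtain ⟨b, hab, hb⟩ := exists_between ha
    have h2 := hx.eventually (hφ.lsc y b hb)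
    refine hab.trans_le (ge_of_tendsto (ENNReal.tendsto_ofReal hc) ?_)
    filter_upwards [h, h2] with n hn hn2
    rw [ENNReal.le_ofReal_iff_toReal_le hn2.ne_top]
    · exact (ENNReal.toReal_mono hn.1 hn2.le).trans hn.2
    · exact ENNReal.toReal_nonneg.trans hn.2
  have h3 : 0 ≤ d := by
    refine ge_of_tendsto hc ?_
    filter_upwards [h] with n hn using ENNReal.toReal_nonneg.trans hn.2
  exact ⟨ne_top_of_le_ne_top ENNReal.ofReal_ne_top h1,
    ENNReal.toReal_le_of_le_ofReal h3 h1⟩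

/-- The last term expresses the uniform convexity of `‖· - f‖²`, which drives the whole construction
of the resolvent. -/
theorem norm_comb_sub_sq (x y f : H) (s : ℝ) :
    ‖(1 - s) • x + s • y - f‖ ^ 2 =
      (1 - s) * ‖x - f‖ ^ 2 + s * ‖y - f‖ ^ 2 - s * (1 - s) * ‖x - y‖ ^ 2 := by
  have e : (1 - s) • x + s • y - f = (1 - s) • (x - f) + s • (y - f) := by module
  have e2 : x - y = (x - f) - (y - f) := by abel
  rw [e, e2, norm_add_sq_real, norm_sub_sq_real (x - f) (y - f), norm_smul, norm_smul,
    real_inner_smul_left,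
    real_inner_smul_right, mul_pow, mul_pow, Real.norm_eq_abs, Real.norm_eq_abs, sq_abs, sq_abs]
  ring

/-- Direct method: uniform convexity makes minimising sequences Cauchy, and lower semicontinuity
makes the limit a minimiser. -/
theorem IsEnergy.exists_resolvent [CompleteSpace H] (hφ : IsEnergy φ) {τ : ℝ} (hτ : 0 < τ) (f : H) :
    ∃ w, IsSubgrad φ w (τ⁻¹ • (f - w)) := by
  -- minimise `Q w = 2 τ φ w + ‖w - f‖²` over the domain
  set Q : H → ℝ := fun w => 2 * τ * (φ w).toReal + ‖w - f‖ ^ 2 with hQ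
  set S : Set ℝ := Q '' {x | φ x ≠ ∞} with hS
  have hbd : BddBelow S := ⟨0, by rintro _ ⟨w, -, rfl⟩; positivity⟩
  have hne : S.Nonempty := ⟨Q 0, 0, by simp [hφ.map_zero], rfl⟩
  have hmin : ∀ w, φ w ≠ ∞ → sInf S ≤ Q w := fun w hw => csInf_le hbd ⟨w, hw, rfl⟩
  have hseq : ∀ n : ℕ, ∃ w, φ w ≠ ∞ ∧ Q w < sInf S + 1 / ((n : ℝ) + 1) := by
    intro n
    obtain ⟨_, ⟨w, hw, rfl⟩, h⟩ := exists_lt_of_csInf_lt hne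
      (show sInf S < sInf S + 1 / ((n : ℝ) + 1) by
        linarith [Nat.one_div_pos_of_nat (α := ℝ) (n := n)])
    exact ⟨w, hw, h⟩
  choose w hw hwQ using hseq
  have hconv : ∀ x y, φ x ≠ ∞ → φ y ≠ ∞ → ∀ s : ℝ, 0 ≤ s → s ≤ 1 →
      sInf S ≤ (1 - s) * Q x + s * Q y - s * (1 - s) * ‖x - y‖ ^ 2 := by
    intro x y hx hy s h0 h1
    obtain ⟨h2, h3⟩ := hφ.convex_toReal hx hy h0 h1
    have h4 := hmin _ h2
    simp only [hQ] at h4 ⊢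
    rw [norm_comb_sub_sq] at h4
    nlinarith
  have hcau : CauchySeq w := by
    rw [Metric.cauchySeq_iff']
    intro ε hε
    obtain ⟨N, hN⟩ := exists_nat_one_div_lt (show 0 < ε ^ 2 / 4 by positivity)
    refine ⟨N, fun n hn => ?_⟩
    -- At the midpoint the convexity defect is `‖w n - w N‖² / 4`, which the excess over the
    -- infimum, at most `1 / (N + 1) < ε² / 4`, controls.
    have h1 := hconv (w n) (w N) (hw n) (hw N) (1 / 2) (by norm_num) (by norm_num)
    have h2 : 1 / ((n : ℝ) + 1) ≤ 1 / ((N : ℝ) + 1) := Nat.one_div_le_one_div hn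
    have h3 := hwQ n
    have h4 := hwQ N
    rw [dist_eq_norm]
    refine lt_of_pow_lt_pow_left₀ 2 hε.le ?_
    nlinarith
  obtain ⟨v, hv⟩ := cauchySeq_tendsto_of_complete hcau
  have hlim : Tendsto (fun n : ℕ => (sInf S + 1 / ((n : ℝ) + 1) - ‖w n - f‖ ^ 2) / (2 * τ)) atTop
      (𝓝 ((sInf S + 0 - ‖v - f‖ ^ 2) / (2 * τ))) :=
    ((tendsto_const_nhds.add tendsto_one_div_add_atTop_nhds_zero_nat).sub
      ((hv.sub_const f).norm.pow 2)).div_const _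
  obtain ⟨hv1, hv2⟩ := hφ.toReal_le_of_tendsto hv hlim (Eventually.of_forall fun n => ⟨hw n, by
    rw [le_div_iff₀ (by positivity)]; have := hwQ n; simp only [hQ] at this; linarith⟩)
  have hvQ : Q v ≤ sInf S := by
    rw [le_div_iff₀ (by positivity)] at hv2
    simp only [hQ]; linarith
  refine ⟨v, hv1, fun g hg => ?_⟩
  -- Compare the minimiser with points of the segment towards `g`, divide by `s` and let `s → 0`.
  -- Once the squares are expanded this is the subgradient inequality.
  have key : ‖v - g‖ ^ 2 ≤ Q g - Q v := by
    have hl : Tendsto (fun s : ℝ => (1 - s) * ‖v - g‖ ^ 2) (𝓝[>] 0) (𝓝 ((1 - 0) * ‖v - g‖ ^ 2)) :=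
      ((continuous_const.sub continuous_id).mul continuous_const).continuousAt.tendsto.mono_left
        nhdsWithin_le_nhds
    rw [sub_zero, one_mul] at hl
    refine le_of_tendsto hl ?_
    filter_upwards [Ioo_mem_nhdsGT (zero_lt_one' ℝ)] with s hs
    have h1 := hconv v g hv1 hg s hs.1.le hs.2.le
    have h2 : s * ((1 - s) * ‖v - g‖ ^ 2) ≤ s * (Q g - Q v) := by nlinarith
    exact le_of_mul_le_mul_left h2 hs.1
  simp only [hQ] at key
  have e : ‖f - g‖ ^ 2 = ‖f - v‖ ^ 2 + 2 * inner ℝ (f - v) (v - g) + ‖v - g‖ ^ 2 := by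
    rw [← norm_add_sq_real]; congr 2; abel
  have e2 : inner ℝ (f - v) (v - g) = - inner ℝ (f - v) (g - v) := by
    rw [← inner_neg_right, neg_sub]
  rw [norm_sub_rev g f, norm_sub_rev v f] at key
  rw [real_inner_smul_left, inv_mul_le_iff₀ hτ]
  linarith

end Abstract

/-! ### Evolution variational inequalities, discrete and continuous. -/

section GradientFlow

variable {H : Type*} [NormedAddCommGroup H] {φ : H → ℝ≥0∞}

/-- Two sequences that satisfy the evolution variational inequality with the same step stay
close to each other. -/
theorem norm_sub_sq_le_of_evi_steps {U V : ℕ → H} {h : ℝ}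
    (hU : ∀ n, φ (U (n + 1)) ≠ ∞ ∧ ∀ g, φ g ≠ ∞ →
      ‖U (n + 1) - g‖ ^ 2 - ‖U n - g‖ ^ 2 ≤ 2 * h * ((φ g).toReal - (φ (U (n + 1))).toReal))
    (hV : ∀ n, φ (V (n + 1)) ≠ ∞ ∧ ∀ g, φ g ≠ ∞ →
      ‖V (n + 1) - g‖ ^ 2 - ‖V n - g‖ ^ 2 ≤ 2 * h * ((φ g).toReal - (φ (V (n + 1))).toReal))
    (hV0 : φ (V 0) ≠ ∞) (n : ℕ) :
    ‖U n - V n‖ ^ 2 ≤ ‖U 0 - V 0‖ ^ 2 + 2 * h * ((φ (V 0)).toReal - (φ (V n)).toReal) := by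
  induction n with
  | zero => simp
  | succ n ih =>
    have hVn : φ (V n) ≠ ∞ := by
      cases n with
      | zero => exact hV0
      | succ k => exact (hV k).1
    -- The step of `U` is tested with `V n` and the step of `V` with `U (n + 1)`. In the sum the
    -- energies of `U` and the mixed distances cancel, so the energies of `V` telescope.
    have h1 := (hU n).2 _ hVn
    have h2 := (hV n).2 _ (hU n).1
    rw [norm_sub_rev, norm_sub_rev (V n)] at h2
    nlinarith

/-- The integrated evolution variational inequality. -/
def IsEVI (φ : H → ℝ≥0∞) (u : ℝ → H) : Prop :=
  ∀ s t, 0 ≤ s → s < t → φ (u t) ≠ ∞ ∧ ∀ g, φ g ≠ ∞ →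
    ‖u t - g‖ ^ 2 - ‖u s - g‖ ^ 2 ≤ 2 * (t - s) * ((φ g).toReal - (φ (u t)).toReal)

theorem IsEVI.shift {u : ℝ → H} (hu : IsEVI φ u) {h : ℝ} (hh : 0 ≤ h) :
    IsEVI φ fun t => u (t + h) := by
  intro s t hs hst
  obtain ⟨h1, h2⟩ := hu (s + h) (t + h) (by positivity) (by linarith)
  exact ⟨h1, fun g hg => (h2 g hg).trans_eq (by ring)⟩

theorem IsEVI.ne_top {u : ℝ → H} (hu : IsEVI φ u) {t : ℝ} (ht : 0 < t) : φ (u t) ≠ ∞ :=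
  (hu 0 t le_rfl ht).1

theorem IsEVI.norm_sub_sq_le {u : ℝ → H} (hu : IsEVI φ u) {s t : ℝ} (hs : 0 < s) (hst : s ≤ t) :
    ‖u t - u s‖ ^ 2 ≤ 2 * (t - s) * ((φ (u s)).toReal - (φ (u t)).toReal) := by
  rcases hst.eq_or_lt with rfl | hst
  · simp
  · simpa using (hu s t hs.le hst).2 (u s) (hu.ne_top hs)

theorem IsEVI.energy_antitone {u : ℝ → H} (hu : IsEVI φ u) {s t : ℝ} (hs : 0 < s) (hst : s ≤ t) :
    (φ (u t)).toReal ≤ (φ (u s)).toReal := by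
  rcases hst.eq_or_lt with rfl | hst
  · rfl
  · have := hu.norm_sub_sq_le hs hst.le
    by_contra! hc
    nlinarith [sq_nonneg ‖u t - u s‖]

/-- Sampling both curves at `n + 1` equal steps reduces this to the discrete comparison, whose error
is one step length times an energy drop. No differentiability of the curves is needed. -/
theorem IsEVI.contraction {u v : ℝ → H} (hu : IsEVI φ u) (hv : IsEVI φ v) {s t : ℝ}
    (hs : 0 < s) (hst : s ≤ t) : ‖u t - v t‖ ≤ ‖u s - v s‖ := by
  rcases hst.eq_or_lt with rfl | hst
  · rfl
  refine le_of_sq_le_sq ?_ (norm_nonneg _)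
  have hlim : Tendsto (fun n : ℕ => ‖u s - v s‖ ^ 2 +
      2 * ((t - s) * (1 / ((n : ℝ) + 1))) * ((φ (v s)).toReal - (φ (v t)).toReal)) atTop
      (𝓝 (‖u s - v s‖ ^ 2 + 2 * ((t - s) * 0) * ((φ (v s)).toReal - (φ (v t)).toReal))) :=
    tendsto_const_nhds.add (((tendsto_one_div_add_atTop_nhds_zero_nat.const_mul _).const_mul
      _).mul_const _)
  simp only [mul_zero, zero_mul, add_zero] at hlim
  refine ge_of_tendsto hlim (Eventually.of_forall fun n => ?_)
  set h := (t - s) * (1 / ((n : ℝ) + 1)) with hh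
  have hpos : 0 < h := mul_pos (by linarith) (by positivity)
  have hstep : ∀ {w : ℝ → H}, IsEVI φ w → ∀ i : ℕ, φ (w (s + ((i + 1 : ℕ) : ℝ) * h)) ≠ ∞ ∧
      ∀ g, φ g ≠ ∞ → ‖w (s + ((i + 1 : ℕ) : ℝ) * h) - g‖ ^ 2 - ‖w (s + (i : ℝ) * h) - g‖ ^ 2 ≤
        2 * h * ((φ g).toReal - (φ (w (s + ((i + 1 : ℕ) : ℝ) * h))).toReal) := by
    intro w hw i
    obtain ⟨h1, h2⟩ := hw (s + (i : ℝ) * h) (s + ((i + 1 : ℕ) : ℝ) * h) (by positivity)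
      (by push_cast; linarith)
    refine ⟨h1, fun g hg => (h2 g hg).trans_eq ?_⟩
    push_cast; ring
  have := norm_sub_sq_le_of_evi_steps (U := fun i : ℕ => u (s + (i : ℝ) * h))
    (V := fun i : ℕ => v (s + (i : ℝ) * h)) (hstep hu) (hstep hv)
    (by simpa using hv.ne_top hs) (n + 1)
  have e : s + ((n + 1 : ℕ) : ℝ) * h = t := by rw [hh]; push_cast; field_simp; ring
  simpa only [e, Nat.cast_zero, zero_mul, add_zero] using this

/-- By contraction, the increments over a fixed time lag `h` do not grow along the curve. About `a /
(2h)` of them fit into `[a/2, a]`, and their squares sum to at most `2h` times the energy at `a/2`.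
Each later increment is therefore of order `h`. -/
theorem IsEVI.lipschitzOnWith {u : ℝ → H} (hu : IsEVI φ u) {a : ℝ} (ha : 0 < a) :
    ∃ K : ℝ≥0, LipschitzOnWith K u (Set.Ici a) := by
  set M := (φ (u (a / 2))).toReal with hM
  have hM0 : 0 ≤ M := ENNReal.toReal_nonneg
  have key : ∀ s t, a ≤ s → s ≤ t → ‖u t - u s‖ ^ 2 ≤ 8 * M / a * (t - s) ^ 2 := by
    intro s t hs hst
    rcases hst.eq_or_lt with rfl | hlt
    · simp
    set h := t - s with hh
    have hpos : 0 < h := by linarith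
    have hen : ∀ r, a / 2 ≤ r → (φ (u r)).toReal ≤ M := fun r hr =>
      hu.energy_antitone (by positivity) hr
    rcases le_or_gt h (a / 2) with hsmall | hbig
    · set n := ⌊a / 2 / h⌋₊ with hn
      have hn1 : (n : ℝ) ≤ a / 2 / h := Nat.floor_le (by positivity)
      have hn2 : a / 2 / h < n + 1 := Nat.lt_floor_add_one _
      have hn3 : 1 ≤ n := by
        apply Nat.le_floor
        rw [Nat.cast_one, le_div_iff₀ hpos]; linarith
      have hn4 : (1 : ℝ) ≤ n := by exact_mod_cast hn3
      have hsum : ∀ j : ℕ, j ≤ n → (j : ℝ) * ‖u t - u s‖ ^ 2 ≤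
          2 * h * ((φ (u (a / 2))).toReal - (φ (u (a / 2 + j * h))).toReal) := by
        intro j
        induction j with
        | zero => simp
        | succ j ih =>
          intro hj
          have h1 := ih (by omega)
          have hp : 0 < a / 2 + j * h := by positivity
          have h2 := hu.norm_sub_sq_le hp (t := a / 2 + j * h + h) (by linarith)
          have hjn : ((j : ℝ) + 1) * h ≤ a / 2 := by
            have : ((j + 1 : ℕ) : ℝ) ≤ n := by exact_mod_cast hj
            push_cast at this
            calc ((j : ℝ) + 1) * h ≤ (a / 2 / h) * h := by gcongr; linarith
              _ = a / 2 := by field_simp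
          -- Contraction between `u (· + h)` and `u` bounds the increment at `s` by the one at the
          -- earlier time `a / 2 + j * h`.
          have h3 := (hu.shift hpos.le).contraction hu hp (t := s) (by linarith)
          have e1 : s + h = t := by rw [hh]; ring
          simp only [e1] at h3
          have h4 : ‖u t - u s‖ ^ 2 ≤ ‖u (a / 2 + j * h + h) - u (a / 2 + j * h)‖ ^ 2 := by gcongr
          have e2 : a / 2 + ((j + 1 : ℕ) : ℝ) * h = a / 2 + j * h + h := by push_cast; ring
          rw [e2]; push_cast
          nlinarith
      have h1 := hsum n le_rfl
      have h2 : (0 : ℝ) ≤ (φ (u (a / 2 + n * h))).toReal := ENNReal.toReal_nonneg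
      have h3 : (n : ℝ) * ‖u t - u s‖ ^ 2 ≤ 2 * h * M := by nlinarith
      have h4 : a / (4 * h) ≤ n := by
        rw [div_le_iff₀ (by positivity)]
        rw [div_lt_iff₀ hpos] at hn2
        nlinarith
      have h5 : a / (4 * h) * ‖u t - u s‖ ^ 2 ≤ 2 * h * M :=
        (mul_le_mul_of_nonneg_right h4 (sq_nonneg _)).trans h3
      rw [div_mul_eq_mul_div, div_le_iff₀ (by positivity)] at h5
      rw [div_mul_eq_mul_div, le_div_iff₀ ha]
      linarith
    · have h1 := hu.norm_sub_sq_le (lt_of_lt_of_le ha hs) hst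
      have h2 := hen s (by linarith)
      have h3 : (0 : ℝ) ≤ (φ (u t)).toReal := ENNReal.toReal_nonneg
      have h4 : ‖u t - u s‖ ^ 2 ≤ 2 * h * M := by nlinarith
      refine h4.trans ?_
      rw [div_mul_eq_mul_div, le_div_iff₀ ha]
      nlinarith [mul_nonneg hM0 hpos.le]
  refine ⟨(√(8 * M / a)).toNNReal, LipschitzOnWith.of_dist_le_mul fun x hx y hy => ?_⟩
  have hc : 0 ≤ 8 * M / a := by positivity
  rw [Real.coe_toNNReal _ (Real.sqrt_nonneg _)]
  have main : ∀ s t, a ≤ s → s ≤ t → dist (u t) (u s) ≤ √(8 * M / a) * (t - s) := by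
    intro s t hs hst
    rw [dist_eq_norm]
    refine le_of_sq_le_sq ?_ (mul_nonneg (Real.sqrt_nonneg _) (by linarith))
    rw [mul_pow, Real.sq_sqrt hc]
    exact key s t hs hst
  rcases le_total x y with hxy | hxy
  · rw [dist_comm, Real.dist_eq, abs_sub_comm, abs_of_nonneg (by linarith)]
    exact main x y hx hxy
  · rw [Real.dist_eq, abs_of_nonneg (by linarith)]
    exact main y x hy hxy

/-- The energy at time `0` may be infinite, so the EVI is tested with a nearby point of the domain.
-/
theorem IsEVI.tendsto_zero {u : ℝ → H} (hφ : Dense {x | φ x ≠ ∞}) (hu : IsEVI φ u) :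
    Tendsto u (𝓝[>] 0) (𝓝 (u 0)) := by
  rw [Metric.tendsto_nhds]
  intro ε hε
  obtain ⟨g, hg, hfg⟩ := Metric.dense_iff.1 hφ (u 0) (ε / 3) (by positivity)
  have hfg' : ‖u 0 - g‖ < ε / 3 := by rw [← dist_eq_norm, dist_comm]; exact hg
  have hlim : Tendsto (fun t : ℝ => ‖u 0 - g‖ ^ 2 + 2 * t * (φ g).toReal) (𝓝[>] 0)
      (𝓝 (‖u 0 - g‖ ^ 2 + 2 * 0 * (φ g).toReal)) :=
    (Continuous.tendsto (by fun_prop) 0).mono_left nhdsWithin_le_nhds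
  have hlt : ‖u 0 - g‖ ^ 2 + 2 * 0 * (φ g).toReal < (ε / 3) ^ 2 := by
    have : ‖u 0 - g‖ ^ 2 < (ε / 3) ^ 2 := by gcongr
    linarith
  filter_upwards [hlim.eventually (gt_mem_nhds hlt), self_mem_nhdsWithin] with t h1 ht
  have h2 := (hu 0 t le_rfl ht).2 g hfg
  have h3 : (0 : ℝ) ≤ (φ (u t)).toReal := ENNReal.toReal_nonneg
  have h4 : ‖u t - g‖ < ε / 3 := by
    refine lt_of_pow_lt_pow_left₀ 2 (by positivity) ?_
    have : 0 < t := ht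
    nlinarith [mul_nonneg this.le h3]
  rw [dist_eq_norm]
  calc ‖u t - u 0‖ = ‖(u t - g) - (u 0 - g)‖ := by congr 1; abel
    _ ≤ ‖u t - g‖ + ‖u 0 - g‖ := norm_sub_le _ _
    _ < ε := by linarith

variable [InnerProductSpace ℝ H]

/-- A resolvent of `φ`: a solution `w` of `(f - w) / τ ∈ ∂φ(w)`. -/
noncomputable def resolvent (φ : H → ℝ≥0∞) (τ : ℝ) (f : H) : H :=
  Classical.epsilon fun w => IsSubgrad φ w (τ⁻¹ • (f - w))

/-- The implicit Euler scheme. -/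
noncomputable def euler (φ : H → ℝ≥0∞) (τ : ℝ) (n : ℕ) (f : H) : H := (resolvent φ τ)^[n] f

theorem euler_zero (τ : ℝ) (f : H) : euler φ τ 0 f = f := rfl

theorem euler_succ (τ : ℝ) (n : ℕ) (f : H) :
    euler φ τ (n + 1) f = resolvent φ τ (euler φ τ n f) := Function.iterate_succ_apply' _ _ _

/-- The gradient flow as the limit of implicit Euler schemes with dyadic steps. -/
noncomputable def gradFlow (φ : H → ℝ≥0∞) (f : H) (t : ℝ) : H :=
  haveI : Nonempty H := ⟨0⟩
  limUnder atTop fun k : ℕ => euler φ ((2 : ℝ) ^ k)⁻¹ ⌊t * 2 ^ k⌋₊ f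

/-! ### Convergence of the implicit Euler scheme. -/

section Euler

variable [CompleteSpace H]

theorem IsEnergy.isSubgrad_resolvent (hφ : IsEnergy φ) {τ : ℝ} (hτ : 0 < τ) (f : H) :
    IsSubgrad φ (resolvent φ τ f) (τ⁻¹ • (f - resolvent φ τ f)) :=
  Classical.epsilon_spec (hφ.exists_resolvent hτ f)

theorem IsEnergy.euler_nonexpansive (hφ : IsEnergy φ) {τ : ℝ} (hτ : 0 < τ) (n : ℕ) (f g : H) :
    ‖euler φ τ n f - euler φ τ n g‖ ≤ ‖f - g‖ := by
  induction n with
  | zero => simp [euler_zero]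
  | succ n ih =>
    rw [euler_succ, euler_succ]
    exact ((hφ.isSubgrad_resolvent hτ _).resolvent_nonexpansive hτ
      (hφ.isSubgrad_resolvent hτ _)).trans ih

theorem IsEnergy.euler_step (hφ : IsEnergy φ) {τ : ℝ} (hτ : 0 < τ) (n : ℕ) (f : H) :
    φ (euler φ τ (n + 1) f) ≠ ∞ ∧ ∀ g, φ g ≠ ∞ →
      ‖euler φ τ (n + 1) f - g‖ ^ 2 - ‖euler φ τ n f - g‖ ^ 2 ≤
        2 * τ * ((φ g).toReal - (φ (euler φ τ (n + 1) f)).toReal) := by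
  rw [euler_succ]
  have h := hφ.isSubgrad_resolvent hτ (euler φ τ n f)
  refine ⟨h.1, fun g hg => ?_⟩
  have := h.evi hτ hg
  nlinarith [sq_nonneg ‖resolvent φ τ (euler φ τ n f) - euler φ τ n f‖]

/-- Energies decrease along the scheme, so the one-step inequalities add up with the last energy on
the right. The disjunction is there because without a step (`j = 0`) the energy need not be finite.
-/
theorem IsEnergy.euler_evi (hφ : IsEnergy φ) {τ : ℝ} (hτ : 0 < τ) (k j : ℕ) (f : H)
    (hk : φ (euler φ τ k f) ≠ ∞ ∨ j ≠ 0) :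
    φ (euler φ τ (k + j) f) ≠ ∞ ∧ ∀ g, φ g ≠ ∞ →
      ‖euler φ τ (k + j) f - g‖ ^ 2 - ‖euler φ τ k f - g‖ ^ 2 ≤
        2 * (τ * j) * ((φ g).toReal - (φ (euler φ τ (k + j) f)).toReal) := by
  induction j with
  | zero => exact ⟨by simpa using hk, fun g _ => by simp⟩
  | succ j ih =>
    obtain ⟨h1, h2⟩ := hφ.euler_step hτ (k + j) f
    refine ⟨h1, fun g hg => ?_⟩
    have h3 := h2 g hg
    rw [← add_assoc]
    rcases Nat.eq_zero_or_pos j with rfl | hj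
    · simpa using h3
    · obtain ⟨h4, h5⟩ := ih (Or.inr hj.ne')
      have h6 := h2 _ h4
      rw [sub_self, norm_zero] at h6
      have h7 : (φ (euler φ τ (k + j + 1) f)).toReal ≤ (φ (euler φ τ (k + j) f)).toReal := by
        by_contra! hc
        nlinarith [sq_nonneg ‖euler φ τ (k + j + 1) f - euler φ τ (k + j) f‖]
      have h8 := h5 g hg
      push_cast
      have h9 : 2 * (τ * j) * ((φ (euler φ τ (k + j + 1) f)).toReal) ≤
          2 * (τ * j) * ((φ (euler φ τ (k + j) f)).toReal) :=
        mul_le_mul_of_nonneg_left h7 (by positivity)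
      nlinarith

theorem IsEnergy.euler_dom (hφ : IsEnergy φ) {τ : ℝ} (hτ : 0 < τ) (n : ℕ) {f : H} (hf : φ f ≠ ∞) :
    φ (euler φ τ n f) ≠ ∞ ∧ (φ (euler φ τ n f)).toReal ≤ (φ f).toReal := by
  have h := hφ.euler_evi hτ 0 n f (Or.inl hf)
  rw [zero_add] at h
  refine ⟨h.1, ?_⟩
  rcases Nat.eq_zero_or_pos n with rfl | hn
  · exact le_rfl
  have h2 := h.2 f hf
  rw [euler_zero, sub_self, norm_zero] at h2
  by_contra! hc
  have : 0 < τ * n := by positivity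
  nlinarith [sq_nonneg ‖euler φ τ n f - f‖]

theorem IsEnergy.euler_time (hφ : IsEnergy φ) {τ : ℝ} (hτ : 0 < τ) (k j : ℕ) {f : H}
    (hf : φ f ≠ ∞) : ‖euler φ τ (k + j) f - euler φ τ k f‖ ^ 2 ≤ 2 * (τ * j) * (φ f).toReal := by
  have h0 := hφ.euler_dom hτ k hf
  have h := (hφ.euler_evi hτ k j f (Or.inl h0.1)).2 _ h0.1
  rw [sub_self, norm_zero] at h
  have h1 : (0 : ℝ) ≤ (φ (euler φ τ (k + j) f)).toReal := ENNReal.toReal_nonneg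
  have h2 : 0 ≤ 2 * (τ * j) := by positivity
  nlinarith

/-- `N` steps of size `σ` together satisfy the inequality of a single step of size `σ * N`, so the
discrete comparison applies to both schemes on the coarse grid. -/
theorem IsEnergy.euler_compare (hφ : IsEnergy φ) {σ : ℝ} (hσ : 0 < σ) {N : ℕ} (hN : N ≠ 0)
    (n : ℕ) {f : H} (hf : φ f ≠ ∞) :
    ‖euler φ (σ * N) n f - euler φ σ (n * N) f‖ ^ 2 ≤ 2 * (σ * N) * (φ f).toReal := by
  have hτ : 0 < σ * N := by positivity
  have h := norm_sub_sq_le_of_evi_steps (φ := φ) (U := fun n => euler φ (σ * N) n f)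
    (V := fun n => euler φ σ (n * N) f) (fun n => hφ.euler_step hτ n f)
    (fun n => by
      have := hφ.euler_evi hσ (n * N) N f (Or.inr hN)
      rwa [← Nat.succ_mul] at this) (by simpa [euler_zero] using hf) n
  simp only [zero_mul, euler_zero, sub_self, norm_zero] at h
  have h1 : (0 : ℝ) ≤ (φ (euler φ σ (n * N) f)).toReal := ENNReal.toReal_nonneg
  nlinarith

/-- Dyadic grids are nested: the schemes are compared at the last coarse grid point before `t`, and
fewer than `N` fine steps remain after it. Each of the two errors contributes one square root. -/
theorem IsEnergy.dist_euler_le (hφ : IsEnergy φ) {f : H} (hf : φ f ≠ ∞) {t : ℝ} (ht : 0 ≤ t)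
    {k l : ℕ} (hkl : k ≤ l) :
    dist (euler φ ((2 : ℝ) ^ l)⁻¹ ⌊t * 2 ^ l⌋₊ f) (euler φ ((2 : ℝ) ^ k)⁻¹ ⌊t * 2 ^ k⌋₊ f) ≤
      2 * √(2 * ((2 : ℝ) ^ k)⁻¹ * (φ f).toReal) := by
  obtain ⟨d, rfl⟩ := Nat.exists_eq_add_of_le hkl
  set σ : ℝ := ((2 : ℝ) ^ (k + d))⁻¹ with hσ
  set N : ℕ := 2 ^ d with hN
  set n := ⌊t * 2 ^ k⌋₊ with hn
  have hσ0 : 0 < σ := by positivity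
  have hτ : ((2 : ℝ) ^ k)⁻¹ = σ * N := by
    rw [hσ, hN]; push_cast; rw [pow_add]; field_simp
  have e1 : t * 2 ^ (k + d) = (t * 2 ^ k) * N := by rw [hN]; push_cast; ring
  have hx : 0 ≤ t * 2 ^ k := by positivity
  have hN0 : (0 : ℝ) < N := by positivity
  have hle : n * N ≤ ⌊t * 2 ^ (k + d)⌋₊ := by
    apply Nat.le_floor
    rw [e1]; push_cast
    exact mul_le_mul_of_nonneg_right (Nat.floor_le hx) hN0.le
  have hlt : ⌊t * 2 ^ (k + d)⌋₊ < n * N + N := by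
    rw [Nat.floor_lt (by positivity), e1]; push_cast
    have := Nat.lt_floor_add_one (t * 2 ^ k)
    nlinarith
  obtain ⟨j, hj⟩ := Nat.exists_eq_add_of_le hle
  have hjN : (j : ℝ) ≤ N := by exact_mod_cast (show j ≤ N by omega)
  rw [hj, hτ]
  have h1 := hφ.euler_compare hσ0 (N := N) (by positivity) n hf
  have h2 := hφ.euler_time hσ0 (n * N) j hf
  have h3 : 2 * (σ * j) * (φ f).toReal ≤ 2 * (σ * N) * (φ f).toReal := by gcongr
  have h4 := Real.le_sqrt_of_sq_le h1
  have h5 := Real.le_sqrt_of_sq_le (h2.trans h3)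
  rw [← dist_eq_norm] at h4 h5
  rw [dist_comm] at h4
  linarith [dist_triangle (euler φ σ (n * N + j) f) (euler φ σ (n * N) f) (euler φ (σ * N) n f)]

theorem IsEnergy.tendsto_gradFlow (hφ : IsEnergy φ) {t : ℝ} (ht : 0 ≤ t) (f : H) :
    Tendsto (fun k : ℕ => euler φ ((2 : ℝ) ^ k)⁻¹ ⌊t * 2 ^ k⌋₊ f) atTop (𝓝 (gradFlow φ f t)) := by
  refine CauchySeq.tendsto_limUnder ?_
  rw [Metric.cauchySeq_iff']
  intro ε hε
  -- The rate holds only for starting points of finite energy; density of the domain and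
  -- nonexpansiveness of the scheme give the other ones.
  obtain ⟨g, hg, hfg⟩ := Metric.dense_iff.1 hφ.dense_dom f (ε / 4) (by positivity)
  have hfg' : ‖f - g‖ < ε / 4 := by rw [← dist_eq_norm, dist_comm]; exact hg
  have hlim : Tendsto (fun k : ℕ => 2 * √(2 * ((2 : ℝ) ^ k)⁻¹ * (φ g).toReal)) atTop (𝓝 0) := by
    have h0 : Tendsto (fun k : ℕ => ((2 : ℝ) ^ k)⁻¹) atTop (𝓝 0) :=
      (tendsto_pow_atTop_atTop_of_one_lt one_lt_two).inv_tendsto_atTop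
    have := (Real.continuous_sqrt.tendsto _).comp ((h0.const_mul 2).mul_const (φ g).toReal)
    simpa using this.const_mul 2
  obtain ⟨N, hN⟩ := (hlim.eventually (gt_mem_nhds (show 0 < ε / 4 by positivity))).exists
  refine ⟨N, fun n hn => ?_⟩
  have h1 := hφ.dist_euler_le hfg ht hn
  have h2 := hφ.euler_nonexpansive (τ := ((2 : ℝ) ^ n)⁻¹) (by positivity) ⌊t * 2 ^ n⌋₊ f g
  have h3 := hφ.euler_nonexpansive (τ := ((2 : ℝ) ^ N)⁻¹) (by positivity) ⌊t * 2 ^ N⌋₊ g f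
  rw [norm_sub_rev g f] at h3
  rw [← dist_eq_norm] at h2 h3
  refine (dist_triangle4 _ _ _ _).trans_lt (lt_of_le_of_lt (add_le_add_three h2 h1 h3) ?_)
  linarith

/-- Closed relations that the resolvents preserve are preserved by the gradient flow. -/
theorem IsEnergy.gradFlow_mem (hφ : IsEnergy φ) {R : Set (H × H)} (hR : IsClosed R)
    (hJ : ∀ τ : ℝ, 0 < τ → ∀ f g, (f, g) ∈ R → (resolvent φ τ f, resolvent φ τ g) ∈ R)
    {t : ℝ} (ht : 0 ≤ t) {f g : H} (hfg : (f, g) ∈ R) : (gradFlow φ f t, gradFlow φ g t) ∈ R := by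
  refine hR.mem_of_tendsto ((hφ.tendsto_gradFlow ht f).prodMk_nhds (hφ.tendsto_gradFlow ht g))
    (Eventually.of_forall fun k => ?_)
  generalize ⌊t * 2 ^ k⌋₊ = n
  induction n with
  | zero => exact hfg
  | succ n ih =>
    rw [euler_succ, euler_succ]
    exact hJ _ (by positivity) _ _ ih

theorem IsEnergy.gradFlow_zero (hφ : IsEnergy φ) (f : H) : gradFlow φ f 0 = f := by
  have h := hφ.tendsto_gradFlow le_rfl f
  simp only [zero_mul, Nat.floor_zero, euler_zero] at h
  exact tendsto_nhds_unique h tendsto_const_nhds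

theorem IsEnergy.isEVI_gradFlow (hφ : IsEnergy φ) (f : H) : IsEVI φ (gradFlow φ f) := by
  intro s t hs hst
  have ht : 0 ≤ t := hs.trans hst.le
  have hfl : ∀ r : ℝ, 0 ≤ r →
      Tendsto (fun k : ℕ => ((2 : ℝ) ^ k)⁻¹ * ⌊r * 2 ^ k⌋₊) atTop (𝓝 r) := by
    intro r hr
    have := (tendsto_nat_floor_mul_div_atTop hr).comp
      (tendsto_pow_atTop_atTop_of_one_lt (one_lt_two (α := ℝ)))
    refine this.congr fun k => ?_
    simp only [Function.comp]
    rw [div_eq_inv_mul]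
  -- The EVI is solved for the energy at time `t`, the only term that is merely lower semicontinuous
  -- in the limit.
  have key : ∀ g, φ g ≠ ∞ → φ (gradFlow φ f t) ≠ ∞ ∧ (φ (gradFlow φ f t)).toReal ≤
      (φ g).toReal - (‖gradFlow φ f t - g‖ ^ 2 - ‖gradFlow φ f s - g‖ ^ 2) / (2 * (t - s)) := by
    intro g hg
    have hd := (hfl t ht).sub (hfl s hs)
    refine hφ.toReal_le_of_tendsto (hφ.tendsto_gradFlow ht f)
      (tendsto_const_nhds.sub (((((hφ.tendsto_gradFlow ht f).sub_const g).norm.pow 2).sub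
        (((hφ.tendsto_gradFlow hs f).sub_const g).norm.pow 2)).div (hd.const_mul 2)
          (by linarith))) ?_
    filter_upwards [hd.eventually (lt_mem_nhds (sub_pos.2 hst))] with k hk
    rw [Pi.div_apply]
    rw [← mul_sub] at hk ⊢
    have hp : (0 : ℝ) < ((2 : ℝ) ^ k)⁻¹ := by positivity
    have hlt : (⌊s * 2 ^ k⌋₊ : ℝ) < ⌊t * 2 ^ k⌋₊ := sub_pos.1 (pos_of_mul_pos_right hk hp.le)
    obtain ⟨j, hj⟩ := Nat.exists_eq_add_of_lt (Nat.cast_lt.1 hlt)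
    have h := hφ.euler_evi hp ⌊s * 2 ^ k⌋₊ (j + 1) f (Or.inr (Nat.succ_ne_zero j))
    rw [← add_assoc, ← hj] at h
    refine ⟨h.1, ?_⟩
    have h2 := h.2 g hg
    have e : ((j + 1 : ℕ) : ℝ) = (⌊t * 2 ^ k⌋₊ : ℝ) - ⌊s * 2 ^ k⌋₊ := by
      rw [hj]; push_cast; ring
    rw [e] at h2
    rw [le_sub_comm, div_le_iff₀ (by positivity)]
    linarith
  refine ⟨(key 0 (by simp [hφ.map_zero])).1, fun g hg => ?_⟩
  have h := (key g hg).2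
  have hpos : 0 < 2 * (t - s) := by linarith
  rw [le_sub_comm, div_le_iff₀ hpos] at h
  linarith

end Euler

section EVI

variable {u v : ℝ → H}

/-- Left difference quotients at `t` are used because the EVI on `[s, t]` contains the energy at the
right endpoint, so no continuity of the energy is required. -/
theorem IsEVI.isSubgrad (hu : IsEVI φ u) {t : ℝ} (ht : 0 < t) {l : H} (h : HasDerivAt u (-l) t) :
    IsSubgrad φ (u t) l := by
  refine ⟨hu.ne_top ht, fun g hg => ?_⟩
  have hd := ((h.sub_const g).norm_sq.tendsto_slope).mono_left
    (show 𝓝[<] t ≤ 𝓝[≠] t from nhdsWithin_mono _ fun x hx => ne_of_lt hx)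
  have h1 : 2 * inner ℝ (u t - g) (-l) ≤ 2 * ((φ g).toReal - (φ (u t)).toReal) := by
    refine le_of_tendsto hd ?_
    filter_upwards [Ioo_mem_nhdsLT ht] with s hs
    rw [slope_comm, slope_def_field, div_le_iff₀ (by linarith [hs.2])]
    linarith [(hu s t hs.1.le hs.2).2 g hg]
  have e : inner ℝ l (g - u t) = inner ℝ (u t - g) (-l) := by
    rw [real_inner_comm, ← neg_sub, inner_neg_left, inner_neg_right]
  linarith

end EVI

end GradientFlow

/-! ### Almost everywhere differentiability of Hilbert-valued Lipschitz curves. -/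

section Lipschitz

variable {H : Type*} [NormedAddCommGroup H] [InnerProductSpace ℝ H]

theorem countable_of_orthonormal [SecondCountableTopology H] {ι : Type*} {b : ι → H}
    (hb : Orthonormal ℝ b) : Countable ι := by
  have hd : Pairwise fun i j => Disjoint (Metric.ball (b i) (1 / 2))
      (Metric.ball (b j) (1 / 2)) := by
    intro i j hij
    apply Metric.ball_disjoint_ball
    have h1 : ‖b i - b j‖ ^ 2 = 2 := by
      rw [norm_sub_sq_real, hb.1 i, hb.1 j, hb.2 hij]; norm_num
    rw [dist_eq_norm]
    by_contra! hc
    nlinarith [norm_nonneg (b i - b j)]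
  exact (hd.countable_of_isOpen_disjoint (fun i => Metric.isOpen_ball)
    fun i => ⟨b i, Metric.mem_ball_self (by norm_num)⟩)

/-- Lipschitz curves in a separable Hilbert space are differentiable almost everywhere. -/
theorem _root_.LipschitzWith.ae_differentiableAt_hilbert [CompleteSpace H]
    [SecondCountableTopology H] {K : ℝ≥0} {u : ℝ → H} (hu : LipschitzWith K u) :
    ∀ᵐ t, DifferentiableAt ℝ u t := by
  classical
  obtain ⟨w, b, -⟩ := exists_hilbertBasis ℝ H
  have hcount : Countable w := countable_of_orthonormal b.orthonormal
  set d : w → ℝ → ℝ := fun i => deriv fun t => inner ℝ (b i) (u t) with hd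
  have hlip : ∀ i, LipschitzWith K fun t => inner ℝ (b i) (u t) := by
    intro i
    refine LipschitzWith.of_dist_le_mul fun x y => ?_
    rw [Real.dist_eq, ← inner_sub_right]
    refine (abs_real_inner_le_norm _ _).trans ?_
    rw [b.orthonormal.1 i, one_mul, ← dist_eq_norm]
    exact hu.dist_le_mul x y
  have hderiv : ∀ᵐ t, ∀ i, HasDerivAt (fun t => inner ℝ (b i) (u t)) (d i t) t := by
    rw [ae_all_iff]
    intro i
    filter_upwards [(hlip i).ae_differentiableAt (μ := volume)] with t ht using ht.hasDerivAt
  -- Bessel's inequality for the difference quotients, of norm at most `K`, survives the limit. The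
  -- coordinate derivatives are therefore square summable and assemble into a vector.
  have hsum : ∀ t, (∀ i, HasDerivAt (fun t => inner ℝ (b i) (u t)) (d i t) t) →
      ∀ s : Finset w, ∑ i ∈ s, ‖d i t‖ ^ (2 : ℝ≥0∞).toReal ≤ (K : ℝ) ^ (2 : ℝ≥0∞).toReal := by
    intro t ht s
    have hl : Tendsto (fun r => ∑ i ∈ s, ‖_root_.slope (fun t => inner ℝ (b i) (u t)) t r‖ ^ 2)
        (𝓝[≠] t)
        (𝓝 (∑ i ∈ s, ‖d i t‖ ^ 2)) :=
      tendsto_finsetSum _ fun i _ => ((hasDerivAt_iff_tendsto_slope.1 (ht i)).norm).pow 2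
    have : ∑ i ∈ s, ‖d i t‖ ^ 2 ≤ (K : ℝ) ^ 2 := by
      refine le_of_tendsto hl ?_
      filter_upwards [self_mem_nhdsWithin] with r hr
      have e : ∀ i, _root_.slope (fun t => inner ℝ (b i) (u t)) t r =
          inner ℝ (b i) ((r - t)⁻¹ • (u r - u t)) := by
        intro i
        rw [slope_def_field, real_inner_smul_right, inner_sub_right, div_eq_inv_mul]
      simp only [e]
      refine (b.orthonormal.sum_inner_products_le _).trans ?_
      have hrt : 0 < |r - t| := abs_pos.2 (sub_ne_zero.2 hr)
      have h1 : ‖(r - t)⁻¹ • (u r - u t)‖ ≤ K := by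
        rw [norm_smul, norm_inv, Real.norm_eq_abs, inv_mul_le_iff₀ hrt, ← dist_eq_norm,
          ← Real.dist_eq, mul_comm]
        exact hu.dist_le_mul r t
      gcongr
    simpa using this
  have hmem : ∀ t, (∀ i, HasDerivAt (fun t => inner ℝ (b i) (u t)) (d i t) t) →
      Memℓp (fun i => d i t) 2 := fun t ht => memℓp_gen' (hsum t ht)
  set ξ : ℝ → H := fun t =>
    if h : ∀ i, HasDerivAt (fun t => inner ℝ (b i) (u t)) (d i t) t
      then b.repr.symm ⟨fun i => d i t, hmem t h⟩ else 0 with hξ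
  have hmeas : AEStronglyMeasurable ξ volume := by
    refine aestronglyMeasurable_of_tendsto_ae atTop
      (f := fun (s : Finset w) t => ∑ i ∈ s, d i t • b i) (fun s => ?_) ?_
    · refine (Finset.stronglyMeasurable_fun_sum s fun i _ => ?_).aestronglyMeasurable
      exact (stronglyMeasurable_deriv _).smul_const _
    · filter_upwards [hderiv] with t ht
      have := b.hasSum_repr_symm ⟨fun i => d i t, hmem t ht⟩
      simp only [hξ, dif_pos ht]
      exact this
  have hinner : ∀ t, (∀ i, HasDerivAt (fun t => inner ℝ (b i) (u t)) (d i t) t) →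
      ∀ i, inner ℝ (b i) (ξ t) = d i t := by
    intro t ht i
    rw [← b.repr_apply_apply]
    simp only [hξ, dif_pos ht, LinearIsometryEquiv.apply_symm_apply]
  have hbound : ∀ t, ‖ξ t‖ ≤ K := by
    intro t
    simp only [hξ]
    split_ifs with h
    · rw [LinearIsometryEquiv.norm_map]
      exact lp.norm_le_of_forall_sum_le (by simp) K.2 (hsum t h)
    · simp
  have hloc : LocallyIntegrable ξ volume :=
    (memLp_top_of_bound hmeas K (Eventually.of_forall hbound)).locallyIntegrable le_top
  have hint : ∀ a c, IntervalIntegrable ξ volume a c := fun a c =>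
    intervalIntegrable_iff.2
      ((hloc.integrableOn_isCompact isCompact_uIcc).mono_set Set.uIoc_subset_uIcc)
  -- Coordinatewise this is the fundamental theorem for real Lipschitz functions; Lebesgue
  -- differentiation of the vector integral then gives a genuine derivative.
  have hFTC : ∀ t, u t = u 0 + ∫ r in (0 : ℝ)..t, ξ r := by
    intro t
    rw [← sub_eq_iff_eq_add']
    apply b.repr.injective
    ext i
    rw [b.repr_apply_apply, b.repr_apply_apply]
    have h1 := (innerSL ℝ (b i)).intervalIntegral_comp_comm (hint 0 t)
    simp only [innerSL_apply_apply] at h1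
    rw [← h1, inner_sub_right, ← ((hlip i).lipschitzOnWith.absolutelyContinuousOnInterval (a := 0)
      (b := t)).integral_deriv_eq_sub]
    refine intervalIntegral.integral_congr_ae ?_
    filter_upwards [hderiv] with r hr _
    rw [hinner r hr]
  filter_upwards [_root_.LocallyIntegrable.ae_hasDerivAt_integral hloc] with t ht
  have h2 := (ht 0).const_add (u 0)
  have e : u = fun x => u 0 + ∫ r in (0 : ℝ)..x, ξ r := funext hFTC
  rw [e]
  exact h2.differentiableAt

theorem _root_.LipschitzOnWith.ae_differentiableAt_Ici_hilbert [CompleteSpace H]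
    [SecondCountableTopology H] {K : ℝ≥0} {u : ℝ → H} {a : ℝ}
    (hu : LipschitzOnWith K u (Set.Ici a)) : ∀ᵐ t, a < t → DifferentiableAt ℝ u t := by
  have hl : LipschitzWith K fun t => u (max t a) := by
    refine LipschitzWith.of_dist_le_mul fun x y => ?_
    refine (hu.dist_le_mul _ (Set.mem_Ici.2 (le_max_right x a)) _
      (Set.mem_Ici.2 (le_max_right y a))).trans ?_
    have := (LipschitzWith.id.max_const a).dist_le_mul x y
    simp only [id, NNReal.coe_one, one_mul] at this
    gcongr
  filter_upwards [hl.ae_differentiableAt_hilbert] with t ht hat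
  refine ht.congr_of_eventuallyEq ?_
  filter_upwards [lt_mem_nhds hat] with s hs
  rw [max_eq_left hs.le]

end Lipschitz

/-! ### From the EVI to gradient flow curves, and uniqueness. -/

section Flow

variable {H : Type*} [NormedAddCommGroup H] [InnerProductSpace ℝ H] {φ : H → ℝ≥0∞}

/-- Gradient flow curves in a Hilbert space. -/
structure IsFlow (φ : H → ℝ≥0∞) (f : H) (u : ℝ → H) : Prop where
  init : u 0 = f
  tendsto_init : Tendsto u (𝓝[>] 0) (𝓝 f)
  locally_ac : ∀ a b : ℝ, 0 < a → a ≤ b → AbsolutelyContinuousOnInterval u a b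
  inclusion : ∀ᵐ t ∂(volume.restrict (Set.Ioi (0 : ℝ))),
    ∃ l : H, HasDerivAt u (-l) t ∧ IsSubgrad φ (u t) l

theorem IsEVI.isFlow [CompleteSpace H] [SecondCountableTopology H]
    (hφ : Dense {x | φ x ≠ ∞}) {u : ℝ → H} (hu : IsEVI φ u) : IsFlow φ (u 0) u := by
  refine ⟨rfl, hu.tendsto_zero hφ, fun a b ha hab => ?_, ?_⟩
  · obtain ⟨K, hK⟩ := hu.lipschitzOnWith ha
    refine (hK.mono ?_).absolutelyContinuousOnInterval
    rw [Set.uIcc_of_le hab]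
    exact Set.Icc_subset_Ici_self
  · rw [ae_restrict_iff' measurableSet_Ioi]
    have h : ∀ᵐ t : ℝ, ∀ n : ℕ, 1 / ((n : ℝ) + 1) < t → DifferentiableAt ℝ u t := by
      rw [ae_all_iff]
      intro n
      obtain ⟨K, hK⟩ := hu.lipschitzOnWith (Nat.one_div_pos_of_nat (α := ℝ) (n := n))
      exact hK.ae_differentiableAt_Ici_hilbert
    filter_upwards [h] with t ht ht0
    obtain ⟨n, hn⟩ := exists_nat_one_div_lt (show 0 < t from ht0)
    have h1 : HasDerivAt u (-(-deriv u t)) t := by rw [neg_neg]; exact (ht n hn).hasDerivAt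
    exact ⟨_, h1, hu.isSubgrad ht0 h1⟩

/-- `‖u - v‖²` is absolutely continuous on compact subintervals of `(0, ∞)`, its derivative is
nonpositive by monotonicity of the subdifferential, and it tends to `0` at time `0`. -/
theorem IsFlow.unique {f : H} {u v : ℝ → H} (hu : IsFlow φ f u) (hv : IsFlow φ f v) :
    Set.EqOn v u (Set.Ici 0) := by
  set N : ℝ → ℝ := fun t => ‖u t - v t‖ with hN
  have hanti : ∀ s t, 0 < s → s ≤ t → N t ^ 2 ≤ N s ^ 2 := by
    intro s t hs hst
    have hac : AbsolutelyContinuousOnInterval (fun t => u t - v t) s t :=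
      (hu.locally_ac s t hs hst).sub (hv.locally_ac s t hs hst)
    have hacN : AbsolutelyContinuousOnInterval N s t := by
      refine squeeze_zero (fun _ => Finset.sum_nonneg fun _ _ => dist_nonneg) (fun E => ?_) hac
      refine Finset.sum_le_sum fun i _ => ?_
      rw [Real.dist_eq, dist_eq_norm]
      exact abs_norm_sub_norm_le _ _
    have hac2 := hacN.mul hacN
    have hint := hac2.integral_deriv_eq_sub
    have hle : ∫ r in s..t, deriv (N * N) r ≤ 0 := by
      rw [intervalIntegral.integral_of_le hst]
      refine integral_nonpos_of_ae ?_
      have hsub : Set.Ioc s t ⊆ Set.Ioi 0 := fun r hr => hs.trans hr.1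
      have h1 := ae_restrict_of_ae_restrict_of_subset hsub hu.inclusion
      have h2 := ae_restrict_of_ae_restrict_of_subset hsub hv.inclusion
      filter_upwards [h1, h2] with r ⟨k, hk, hk'⟩ ⟨l, hl, hl'⟩
      have h3 := (hk.sub hl).norm_sq
      have e : (fun x => ‖(u - v) x‖ ^ 2) = N * N := by
        ext x; simp [hN, sq]
      rw [e] at h3
      rw [h3.deriv]
      have h4 := hk'.monotone hl'
      have e2 : -k - -l = -(k - l) := by abel
      rw [e2, inner_neg_right, real_inner_comm, Pi.zero_apply]
      simp only [Pi.sub_apply]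
      linarith
    rw [hint] at hle
    simp only [Pi.mul_apply] at hle
    nlinarith
  have hlim : Tendsto (fun s => N s ^ 2) (𝓝[>] 0) (𝓝 0) := by
    have := ((hu.tendsto_init.sub hv.tendsto_init).norm).pow 2
    simpa using this
  intro t ht
  rcases (show (0 : ℝ) ≤ t from ht).eq_or_lt with rfl | ht
  · rw [hu.init, hv.init]
  have : N t ^ 2 ≤ 0 := by
    refine ge_of_tendsto hlim ?_
    filter_upwards [Ioo_mem_nhdsGT ht] with s hs using hanti s t hs.1 hs.2.le
  have h0 : N t = 0 := by simpa using le_antisymm this (sq_nonneg _)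
  exact (sub_eq_zero.1 (norm_eq_zero.1 h0)).symm

end Flow

/-! ### Calculus of the local slope. -/

section Slope

variable {X : Type*} [MetricSpace X]

theorem slope_le_of_lipschitz {f : X → ℝ} {K : ℝ≥0} (hf : LipschitzWith K f) (x : X) :
    slope f x ≤ K := by
  refine limsup_le_of_le (by isBoundedDefault) ?_
  filter_upwards [self_mem_nhdsWithin] with y hy
  exact ENNReal.div_le_of_le_mul (hf y x)

theorem slope_eq_zero_of_eventually_eq {f : X → ℝ} {x : X} (h : ∀ᶠ y in 𝓝 x, f y = f x) :
    slope f x = 0 := by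
  refine le_antisymm (limsup_le_of_le (by isBoundedDefault) ?_) zero_le
  filter_upwards [mem_nhdsWithin_of_mem_nhds h] with y hy
  have : f y = f x := hy
  simp [this]

/-- The slope is controlled by a linear control of the increments. -/
theorem slope_le_of_increments {h p q : X → ℝ} {x : X} {a b : ℝ≥0}
    (hp : slope p x ≠ ∞) (hq : slope q x ≠ ∞)
    (H : ∀ ε : ℝ≥0, 0 < ε → ∀ᶠ y in 𝓝[≠] x,
      edist (h y) (h x) ≤ a * edist (p y) (p x) + b * edist (q y) (q x) + ε * edist y x) :
    slope h x ≤ a * slope p x + b * slope q x := by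
  refine ENNReal.le_of_forall_pos_le_add fun ε hε _ => ?_
  set δ : ℝ≥0 := ε / (a + b + 1) with hδ
  have hδ0 : 0 < δ := by positivity
  have hP : slope p x < slope p x + δ := ENNReal.lt_add_right hp (by exact_mod_cast hδ0.ne')
  have hQ : slope q x < slope q x + δ := ENNReal.lt_add_right hq (by exact_mod_cast hδ0.ne')
  have e : a * slope p x + b * slope q x + ε =
      a * (slope p x + δ) + b * (slope q x + δ) + δ := by
    have : (ε : ℝ≥0∞) = a * δ + b * δ + δ := by
      have : ε = a * δ + b * δ + δ := by
        rw [hδ]; field_simp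
      exact_mod_cast this
    rw [this]; ring
  rw [e]
  refine limsup_le_of_le (by isBoundedDefault) ?_
  filter_upwards [H δ hδ0, eventually_lt_of_limsup_lt hP, eventually_lt_of_limsup_lt hQ,
    self_mem_nhdsWithin] with y h1 h2 h3 hy
  have hy0 : edist y x ≠ 0 := by simpa using hy
  have hyt : edist y x ≠ ∞ := edist_ne_top _ _
  rw [ENNReal.div_le_iff hy0 hyt]
  have h2' := (ENNReal.div_le_iff hy0 hyt).1 h2.le
  have h3' := (ENNReal.div_le_iff hy0 hyt).1 h3.le
  calc edist (h y) (h x) ≤ a * edist (p y) (p x) + b * edist (q y) (q x) + δ * edist y x := h1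
    _ ≤ a * ((slope p x + δ) * edist y x) + b * ((slope q x + δ) * edist y x) + δ * edist y x := by
        gcongr
    _ = _ := by ring

/-- The supremum over the punctured ball is uncountable. For fixed `y` the constraint on `x` is open
and the quotient is continuous in `x` there, so the supremum is lower semicontinuous, hence Borel.
-/
theorem measurable_slope [MeasurableSpace X] [BorelSpace X] {f : X → ℝ} (hf : Continuous f) :
    Measurable (slope f) := by
  have e : slope f = fun x => ⨅ n : ℕ, ⨆ y : X,
      ⨆ _ : dist y x < 1 / ((n : ℝ) + 1) ∧ y ≠ x, edist (f y) (f x) / edist y x := by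
    ext x
    rw [slope, (nhdsWithin_hasBasis (Metric.nhds_basis_ball_inv_nat_succ (x := x))
      {x}ᶜ).limsup_eq_iInf_iSup]
    simp [Set.mem_inter_iff]
  rw [e]
  refine Measurable.iInf fun n => LowerSemicontinuous.measurable ?_
  refine lowerSemicontinuous_iSup fun y => ?_
  intro x c hc
  by_cases h : dist y x < 1 / ((n : ℝ) + 1) ∧ y ≠ x
  · simp only [iSup_pos h] at hc
    have hy0 : edist y x ≠ 0 := by simpa using h.2
    have h1 : Tendsto (fun x' => edist (f y) (f x') / edist y x') (𝓝 x)
        (𝓝 (edist (f y) (f x) / edist y x)) :=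
      ENNReal.Tendsto.div ((continuous_const.edist hf).tendsto x) (Or.inr hy0)
        ((continuous_const.edist continuous_id).tendsto x) (Or.inl (edist_ne_top _ _))
    have h2 : ∀ᶠ x' in 𝓝 x, dist y x' < 1 / ((n : ℝ) + 1) :=
      ((continuous_const.dist continuous_id).tendsto x).eventually (gt_mem_nhds h.1)
    have h3 : ∀ᶠ x' in 𝓝 x, y ≠ x' := by
      filter_upwards [isOpen_ne.mem_nhds h.2.symm] with x' hx' using Ne.symm hx'
    filter_upwards [h1.eventually (lt_mem_nhds hc), h2, h3] with x' h1 h2 h3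
    rw [iSup_pos ⟨h2, h3⟩]
    exact h1
  · simp only [iSup_neg h] at hc
    exact absurd hc (by simp)

theorem IsLipBdd.continuous {f : X → ℝ} (hf : IsLipBdd f) : Continuous f := by
  obtain ⟨⟨K, hK⟩, -⟩ := hf
  exact hK.continuous

theorem IsLipBdd.slope_ne_top {f : X → ℝ} (hf : IsLipBdd f) (x : X) : slope f x ≠ ∞ := by
  obtain ⟨⟨K, hK⟩, -⟩ := hf
  exact ne_top_of_le_ne_top ENNReal.coe_ne_top (slope_le_of_lipschitz hK x)

theorem IsLipBdd.add {f g : X → ℝ} (hf : IsLipBdd f) (hg : IsLipBdd g) :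
    IsLipBdd fun x => f x + g x := by
  obtain ⟨⟨K, hK⟩, C, hC⟩ := hf
  obtain ⟨⟨L, hL⟩, D, hD⟩ := hg
  exact ⟨⟨K + L, hK.add hL⟩, C + D, fun x => (abs_add_le _ _).trans (add_le_add (hC x) (hD x))⟩

theorem IsLipBdd.comp {f : X → ℝ} (hf : IsLipBdd f) {θ : ℝ → ℝ} {L : ℝ≥0} (hθ : LipschitzWith L θ) :
    IsLipBdd fun x => θ (f x) := by
  obtain ⟨⟨K, hK⟩, C, hC⟩ := hf
  refine ⟨⟨L * K, hθ.comp hK⟩, L * C + |θ 0|, fun x => ?_⟩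
  have h1 := hθ.dist_le_mul (f x) 0
  rw [Real.dist_eq, Real.dist_eq, sub_zero] at h1
  have h2 : |θ (f x)| ≤ |θ (f x) - θ 0| + |θ 0| := by
    simpa using abs_add_le (θ (f x) - θ 0) (θ 0)
  have h3 : (L : ℝ) * |f x| ≤ L * C := mul_le_mul_of_nonneg_left (hC x) L.2
  linarith

theorem IsLipBdd.const_mul {f : X → ℝ} (hf : IsLipBdd f) (c : ℝ) : IsLipBdd fun x => c * f x :=
  hf.comp (θ := fun r => c * r) (L := ‖c‖₊) (by
    refine LipschitzWith.of_dist_le_mul fun a b => ?_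
    rw [Real.dist_eq, Real.dist_eq, ← mul_sub, abs_mul]; rfl)

theorem IsLipBdd.slope_comb_le {p q : X → ℝ} (hp : IsLipBdd p) (hq : IsLipBdd q) (a b : ℝ) (x : X) :
    slope (fun x => a * p x + b * q x) x ≤ ‖a‖₊ * slope p x + ‖b‖₊ * slope q x := by
  refine slope_le_of_increments (hp.slope_ne_top x) (hq.slope_ne_top x) fun ε _ =>
    Eventually.of_forall fun y => le_add_right ?_
  simp only [edist_eq_enorm_sub]
  have e : a * p y + b * q y - (a * p x + b * q x) = a * (p y - p x) + b * (q y - q x) := by ring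
  rw [e]
  refine (enorm_add_le _ _).trans_eq ?_
  rw [enorm_mul, enorm_mul]
  rfl

/-- Exchange of a part of the increments between two functions, by a differentiable `θ`. -/
theorem slope_exchange_le {p q : X → ℝ} (hp : IsLipBdd p) (hq : IsLipBdd q) {θ : ℝ → ℝ} {x : X}
    {s : ℝ≥0} (hs : s ≤ 1) (hθ : HasDerivAt θ s (p x - q x)) :
    slope (fun x => p x - θ (p x - q x)) x ≤ (1 - s : ℝ≥0) * slope p x + s * slope q x := by
  refine slope_le_of_increments (hp.slope_ne_top x) (hq.slope_ne_top x) fun ε hε => ?_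
  obtain ⟨⟨K, hK⟩, -⟩ := hp
  obtain ⟨⟨L, hL⟩, -⟩ := hq
  have hcont : Tendsto (fun y => p y - q y) (𝓝[≠] x) (𝓝 (p x - q x)) :=
    ((hK.continuous.sub hL.continuous).tendsto x).mono_left nhdsWithin_le_nhds
  -- Increments of `p - q` are at most `(K + L) * dist y x`, so this tolerance leaves an error of at
  -- most `ε * dist y x`.
  have ho := hcont.eventually ((hasDerivAt_iff_isLittleO.1 hθ).def
    (show 0 < (ε : ℝ) / (K + L + 1) by positivity))
  filter_upwards [ho] with y hy
  simp only [smul_eq_mul, Real.norm_eq_abs] at hy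
  have h1 := hK.dist_le_mul y x
  have h2 := hL.dist_le_mul y x
  rw [Real.dist_eq] at h1 h2
  have h3 : |p y - q y - (p x - q x)| ≤ (K + L + 1) * dist y x := by
    calc |p y - q y - (p x - q x)| = |(p y - p x) - (q y - q x)| := by congr 1; ring
      _ ≤ |p y - p x| + |q y - q x| := abs_sub _ _
      _ ≤ _ := by nlinarith [dist_nonneg (x := y) (y := x)]
  have h4 : (ε : ℝ) / (K + L + 1) * |p y - q y - (p x - q x)| ≤ ε * dist y x := by
    calc (ε : ℝ) / (K + L + 1) * |p y - q y - (p x - q x)|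
        ≤ (ε : ℝ) / (K + L + 1) * ((K + L + 1) * dist y x) := by gcongr
      _ = ε * dist y x := by field_simp
  have h5 : |(p y - θ (p y - q y)) - (p x - θ (p x - q x))| ≤
      (1 - s) * |p y - p x| + s * |q y - q x| + ε * dist y x := by
    -- Linearising `θ` at `p x - q x` moves the fraction `s` of the increment from `p` to `q`, up to
    -- the remainder.
    have e : (p y - θ (p y - q y)) - (p x - θ (p x - q x)) =
        ((1 - s) * (p y - p x) + s * (q y - q x)) -
          (θ (p y - q y) - θ (p x - q x) - (p y - q y - (p x - q x)) * s) := by ring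
    rw [e]
    refine (abs_sub _ _).trans ?_
    have hs' : (s : ℝ) ≤ 1 := by exact_mod_cast hs
    have h6 : |(1 - s) * (p y - p x) + s * (q y - q x)| ≤
        (1 - s) * |p y - p x| + s * |q y - q x| := by
      refine (abs_add_le _ _).trans_eq ?_
      rw [abs_mul, abs_mul, abs_of_nonneg (show (0 : ℝ) ≤ 1 - s by linarith),
        abs_of_nonneg (NNReal.coe_nonneg s)]
    linarith
  have e1 : ((1 - s : ℝ≥0) : ℝ) = 1 - s := NNReal.coe_sub hs
  rw [← e1] at h5
  simp only [edist_dist, Real.dist_eq]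
  rw [← ENNReal.ofReal_coe_nnreal, ← ENNReal.ofReal_coe_nnreal (p := s),
    ← ENNReal.ofReal_coe_nnreal (p := ε), ← ENNReal.ofReal_mul (NNReal.coe_nonneg _),
    ← ENNReal.ofReal_mul (NNReal.coe_nonneg _), ← ENNReal.ofReal_mul (NNReal.coe_nonneg _),
    ← ENNReal.ofReal_add (by positivity) (by positivity),
    ← ENNReal.ofReal_add (by positivity) (by positivity)]
  exact ENNReal.ofReal_le_ofReal h5

end Slope

theorem _root_.ENNReal.comb_sq_le {a b : ℝ≥0} (hab : a + b = 1) {P Q : ℝ≥0∞} (hP : P ≠ ∞)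
    (hQ : Q ≠ ∞) : (a * P + b * Q) ^ 2 ≤ a * P ^ 2 + b * Q ^ 2 := by
  lift P to ℝ≥0 using hP
  lift Q to ℝ≥0 using hQ
  have hab' : (a : ℝ) + b = 1 := by exact_mod_cast hab
  have : (a * P + b * Q) ^ 2 ≤ a * P ^ 2 + b * Q ^ 2 := by
    rw [← NNReal.coe_le_coe]
    push_cast
    have e : (b : ℝ) = 1 - a := by linarith
    have hb : (0 : ℝ) ≤ 1 - a := e ▸ b.2
    rw [e]
    nlinarith [mul_nonneg (mul_nonneg (NNReal.coe_nonneg a) hb) (sq_nonneg ((P : ℝ) - Q))]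
  exact_mod_cast this

/-! ### The Cheeger energy: convexity, lower semicontinuity, homogeneity, exchange. -/

section Energy

variable {X : Type*} [MetricSpace X] [MeasurableSpace X]

/-- The energy `½ ∫ |Df|² dm`. -/
noncomputable def energy (m : Measure X) (f : X → ℝ) : ℝ≥0∞ :=
  (1 / 2 : ℝ≥0∞) * ∫⁻ x, slope f x ^ 2 ∂m

variable {m : Measure X}

theorem cheeger_le_liminf {f : Lp ℝ 2 m} {φ : ℕ → X → ℝ} (hL : ∀ n, IsLipBdd (φ n))
    (hM : ∀ n, MemLp (φ n) 2 m) (hT : Tendsto (fun n => (hM n).toLp) atTop (𝓝 f)) :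
    cheeger m f ≤ liminf (fun n => energy m (φ n)) atTop := by
  refine iInf₂_le φ ⟨fun n => ⟨hL n, hM n⟩, ?_⟩
  have := (Lp.tendsto_Lp_iff_tendsto_eLpNorm'' φ hM f (Lp.memLp f)).1
    (by rwa [Lp.toLp_coeFn])
  exact this

/-- A subsequence puts every energy below `c`, so that later estimates need not handle the liminf of
each sequence separately. -/
theorem exists_approx_of_cheeger_lt {f : Lp ℝ 2 m} {c : ℝ≥0∞} (h : cheeger m f < c) :
    ∃ (φ : ℕ → X → ℝ) (_ : ∀ n, IsLipBdd (φ n)) (hM : ∀ n, MemLp (φ n) 2 m),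
      Tendsto (fun n => (hM n).toLp) atTop (𝓝 f) ∧ ∀ n, energy m (φ n) < c := by
  obtain ⟨φ, hφ, h⟩ : ∃ φ, ∃ _ : IsLipApprox m f φ,
      liminf (fun n => energy m (φ n)) atTop < c := by
    simpa only [cheeger, energy, iInf_lt_iff] using h
  obtain ⟨ns, hns, h2⟩ := extraction_of_frequently_atTop (frequently_lt_of_liminf_lt
    (by isBoundedDefault) h)
  refine ⟨fun n => φ (ns n), fun n => (hφ.1 _).1, fun n => (hφ.1 _).2, ?_, h2⟩
  have := (Lp.tendsto_Lp_iff_tendsto_eLpNorm'' φ (fun n => (hφ.1 n).2) f (Lp.memLp f)).2 hφ.2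
  rw [Lp.toLp_coeFn] at this
  exact this.comp hns.tendsto_atTop

theorem liminf_add_liminf_le (u v : ℕ → ℝ≥0∞) :
    liminf u atTop + liminf v atTop ≤ liminf (fun n => u n + v n) atTop := by
  rw [liminf_eq_iSup_iInf_of_nat, liminf_eq_iSup_iInf_of_nat, liminf_eq_iSup_iInf_of_nat,
    ENNReal.iSup_add_iSup_of_monotone]
  · refine iSup_mono fun n => le_iInf₂ fun i hi => add_le_add (iInf₂_le i hi) (iInf₂_le i hi)
  · exact fun a b hab => le_iInf₂ fun i hi => iInf₂_le i (hab.trans hi)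
  · exact fun a b hab => le_iInf₂ fun i hi => iInf₂_le i (hab.trans hi)

theorem cheeger_zero : cheeger m (0 : Lp ℝ 2 m) = 0 := by
  have hz : ∀ x : X, slope (fun _ : X => (0 : ℝ)) x = 0 := fun x =>
    slope_eq_zero_of_eventually_eq (Eventually.of_forall fun _ => rfl)
  have h := cheeger_le_liminf (m := m) (f := 0) (φ := fun _ _ => 0)
    (fun _ => ⟨⟨0, LipschitzWith.const 0⟩, 0, by simp⟩) (fun _ => MemLp.zero)
    (tendsto_const_nhds (x := (0 : Lp ℝ 2 m)))
  refine le_antisymm (h.trans ?_) zero_le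
  simp [energy, hz]

theorem lowerSemicontinuous_cheeger : LowerSemicontinuous (cheeger m) := by
  rw [lowerSemicontinuous_iff_isClosed_preimage]
  intro c
  refine IsSeqClosed.isClosed fun x f hx hxf => ?_
  change cheeger m f ≤ c
  refine le_of_forall_gt fun d hd => ?_
  obtain ⟨c', hc, hcd⟩ := exists_between hd
  refine lt_of_le_of_lt ?_ hcd
  have hex : ∀ n : ℕ, ∃ (φ : X → ℝ) (_ : IsLipBdd φ) (hM : MemLp φ 2 m),
      dist hM.toLp (x n) < 1 / ((n : ℝ) + 1) ∧ energy m φ < c' := by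
    intro n
    obtain ⟨φ, hL, hM, hT, hE⟩ := exists_approx_of_cheeger_lt (lt_of_le_of_lt (hx n) hc)
    obtain ⟨k, hk⟩ := ((Metric.tendsto_nhds.1 hT) _
      (Nat.one_div_pos_of_nat (α := ℝ) (n := n))).exists
    exact ⟨φ k, hL k, hM k, hk, hE k⟩
  choose φ hL hM hd hE using hex
  have hT : Tendsto (fun n => (hM n).toLp) atTop (𝓝 f) := by
    rw [tendsto_iff_dist_tendsto_zero]
    have h0 := (tendsto_one_div_add_atTop_nhds_zero_nat (𝕜 := ℝ)).add
      (tendsto_iff_dist_tendsto_zero.1 hxf)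
    rw [add_zero] at h0
    refine squeeze_zero (fun _ => dist_nonneg) (fun n => ?_) h0
    exact (dist_triangle _ (x n) _).trans (by gcongr; exact (hd n).le)
  exact (cheeger_le_liminf hL hM hT).trans
    (liminf_le_of_frequently_le' (Frequently.of_forall fun n => (hE n).le))

variable [BorelSpace X]

theorem energy_comb_le {p q : X → ℝ} (hp : IsLipBdd p) (hq : IsLipBdd q) {s : ℝ} (h0 : 0 ≤ s)
    (h1 : s ≤ 1) : energy m (fun x => (1 - s) * p x + s * q x) ≤
      ENNReal.ofReal (1 - s) * energy m p + ENNReal.ofReal s * energy m q := by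
  have hmp := (measurable_slope hp.continuous).pow_const 2
  have hmq := (measurable_slope hq.continuous).pow_const 2
  have hs : ENNReal.ofReal s = ‖s‖₊ := by
    rw [← enorm_eq_nnnorm, Real.enorm_eq_ofReal h0]
  have hs' : ENNReal.ofReal (1 - s) = ‖1 - s‖₊ := by
    rw [← enorm_eq_nnnorm, Real.enorm_eq_ofReal (by linarith)]
  have hadd : ‖1 - s‖₊ + ‖s‖₊ = 1 := by
    ext
    push_cast
    rw [Real.norm_of_nonneg h0, Real.norm_of_nonneg (by linarith)]; ring
  rw [hs, hs', energy, energy, energy, mul_left_comm, mul_left_comm _ (1 / 2), ← mul_add,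
    ← lintegral_const_mul _ hmp, ← lintegral_const_mul _ hmq,
    ← lintegral_add_left (hmp.const_mul _)]
  gcongr with x
  exact (pow_le_pow_left' (hp.slope_comb_le hq _ _ x) 2).trans
    (ENNReal.comb_sq_le hadd (hp.slope_ne_top x) (hq.slope_ne_top x))

theorem energy_const_mul_le {p : X → ℝ} (hp : IsLipBdd p) (c : ℝ) :
    energy m (fun x => c * p x) ≤ ENNReal.ofReal (c ^ 2) * energy m p := by
  have hmp := (measurable_slope hp.continuous).pow_const 2
  have hc : ENNReal.ofReal (c ^ 2) = (‖c‖₊ : ℝ≥0∞) ^ 2 := by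
    rw [← sq_abs, ENNReal.ofReal_pow (abs_nonneg _), ← enorm_eq_nnnorm,
      Real.enorm_eq_ofReal_abs]
  rw [hc, energy, energy, mul_left_comm, ← lintegral_const_mul _ hmp]
  gcongr with x
  rw [← mul_pow]
  refine pow_le_pow_left' ?_ 2
  simpa using hp.slope_comb_le hp c 0 x

/-- With `s = θ' (p x - q x)`, the new slopes at `x` are bounded by `(1 - s)|Dp| + s|Dq|` and `(1 -
s)|Dq| + s|Dp|`. By convexity their squares sum to at most `|Dp|² + |Dq|²`. -/
theorem energy_exchange_le {p q : X → ℝ} (hp : IsLipBdd p) (hq : IsLipBdd q) {θ θ' : ℝ → ℝ}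
    (hθ : ∀ r, HasDerivAt θ (θ' r) r) (h0 : ∀ r, 0 ≤ θ' r) (h1 : ∀ r, θ' r ≤ 1) :
    energy m (fun x => p x - θ (p x - q x)) + energy m (fun x => q x + θ (p x - q x)) ≤
      energy m p + energy m q := by
  have hcθ : Continuous θ := continuous_iff_continuousAt.2 fun r => (hθ r).continuousAt
  have hmp := (measurable_slope hp.continuous).pow_const 2
  have hmpq := (measurable_slope (hp.continuous.sub
    (hcθ.comp (hp.continuous.sub hq.continuous)))).pow_const 2
  simp only [energy]
  rw [← mul_add, ← mul_add, ← lintegral_add_left hmp]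
  refine mul_le_mul_right (le_trans (lintegral_add_left hmpq _).ge (lintegral_mono fun x => ?_)) _
  set s : ℝ≥0 := ⟨θ' (p x - q x), h0 _⟩ with hs
  have hs1 : s ≤ 1 := h1 _
  have hab : (1 - s) + s = 1 := tsub_add_cancel_of_le hs1
  have hd1 : HasDerivAt θ s (p x - q x) := hθ _
  -- The second function is the first one with `p` and `q` interchanged and `θ` replaced by its odd
  -- reflection, whose derivative at `q x - p x` is again `s`.
  have hd2 : HasDerivAt (fun r => -θ (-r)) s (q x - p x) := by
    have h2 : HasDerivAt θ s (-(q x - p x)) := by rwa [neg_sub]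
    have := (h2.comp (q x - p x) (hasDerivAt_neg (q x - p x))).neg
    rw [mul_neg, mul_one, neg_neg] at this
    exact this
  have k1 := slope_exchange_le hp hq hs1 hd1
  have k2 := slope_exchange_le hq hp hs1 hd2
  have e : (fun x => q x - -θ (-(q x - p x))) = fun x => q x + θ (p x - q x) := by
    ext y; rw [neg_sub]; ring
  rw [e] at k2
  have hP := hp.slope_ne_top x
  have hQ := hq.slope_ne_top x
  calc _ ≤ ((1 - s : ℝ≥0) * slope p x + s * slope q x) ^ 2 +
        ((1 - s : ℝ≥0) * slope q x + s * slope p x) ^ 2 :=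
        add_le_add (pow_le_pow_left' k1 2) (pow_le_pow_left' k2 2)
    _ ≤ ((1 - s : ℝ≥0) * slope p x ^ 2 + s * slope q x ^ 2) +
        ((1 - s : ℝ≥0) * slope q x ^ 2 + s * slope p x ^ 2) :=
        add_le_add (ENNReal.comb_sq_le hab hP hQ) (ENNReal.comb_sq_le hab hQ hP)
    _ = ((1 - s + s : ℝ≥0) : ℝ≥0∞) * (slope p x ^ 2 + slope q x ^ 2) := by push_cast; ring
    _ = _ := by rw [hab]; simp

theorem cheeger_convex (x y : Lp ℝ 2 m) (s : ℝ) (h0 : 0 ≤ s) (h1 : s ≤ 1) :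
    cheeger m ((1 - s) • x + s • y) ≤
      ENNReal.ofReal (1 - s) * cheeger m x + ENNReal.ofReal s * cheeger m y := by
  rcases h0.eq_or_lt with rfl | h0'
  · simp
  rcases h1.eq_or_lt with rfl | h1'
  · simp
  have hne : ∀ {r : ℝ}, 0 < r → ENNReal.ofReal r ≠ 0 := fun hr => by simpa using hr
  by_cases hx : cheeger m x = ∞
  · rw [hx, ENNReal.mul_top (hne (by linarith)), top_add]; exact le_top
  by_cases hy : cheeger m y = ∞
  · rw [hy, ENNReal.mul_top (hne h0'), add_top]; exact le_top
  have key : ∀ ε : ℝ≥0, 0 < ε → cheeger m ((1 - s) • x + s • y) ≤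
      ENNReal.ofReal (1 - s) * (cheeger m x + ε) + ENNReal.ofReal s * (cheeger m y + ε) := by
    intro ε hε
    have hε' : (ε : ℝ≥0∞) ≠ 0 := by exact_mod_cast hε.ne'
    obtain ⟨p, hpL, hpM, hpT, hpE⟩ := exists_approx_of_cheeger_lt (ENNReal.lt_add_right hx hε')
    obtain ⟨q, hqL, hqM, hqT, hqE⟩ := exists_approx_of_cheeger_lt (ENNReal.lt_add_right hy hε')
    refine (cheeger_le_liminf (φ := fun n x => (1 - s) * p n x + s * q n x)
      (fun n => ((hpL n).const_mul _).add ((hqL n).const_mul _))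
      (fun n => ((hpM n).const_smul (1 - s)).add ((hqM n).const_smul s))
      ((hpT.const_smul (1 - s)).add (hqT.const_smul s))).trans ?_
    refine liminf_le_of_frequently_le' (Frequently.of_forall fun n => ?_)
    refine (energy_comb_le (hpL n) (hqL n) h0 h1).trans ?_
    gcongr
    · exact (hpE n).le
    · exact (hqE n).le
  refine ENNReal.le_of_forall_pos_le_add fun ε hε _ => (key ε hε).trans_eq ?_
  rw [mul_add, mul_add, add_add_add_comm, ← add_mul, ← ENNReal.ofReal_add (by linarith) h0]
  simp

theorem cheeger_smul_le (c : ℝ) (x : Lp ℝ 2 m) :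
    cheeger m (c • x) ≤ ENNReal.ofReal (c ^ 2) * cheeger m x := by
  rcases eq_or_ne c 0 with rfl | hc
  · simp [cheeger_zero]
  have hc2 : ENNReal.ofReal (c ^ 2) ≠ 0 := (ENNReal.ofReal_pos.2 (by positivity)).ne'
  by_cases hx : cheeger m x = ∞
  · rw [hx, ENNReal.mul_top hc2]; exact le_top
  refine le_of_forall_gt fun d hd => ?_
  have h1 : cheeger m x < d / ENNReal.ofReal (c ^ 2) := by
    rwa [ENNReal.lt_div_iff_mul_lt (Or.inl hc2) (Or.inl ENNReal.ofReal_ne_top), mul_comm]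
  obtain ⟨b, hb, hbd⟩ := exists_between h1
  obtain ⟨p, hpL, hpM, hpT, hpE⟩ := exists_approx_of_cheeger_lt hb
  refine lt_of_le_of_lt ((cheeger_le_liminf (φ := fun n x => c * p n x)
    (fun n => (hpL n).const_mul _) (fun n => (hpM n).const_smul c) (hpT.const_smul c)).trans
    (liminf_le_of_frequently_le' (Frequently.of_forall fun n =>
      (energy_const_mul_le (hpL n) c).trans (mul_le_mul_right (hpE n).le _)))) ?_
  rwa [ENNReal.lt_div_iff_mul_lt (Or.inl hc2) (Or.inl ENNReal.ofReal_ne_top), mul_comm] at hbd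

theorem cheeger_smul {c : ℝ} (hc : c ≠ 0) (x : Lp ℝ 2 m) :
    cheeger m (c • x) = ENNReal.ofReal (c ^ 2) * cheeger m x := by
  refine le_antisymm (cheeger_smul_le c x) ?_
  have h := cheeger_smul_le c⁻¹ (c • x)
  rw [smul_smul, inv_mul_cancel₀ hc, one_smul] at h
  refine (mul_le_mul_right h _).trans_eq ?_
  rw [← mul_assoc, ← ENNReal.ofReal_mul (sq_nonneg c), ← mul_pow, mul_inv_cancel₀ hc]
  simp

/-- Exchange between two functions does not increase the sum of their Cheeger energies. -/
theorem cheeger_exchange_le {θ θ' : ℝ → ℝ} (hθ : ∀ r, HasDerivAt θ (θ' r) r) (h0 : ∀ r, 0 ≤ θ' r)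
    (h1 : ∀ r, θ' r ≤ 1) (hl : LipschitzWith 1 θ) (hz : θ 0 = 0) (w z : Lp ℝ 2 m) :
    cheeger m (w - hl.compLp hz (w - z)) + cheeger m (z + hl.compLp hz (w - z)) ≤
      cheeger m w + cheeger m z := by
  by_cases hx : cheeger m w = ∞
  · rw [hx, top_add]; exact le_top
  by_cases hy : cheeger m z = ∞
  · rw [hy, add_top]; exact le_top
  have key : ∀ ε : ℝ≥0, 0 < ε →
      cheeger m (w - hl.compLp hz (w - z)) + cheeger m (z + hl.compLp hz (w - z)) ≤
      (cheeger m w + ε) + (cheeger m z + ε) := by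
    intro ε hε
    have hε' : (ε : ℝ≥0∞) ≠ 0 := by exact_mod_cast hε.ne'
    obtain ⟨p, hpL, hpM, hpT, hpE⟩ := exists_approx_of_cheeger_lt (ENNReal.lt_add_right hx hε')
    obtain ⟨q, hqL, hqM, hqT, hqE⟩ := exists_approx_of_cheeger_lt (ENNReal.lt_add_right hy hε')
    have hdL : ∀ n, IsLipBdd fun x => p n x - q n x := fun n => by
      simpa [sub_eq_add_neg] using (hpL n).add ((hqL n).const_mul (-1))
    have hθL : ∀ n, IsLipBdd fun x => θ (p n x - q n x) := fun n => (hdL n).comp hl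
    have hθM : ∀ n, MemLp (fun x => θ (p n x - q n x)) 2 m := fun n =>
      hl.comp_memLp hz ((hpM n).sub (hqM n))
    have hθe : ∀ n, (hθM n).toLp = hl.compLp hz ((hpM n).toLp - (hqM n).toLp) := by
      intro n
      apply Lp.ext
      filter_upwards [(hθM n).coeFn_toLp, hl.coeFn_compLp hz ((hpM n).toLp - (hqM n).toLp),
        Lp.coeFn_sub (hpM n).toLp (hqM n).toLp, (hpM n).coeFn_toLp, (hqM n).coeFn_toLp]
        with x h1 h2 h3 h4 h5
      rw [h1, h2, Function.comp, h3, Pi.sub_apply, h4, h5]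
    have hθT : Tendsto (fun n => (hθM n).toLp) atTop (𝓝 (hl.compLp hz (w - z))) := by
      simp only [hθe]
      exact ((hl.continuous_compLp hz).tendsto _).comp (hpT.sub hqT)
    have i1 := cheeger_le_liminf (φ := fun n x => p n x - θ (p n x - q n x))
      (fun n => by simpa [sub_eq_add_neg] using (hpL n).add ((hθL n).const_mul (-1)))
      (fun n => (hpM n).sub (hθM n)) (hpT.sub hθT)
    have i2 := cheeger_le_liminf (φ := fun n x => q n x + θ (p n x - q n x))
      (fun n => (hqL n).add (hθL n)) (fun n => (hqM n).add (hθM n)) (hqT.add hθT)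
    -- Both energies are relaxed along the same index, so superadditivity of the liminf keeps them
    -- together and the exchange bound applies for each `n`.
    refine (add_le_add i1 i2).trans ((liminf_add_liminf_le _ _).trans ?_)
    refine liminf_le_of_frequently_le' (Frequently.of_forall fun n => ?_)
    exact (energy_exchange_le (hpL n) (hqL n) hθ h0 h1).trans (add_le_add (hpE n).le (hqE n).le)
  refine ENNReal.le_of_forall_pos_le_add fun ε hε _ => ?_
  have h2 : 0 < ε / 2 := by positivity
  refine (key (ε / 2) h2).trans_eq ?_
  rw [add_add_add_comm, ← ENNReal.coe_add, add_halves]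

end Energy

/-! ### Density of the domain of the Cheeger energy. -/

section Density

variable {X : Type*} [MetricSpace X] [MeasurableSpace X] {m : Measure X}

theorem VolumeGrowth.measure_ball_lt_top (hm : VolumeGrowth m) :
    ∃ o : X, ∀ r : ℝ, m (Metric.ball o r) < ∞ := by
  obtain ⟨o, κ, -, h⟩ := hm
  refine ⟨o, fun r => ?_⟩
  refine (measure_mono (Metric.ball_subset_ball (le_max_left r 1))).trans_lt ?_
  exact (h _ (by positivity)).trans_lt ENNReal.ofReal_lt_top

theorem VolumeGrowth.isLocallyFiniteMeasure (hm : VolumeGrowth m) : IsLocallyFiniteMeasure m := by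
  obtain ⟨o, ho⟩ := hm.measure_ball_lt_top
  refine ⟨fun x => ⟨Metric.ball o (dist x o + 1), ?_, ho _⟩⟩
  exact Metric.isOpen_ball.mem_nhds (by simp)

variable [BorelSpace X]

theorem energy_lt_top_of_support {p : X → ℝ} {K : ℝ≥0} (hp : LipschitzWith K p) {o : X} {r : ℝ}
    (hball : m (Metric.ball o (r + 1)) < ∞) (hsupp : ∀ x, x ∉ Metric.closedBall o r → p x = 0) :
    energy m p < ∞ := by
  have hle : ∀ x, slope p x ^ 2 ≤ (Metric.ball o (r + 1)).indicator
      (fun _ => (K : ℝ≥0∞) ^ 2) x := by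
    intro x
    by_cases hx : x ∈ Metric.closedBall o r
    · have hx' : x ∈ Metric.ball o (r + 1) := Metric.closedBall_subset_ball (by linarith) hx
      rw [Set.indicator_of_mem hx']
      exact pow_le_pow_left' (slope_le_of_lipschitz hp x) 2
    · rw [slope_eq_zero_of_eventually_eq]
      · simp
      · filter_upwards [Metric.isClosed_closedBall.isOpen_compl.mem_nhds hx] with y hy
        rw [hsupp x hx, hsupp y hy]
  refine ENNReal.mul_lt_top (by simp) ((lintegral_mono hle).trans_lt ?_)
  rw [lintegral_indicator Metric.isOpen_ball.measurableSet, lintegral_const,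
    Measure.restrict_apply_univ]
  exact ENNReal.mul_lt_top (by simp) hball

theorem memLp_of_support {p : X → ℝ} (hp : Continuous p) {C : ℝ} (hC : ∀ x, |p x| ≤ C) {o : X}
    {r : ℝ} (hball : m (Metric.ball o (r + 1)) < ∞)
    (hsupp : ∀ x, x ∉ Metric.closedBall o r → p x = 0) : MemLp p 2 m := by
  have e : (Metric.ball o (r + 1)).indicator p = p := by
    rw [Set.indicator_eq_self]
    intro x hx
    by_contra hc
    exact hx (hsupp x fun h => hc (Metric.closedBall_subset_ball (by linarith) h))
  rw [← e, memLp_indicator_iff_restrict Metric.isOpen_ball.measurableSet]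
  have : IsFiniteMeasure (m.restrict (Metric.ball o (r + 1))) :=
    ⟨by rwa [Measure.restrict_apply_univ]⟩
  exact MemLp.of_bound hp.aestronglyMeasurable C (Eventually.of_forall hC)

/-- The domain of the Cheeger energy as a linear subspace. -/
noncomputable def cheegerDomain (m : Measure X) : Submodule ℝ (Lp ℝ 2 m) where
  carrier := {f | cheeger m f ≠ ∞}
  zero_mem' := by simp [cheeger_zero]
  smul_mem' c f hf := ne_top_of_le_ne_top (ENNReal.mul_ne_top ENNReal.ofReal_ne_top hf)
    (cheeger_smul_le c f)
  add_mem' {f g} hf hg := by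
    have h := cheeger_convex ((2 : ℝ) • f) ((2 : ℝ) • g) (1 / 2) (by norm_num) (by norm_num)
    have e : (1 - 1 / 2 : ℝ) • (2 : ℝ) • f + (1 / 2 : ℝ) • (2 : ℝ) • g = f + g := by
      rw [smul_smul, smul_smul]; norm_num
    rw [e] at h
    have h2 : ∀ {x : Lp ℝ 2 m}, cheeger m x ≠ ∞ → cheeger m ((2 : ℝ) • x) ≠ ∞ := fun hx =>
      ne_top_of_le_ne_top (ENNReal.mul_ne_top ENNReal.ofReal_ne_top hx) (cheeger_smul_le 2 _)
    exact ne_top_of_le_ne_top (ENNReal.add_ne_top.2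
      ⟨ENNReal.mul_ne_top ENNReal.ofReal_ne_top (h2 hf),
        ENNReal.mul_ne_top ENNReal.ofReal_ne_top (h2 hg)⟩) h

theorem toLp_mem_cheegerDomain {p : X → ℝ} {K : ℝ≥0} (hp : LipschitzWith K p) {C : ℝ}
    (hC : ∀ x, |p x| ≤ C) (hM : MemLp p 2 m) (hE : energy m p < ∞) :
    hM.toLp ∈ cheegerDomain m := by
  refine ne_top_of_le_ne_top hE.ne ((cheeger_le_liminf (φ := fun _ => p)
    (fun _ => ⟨⟨K, hp⟩, C, hC⟩) (fun _ => hM) tendsto_const_nhds).trans ?_)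
  simp

/-- A vector orthogonal to the domain is orthogonal to Lipschitz functions with bounded support,
which lie in the domain because balls about `o` have finite measure. Such functions approximate
indicators of bounded closed sets, so its integrals over these sets vanish, and it is zero. -/
theorem VolumeGrowth.dense_cheegerDomain (hm : VolumeGrowth m) :
    Dense {f : Lp ℝ 2 m | cheeger m f ≠ ∞} := by
  obtain ⟨o, ho⟩ := hm.measure_ball_lt_top
  change Dense (cheegerDomain m : Set (Lp ℝ 2 m))
  rw [Submodule.dense_iff_topologicalClosure_eq_top, Submodule.topologicalClosure_eq_top_iff,
    Submodule.eq_bot_iff]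
  intro h hh
  rw [Submodule.mem_orthogonal] at hh
  have hint : ∀ r, IntegrableOn h (Metric.ball o r) m := fun r => by
    have : IsFiniteMeasure (m.restrict (Metric.ball o r)) :=
      ⟨by rw [Measure.restrict_apply_univ]; exact ho r⟩
    exact ((Lp.memLp h).restrict _).integrable (by norm_num)
  -- integrals over bounded closed sets vanish
  have hclosed : ∀ (n : ℕ) (A : Set X), IsClosed A → A ⊆ Metric.closedBall o n →
      ∫ x in A, h x ∂m = 0 := by
    intro n A hA hAn
    set δ : ℕ → ℝ := fun k => 1 / ((k : ℝ) + 1) with hδ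
    have hδ0 : ∀ k, 0 < δ k := fun k => Nat.one_div_pos_of_nat
    have hδ1 : ∀ k, δ k ≤ 1 := fun k => by
      rw [hδ]; simp only
      rw [div_le_one (by positivity)]; linarith [Nat.cast_nonneg (α := ℝ) k]
    set p : ℕ → X → ℝ := fun k x => (thickenedIndicator (hδ0 k) A x : ℝ) with hp
    have hpL : ∀ k, LipschitzWith (δ k).toNNReal⁻¹ (p k) := fun k =>
      lipschitzWith_thickenedIndicator (hδ0 k) A
    have hpB : ∀ k x, |p k x| ≤ 1 := fun k x => by
      rw [abs_of_nonneg (NNReal.coe_nonneg _)]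
      exact_mod_cast thickenedIndicator_le_one (hδ0 k) A x
    have hps : ∀ k x, x ∉ Metric.closedBall o (n + 1 : ℝ) → p k x = 0 := by
      intro k x hx
      have : x ∉ Metric.thickening (δ k) A := by
        intro hxt
        obtain ⟨z, hz, hxz⟩ := Metric.mem_thickening_iff.1 hxt
        apply hx
        have h1 := hAn hz
        rw [Metric.mem_closedBall] at h1 ⊢
        linarith [dist_triangle x z o, hδ1 k]
      simp only [hp]
      rw [thickenedIndicator_zero (hδ0 k) A this]; rfl
    have hpM : ∀ k, MemLp (p k) 2 m := fun k =>
      memLp_of_support (hpL k).continuous (hpB k) (ho _) (hps k)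
    have hz : ∀ k, ∫ x, p k x * h x ∂m = 0 := by
      intro k
      have h1 := hh _ (toLp_mem_cheegerDomain (hpL k) (hpB k) (hpM k)
        (energy_lt_top_of_support (hpL k) (ho _) (hps k)))
      rw [L2.inner_def] at h1
      rw [← h1]
      refine integral_congr_ae ?_
      filter_upwards [(hpM k).coeFn_toLp] with x hx
      rw [hx, Real.inner_apply]
    have hlim : Tendsto (fun k => ∫ x, p k x * h x ∂m) atTop
        (𝓝 (∫ x, A.indicator (fun _ => (1 : ℝ)) x * h x ∂m)) := by
      refine tendsto_integral_of_dominated_convergence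
        ((Metric.ball o (n + 2 : ℝ)).indicator fun x => |h x|) (fun k => ?_) ?_ (fun k => ?_) ?_
      · exact (hpL k).continuous.aestronglyMeasurable.mul (Lp.aestronglyMeasurable h)
      · exact (IntegrableOn.integrable_indicator (Integrable.abs (hint _))
          Metric.isOpen_ball.measurableSet)
      · refine Eventually.of_forall fun x => ?_
        by_cases hx : x ∈ Metric.closedBall o (n + 1 : ℝ)
        · rw [Set.indicator_of_mem (Metric.closedBall_subset_ball (by linarith) hx),
            Real.norm_eq_abs, abs_mul]
          exact mul_le_of_le_one_left (abs_nonneg _) (hpB k x)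
        · rw [hps k x hx, zero_mul, norm_zero]
          exact Set.indicator_nonneg (fun _ _ => abs_nonneg _) _
      · refine Eventually.of_forall fun x => Tendsto.mul_const _ ?_
        have h1 := tendsto_pi_nhds.1 (thickenedIndicator_tendsto_indicator_closure hδ0
          tendsto_one_div_add_atTop_nhds_zero_nat A) x
        rw [hA.closure_eq] at h1
        have h2 := (NNReal.continuous_coe.tendsto _).comp h1
        have e : ((A.indicator (fun _ => (1 : ℝ≥0)) x : ℝ≥0) : ℝ) =
            A.indicator (fun _ => (1 : ℝ)) x := by
          by_cases hx : x ∈ A <;> simp [hx]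
        rw [e] at h2
        exact h2
    simp only [hz] at hlim
    have h0 := tendsto_nhds_unique tendsto_const_nhds hlim
    rw [← integral_indicator hA.measurableSet, h0]
    congr 1
    ext x
    by_cases hx : x ∈ A <;> simp [hx]
  have hn : ∀ n : ℕ, (Metric.closedBall o (n : ℝ)).indicator h =ᵐ[m] 0 := by
    intro n
    have hB := (Metric.isClosed_closedBall (x := o) (ε := (n : ℝ)))
    refine ae_eq_zero_of_forall_setIntegral_isClosed_eq_zero
      (((hint (n + 1)).mono_set (Metric.closedBall_subset_ball (by linarith))).integrable_indicator
        hB.measurableSet) fun C hC => ?_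
    rw [setIntegral_indicator hB.measurableSet]
    exact hclosed n _ (hC.inter hB) Set.inter_subset_right
  rw [Lp.eq_zero_iff_ae_eq_zero]
  filter_upwards [ae_all_iff.2 hn] with x hx
  obtain ⟨n, hxn⟩ := exists_nat_ge (dist x o)
  have := hx n
  rwa [Set.indicator_of_mem (Metric.mem_closedBall.2 hxn)] at this

theorem VolumeGrowth.isEnergy_cheeger (hm : VolumeGrowth m) : IsEnergy (cheeger m) where
  convex := cheeger_convex
  lsc := lowerSemicontinuous_cheeger
  map_zero := cheeger_zero
  dense_dom := hm.dense_cheegerDomain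

end Density

/-! ### Contraction of the positive part under the resolvents. -/

section Contraction

/-- A differentiable nondecreasing function that vanishes on the negative half-line. -/
noncomputable def smoothStep (r : ℝ) : ℝ := (max r 0) ^ 2 / (1 + (max r 0) ^ 2)

theorem smoothStep_nonneg (r : ℝ) : 0 ≤ smoothStep r := by unfold smoothStep; positivity

theorem smoothStep_le_one (r : ℝ) : smoothStep r ≤ 1 := by
  unfold smoothStep
  rw [div_le_one (by positivity)]; linarith

theorem smoothStep_of_nonpos {r : ℝ} (hr : r ≤ 0) : smoothStep r = 0 := by
  simp [smoothStep, max_eq_right hr]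

theorem continuous_smoothStep : Continuous smoothStep := by
  unfold smoothStep
  exact Continuous.div (by fun_prop) (by fun_prop) fun r => by positivity

theorem hasDerivAt_smoothStep (r : ℝ) :
    HasDerivAt smoothStep (2 * max r 0 / (1 + (max r 0) ^ 2) ^ 2) r := by
  rcases lt_trichotomy r 0 with hr | rfl | hr
  · rw [max_eq_right hr.le, mul_zero, zero_div]
    refine (hasDerivAt_const r (0 : ℝ)).congr_of_eventuallyEq ?_
    filter_upwards [gt_mem_nhds hr] with s hs using smoothStep_of_nonpos (le_of_lt hs)
  · rw [max_self, mul_zero, zero_div, hasDerivAt_iff_isLittleO]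
    have h1 : (fun s : ℝ => s ^ 2) =o[𝓝 0] fun s : ℝ => s := by
      simpa using Asymptotics.isLittleO_pow_pow (𝕜 := ℝ) (show 1 < 2 by norm_num)
    refine (Asymptotics.IsBigO.trans_isLittleO (Asymptotics.isBigO_of_le _ fun s => ?_)
      h1).congr_right
      fun s => (sub_zero s).symm
    rw [smoothStep_of_nonpos le_rfl, smul_zero, sub_zero, sub_zero, Real.norm_of_nonneg
      (smoothStep_nonneg s), Real.norm_of_nonneg (sq_nonneg s)]
    unfold smoothStep
    refine (div_le_self (by positivity) (by linarith [sq_nonneg (max s 0)])).trans ?_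
    rcases le_total s 0 with h | h
    · rw [max_eq_right h, zero_pow two_ne_zero]; exact sq_nonneg s
    · rw [max_eq_left h]
  · rw [max_eq_left hr.le]
    have h1 : HasDerivAt (fun s : ℝ => s ^ 2 / (1 + s ^ 2))
        ((2 * r * (1 + r ^ 2) - r ^ 2 * (2 * r)) / (1 + r ^ 2) ^ 2) r := by
      have h2 : HasDerivAt (fun s : ℝ => s ^ 2) (2 * r) r := by simpa using hasDerivAt_pow 2 r
      exact h2.div (h2.const_add 1) (show (1 : ℝ) + r ^ 2 ≠ 0 by positivity)
    have e : (2 * r * (1 + r ^ 2) - r ^ 2 * (2 * r)) / (1 + r ^ 2) ^ 2 =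
        2 * r / (1 + r ^ 2) ^ 2 := by
      congr 1; ring
    rw [e] at h1
    refine h1.congr_of_eventuallyEq ?_
    filter_upwards [lt_mem_nhds hr] with s hs
    rw [smoothStep, max_eq_left (le_of_lt hs)]

theorem smoothStep_deriv_mem (r : ℝ) : 0 ≤ 2 * max r 0 / (1 + (max r 0) ^ 2) ^ 2 ∧
    2 * max r 0 / (1 + (max r 0) ^ 2) ^ 2 ≤ 1 := by
  have h : 0 ≤ max r 0 := le_max_right _ _
  refine ⟨by positivity, ?_⟩
  rw [div_le_one (by positivity)]
  nlinarith [sq_nonneg (max r 0 - 1), sq_nonneg (max r 0 ^ 2)]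

/-- This scaling keeps the derivative in `[0, 1]`, while `n + 1` times the function tends to the
indicator of `(0, ∞)`. A function differentiable at every point is needed by the exchange of slopes.
-/
theorem hasDerivAt_smoothStep_scaled (n : ℕ) (r : ℝ) :
    HasDerivAt (fun r => smoothStep (((n : ℝ) + 1) * r) / ((n : ℝ) + 1))
      (2 * max (((n : ℝ) + 1) * r) 0 / (1 + (max (((n : ℝ) + 1) * r) 0) ^ 2) ^ 2) r := by
  have h := ((hasDerivAt_smoothStep (((n : ℝ) + 1) * r)).comp r
    ((hasDerivAt_id r).const_mul ((n : ℝ) + 1))).div_const ((n : ℝ) + 1)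
  have hn : ((n : ℝ) + 1) ≠ 0 := by positivity
  rw [mul_one, mul_div_assoc, div_self hn, mul_one] at h
  exact h

theorem lipschitzWith_smoothStep_scaled (n : ℕ) :
    LipschitzWith 1 fun r => smoothStep (((n : ℝ) + 1) * r) / ((n : ℝ) + 1) := by
  refine lipschitzWith_of_nnnorm_deriv_le
    (fun r => (hasDerivAt_smoothStep_scaled n r).differentiableAt) fun r => ?_
  rw [(hasDerivAt_smoothStep_scaled n r).deriv, ← NNReal.coe_le_coe, coe_nnnorm,
    Real.norm_of_nonneg (smoothStep_deriv_mem _).1]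
  exact (smoothStep_deriv_mem _).2

variable {X : Type*} [MetricSpace X] [MeasurableSpace X] [BorelSpace X] {m : Measure X}

/-- With `h = θ(w - z)`, the subgradient inequality at `w` is tested with `w - h` and the one at `z`
with `z + h`; the exchange makes the sum of the energy differences nonpositive. -/
theorem inner_exchange_le {τ : ℝ} (hτ : 0 < τ) {f g w z : Lp ℝ 2 m}
    (hw : IsSubgrad (cheeger m) w (τ⁻¹ • (f - w))) (hz : IsSubgrad (cheeger m) z (τ⁻¹ • (g - z)))
    {θ θ' : ℝ → ℝ} (hθ : ∀ r, HasDerivAt θ (θ' r) r) (h0 : ∀ r, 0 ≤ θ' r)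
    (h1 : ∀ r, θ' r ≤ 1) (hl : LipschitzWith 1 θ) (hθ0 : θ 0 = 0) :
    inner ℝ (w - z) (hl.compLp hθ0 (w - z)) ≤ inner ℝ (f - g) (hl.compLp hθ0 (w - z)) := by
  set h := hl.compLp hθ0 (w - z) with hh
  have hle := cheeger_exchange_le hθ h0 h1 hl hθ0 w z
  rw [← hh] at hle
  have hfin := ENNReal.add_ne_top.1
    (ne_top_of_le_ne_top (ENNReal.add_ne_top.2 ⟨hw.1, hz.1⟩) hle)
  have hle' := ENNReal.toReal_mono (ENNReal.add_ne_top.2 ⟨hw.1, hz.1⟩) hle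
  rw [ENNReal.toReal_add hfin.1 hfin.2, ENNReal.toReal_add hw.1 hz.1] at hle'
  have k1 := hw.2 _ hfin.1
  have k2 := hz.2 _ hfin.2
  have e1 : w - h - w = -h := by abel
  have e2 : z + h - z = h := by abel
  rw [e1, real_inner_smul_left, inner_neg_right] at k1
  rw [e2, real_inner_smul_left] at k2
  have k3 : τ⁻¹ * (inner ℝ (g - z) h - inner ℝ (f - w) h) ≤ 0 := by linarith
  have k4 : inner ℝ (g - z) h - inner ℝ (f - w) h ≤ 0 :=
    nonpos_of_mul_nonpos_right k3 (by positivity)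
  have e3 : inner ℝ (g - z) h - inner ℝ (f - w) h = inner ℝ (w - z) h - inner ℝ (f - g) h := by
    rw [← inner_sub_left, ← inner_sub_left]; congr 1; abel
  linarith

/-- The integral of the positive part of a difference does not increase under the resolvents. -/
theorem lintegral_sub_resolvent_le {τ : ℝ} (hτ : 0 < τ) {f g w z : Lp ℝ 2 m}
    (hw : IsSubgrad (cheeger m) w (τ⁻¹ • (f - w))) (hz : IsSubgrad (cheeger m) z (τ⁻¹ • (g - z))) :
    ∫⁻ x, ENNReal.ofReal ((w - z : Lp ℝ 2 m) x) ∂m ≤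
      ∫⁻ x, ENNReal.ofReal ((f - g : Lp ℝ 2 m) x) ∂m := by
  set d := w - z with hd
  set e := f - g with he
  set S : ℕ → X → ℝ := fun n x => smoothStep (((n : ℝ) + 1) * d x) with hS
  have hdm := Lp.aestronglyMeasurable d
  have hem := Lp.aestronglyMeasurable e
  have hSm : ∀ n, AEStronglyMeasurable (S n) m := fun n =>
    continuous_smoothStep.comp_aestronglyMeasurable (hdm.const_mul ((n : ℝ) + 1))
  have hn0 : ∀ n : ℕ, smoothStep (((n : ℝ) + 1) * 0) / ((n : ℝ) + 1) = 0 := fun n => by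
    rw [mul_zero, smoothStep_of_nonpos le_rfl, zero_div]
  -- Multiplication by `n + 1` turns the test function into `S n`, which takes values in `[0, 1]`:
  -- `d * S n` is nonnegative and `e * S n` is at most the positive part of `e`.
  have key : ∀ n : ℕ, ∫⁻ x, ENNReal.ofReal (d x * S n x) ∂m ≤ ∫⁻ x, ENNReal.ofReal (e x) ∂m := by
    intro n
    have hn : (0 : ℝ) < (n : ℝ) + 1 := by positivity
    have hin := inner_exchange_le hτ hw hz (hasDerivAt_smoothStep_scaled n)
      (fun r => (smoothStep_deriv_mem _).1) (fun r => (smoothStep_deriv_mem _).2)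
      (lipschitzWith_smoothStep_scaled n) (hn0 n)
    set h := (lipschitzWith_smoothStep_scaled n).compLp (hn0 n) (w - z) with hh
    have hhS : ∀ᵐ x ∂m, h x = S n x / ((n : ℝ) + 1) := by
      filter_upwards [(lipschitzWith_smoothStep_scaled n).coeFn_compLp (hn0 n) (w - z)] with x hx
      rw [hx]; rfl
    have hi : ∀ k : Lp ℝ 2 m, Integrable (fun x => k x * S n x) m ∧
        ∫ x, k x * S n x ∂m = ((n : ℝ) + 1) * inner ℝ k h := by
      intro k
      have hae : (fun x => ((n : ℝ) + 1) * inner ℝ (k x) (h x)) =ᵐ[m] fun x => k x * S n x := by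
        filter_upwards [hhS] with x hx
        rw [hx, Real.inner_apply]; field_simp
      refine ⟨((L2.integrable_inner k h).const_mul _).congr hae, ?_⟩
      rw [← integral_congr_ae hae, integral_const_mul, L2.inner_def]
    have hle : ∫ x, d x * S n x ∂m ≤ ∫ x, e x * S n x ∂m := by
      rw [(hi d).2, (hi e).2]
      exact mul_le_mul_of_nonneg_left hin hn.le
    have hpos : ∀ x, 0 ≤ d x * S n x := by
      intro x
      rcases le_total (d x) 0 with h | h
      · simp only [hS]
        rw [smoothStep_of_nonpos (mul_nonpos_of_nonneg_of_nonpos hn.le h), mul_zero]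
      · exact mul_nonneg h (smoothStep_nonneg _)
    rw [← ofReal_integral_eq_lintegral_ofReal (hi d).1 (Eventually.of_forall hpos)]
    refine (ENNReal.ofReal_le_ofReal hle).trans ?_
    refine (ENNReal.ofReal_le_ofReal (integral_mono (hi e).1 (hi e).1.pos_part
      fun x => le_max_left _ 0)).trans ?_
    rw [ofReal_integral_eq_lintegral_ofReal (hi e).1.pos_part
      (Eventually.of_forall fun x => le_max_right _ _)]
    refine lintegral_mono fun x => ENNReal.ofReal_le_of_le_toReal ?_
    rw [ENNReal.toReal_ofReal']
    refine max_le ?_ (le_max_right _ _)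
    rcases le_total (e x) 0 with h | h
    · exact (mul_nonpos_of_nonpos_of_nonneg h (smoothStep_nonneg _)).trans (le_max_right _ _)
    · exact (mul_le_of_le_one_right h (smoothStep_le_one _)).trans (le_max_left _ _)
  have hlim : ∀ x, Tendsto (fun n => ENNReal.ofReal (d x * S n x)) atTop
      (𝓝 (ENNReal.ofReal (d x))) := by
    intro x
    rcases le_or_gt (d x) 0 with h | h
    · have e : ∀ n, ENNReal.ofReal (d x * S n x) = ENNReal.ofReal (d x) := fun n => by
        rw [ENNReal.ofReal_of_nonpos h, ENNReal.ofReal_of_nonpos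
          (mul_nonpos_of_nonpos_of_nonneg h (smoothStep_nonneg _))]
      simp only [e]
      exact tendsto_const_nhds
    · refine ENNReal.tendsto_ofReal ?_
      have h1 : Tendsto (fun n : ℕ => (((n : ℝ) + 1) * d x) ^ 2) atTop atTop :=
        (tendsto_pow_atTop two_ne_zero).comp
          ((tendsto_atTop_add_const_right _ 1 tendsto_natCast_atTop_atTop).atTop_mul_const h)
      have h2 : Tendsto (fun n : ℕ => 1 - (1 + (((n : ℝ) + 1) * d x) ^ 2)⁻¹) atTop (𝓝 (1 - 0)) :=
        tendsto_const_nhds.sub (tendsto_atTop_add_const_left _ 1 h1).inv_tendsto_atTop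
      have h3 : ∀ n : ℕ, 1 - (1 + (((n : ℝ) + 1) * d x) ^ 2)⁻¹ = S n x := fun n => by
        simp only [hS, smoothStep]
        rw [max_eq_left (by positivity)]
        field_simp
        ring
      simp only [h3] at h2
      simpa using h2.const_mul (d x)
  calc ∫⁻ x, ENNReal.ofReal (d x) ∂m
      = ∫⁻ x, liminf (fun n => ENNReal.ofReal (d x * S n x)) atTop ∂m := by
        refine lintegral_congr fun x => ?_
        rw [(hlim x).liminf_eq]
    _ ≤ liminf (fun n => ∫⁻ x, ENNReal.ofReal (d x * S n x) ∂m) atTop :=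
        lintegral_liminf_le' fun n => (hdm.mul (hSm n)).aemeasurable.ennreal_ofReal
    _ ≤ ∫⁻ x, ENNReal.ofReal (e x) ∂m :=
        liminf_le_of_frequently_le' (Frequently.of_forall key)

end Contraction

/-! ### Positive parts and density in `L¹`. -/

section L1

variable {X : Type*} [MeasurableSpace X] {m : Measure X}

/-- Fatou's lemma along an a.e. convergent subsequence. In `L²` the integral of the positive part
may be infinite and is only lower semicontinuous. -/
theorem lintegral_ofReal_le_of_tendsto {p : ℝ≥0∞} [Fact (1 ≤ p)] {d : ℕ → Lp ℝ p m} {e : Lp ℝ p m}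
    (h : Tendsto d atTop (𝓝 e)) {c : ℝ≥0∞} (hc : ∀ n, ∫⁻ x, ENNReal.ofReal (d n x) ∂m ≤ c) :
    ∫⁻ x, ENNReal.ofReal (e x) ∂m ≤ c := by
  obtain ⟨ns, -, hns⟩ := (tendstoInMeasure_of_tendsto_Lp h).exists_seq_tendsto_ae
  calc ∫⁻ x, ENNReal.ofReal (e x) ∂m
      = ∫⁻ x, liminf (fun n => ENNReal.ofReal (d (ns n) x)) atTop ∂m := by
        refine lintegral_congr_ae ?_
        filter_upwards [hns] with x hx
        rw [(ENNReal.tendsto_ofReal hx).liminf_eq]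
    _ ≤ liminf (fun n => ∫⁻ x, ENNReal.ofReal (d (ns n) x) ∂m) atTop :=
        lintegral_liminf_le' fun n => (Lp.aestronglyMeasurable _).aemeasurable.ennreal_ofReal
    _ ≤ c := liminf_le_of_frequently_le' (Frequently.of_forall fun n => hc _)

theorem eLpNorm_one_eq_add (f : X → ℝ) (hf : AEStronglyMeasurable f m) :
    eLpNorm f 1 m = ∫⁻ x, ENNReal.ofReal (f x) ∂m + ∫⁻ x, ENNReal.ofReal (-f x) ∂m := by
  rw [eLpNorm_one_eq_lintegral_enorm, ← lintegral_add_left' hf.aemeasurable.ennreal_ofReal]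
  refine lintegral_congr fun x => ?_
  rw [Real.enorm_eq_ofReal_abs]
  rcases le_total 0 (f x) with h | h
  · rw [abs_of_nonneg h, ENNReal.ofReal_of_nonpos (show -f x ≤ 0 by linarith), add_zero]
  · rw [abs_of_nonpos h, ENNReal.ofReal_of_nonpos h, zero_add]

theorem denseRange_memLp_two :
    DenseRange (Subtype.val : {f : Lp ℝ 1 m // MemLp f 2 m} → Lp ℝ 1 m) := by
  refine (Lp.simpleFunc.denseRange (E := ℝ) (p := 1) (μ := m) ENNReal.one_ne_top).mono ?_
  rintro _ ⟨s, rfl⟩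
  refine ⟨⟨s, ?_⟩, rfl⟩
  refine MemLp.ae_eq (Lp.simpleFunc.toSimpleFunc_eq_toFun s) ?_
  rw [SimpleFunc.memLp_iff_integrable two_ne_zero ENNReal.ofNat_ne_top, ← memLp_one_iff_integrable]
  exact Lp.simpleFunc.memLp s

theorem enorm_posPart_eq (f : Lp ℝ 1 m) :
    ‖Lp.posPart f‖ₑ = ∫⁻ x, ENNReal.ofReal (f x) ∂m := by
  rw [Lp.enorm_def, eLpNorm_one_eq_lintegral_enorm]
  refine lintegral_congr_ae ?_
  filter_upwards [Lp.coeFn_posPart f] with x hx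
  rw [hx, Real.enorm_eq_ofReal (le_max_right _ _), ENNReal.ofReal_max, ENNReal.ofReal_zero,
    max_eq_left zero_le]

end L1

/-! ### The heat flow in `L²` and `L¹`. -/

section HeatFlow

variable {X : Type*} [MetricSpace X] [MeasurableSpace X] {m : Measure X}

theorem isGradientFlow_iff {f : Lp ℝ 2 m} {u : ℝ → Lp ℝ 2 m} :
    IsGradientFlow m f u ↔ IsFlow (cheeger m) f u :=
  ⟨fun h => ⟨h.1, h.2, h.3, h.4⟩, fun h => ⟨h.1, h.2, h.3, h.4⟩⟩

theorem IsL1Extension.unique {t : ℝ} {S T : Lp ℝ 1 m → Lp ℝ 1 m} (hS : IsL1Extension m t S)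
    (hT : IsL1Extension m t T) : S = T := by
  refine denseRange_memLp_two.equalizer hS.1 hT.1 (funext fun f => Lp.ext ?_)
  exact (hS.2 f.1 f.2.toLp f.2.coeFn_toLp.symm).trans (hT.2 f.1 f.2.toLp f.2.coeFn_toLp.symm).symm

theorem VolumeGrowth.sigmaFinite [TopologicalSpace.SeparableSpace X] (hm : VolumeGrowth m) :
    SigmaFinite m := by
  have := UniformSpace.secondCountable_of_separable X
  have := hm.isLocallyFiniteMeasure
  infer_instance

variable [BorelSpace X]

theorem isSubgrad_cheeger_smul {c : ℝ} (hc : c ≠ 0) {f l : Lp ℝ 2 m}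
    (h : IsSubgrad (cheeger m) f l) : IsSubgrad (cheeger m) (c • f) (c • l) := by
  refine ⟨ne_top_of_le_ne_top (ENNReal.mul_ne_top ENNReal.ofReal_ne_top h.1)
    (cheeger_smul_le c f), fun g hg => ?_⟩
  have hg' : cheeger m (c⁻¹ • g) ≠ ∞ :=
    ne_top_of_le_ne_top (ENNReal.mul_ne_top ENNReal.ofReal_ne_top hg) (cheeger_smul_le _ g)
  have h1 := h.2 _ hg'
  rw [cheeger_smul (inv_ne_zero hc), ENNReal.toReal_mul, ENNReal.toReal_ofReal (sq_nonneg _)] at h1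
  rw [cheeger_smul hc, ENNReal.toReal_mul, ENNReal.toReal_ofReal (sq_nonneg _),
    real_inner_smul_left]
  have e : g - c • f = c • (c⁻¹ • g - f) := by
    rw [smul_sub, smul_smul, mul_inv_cancel₀ hc, one_smul]
  rw [e, real_inner_smul_right]
  have h2 := mul_le_mul_of_nonneg_left h1 (sq_nonneg c)
  have e2 : c ^ 2 * (c⁻¹ ^ 2 * (cheeger m g).toReal - (cheeger m f).toReal) =
      (cheeger m g).toReal - c ^ 2 * (cheeger m f).toReal := by field_simp
  rw [e2] at h2
  linarith

variable [TopologicalSpace.SeparableSpace X]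

theorem VolumeGrowth.secondCountable_Lp (hm : VolumeGrowth m) :
    SecondCountableTopology (Lp ℝ 2 m) := by
  have := UniformSpace.secondCountable_of_separable X
  have := hm.sigmaFinite
  have : Fact ((2 : ℝ≥0∞) ≠ ∞) := ⟨by norm_num⟩
  infer_instance

theorem VolumeGrowth.isGradientFlow_gradFlow (hm : VolumeGrowth m) (f : Lp ℝ 2 m) :
    IsGradientFlow m f (gradFlow (cheeger m) f) := by
  have := hm.secondCountable_Lp
  have hE := hm.isEnergy_cheeger
  have h := (hE.isEVI_gradFlow f).isFlow hE.dense_dom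
  rw [hE.gradFlow_zero] at h
  exact isGradientFlow_iff.2 h

theorem VolumeGrowth.heatFlowL2_eq (hm : VolumeGrowth m) {t : ℝ} (ht : 0 ≤ t) (f : Lp ℝ 2 m) :
    heatFlowL2 m t f = gradFlow (cheeger m) f t := by
  have h := hm.isGradientFlow_gradFlow f
  have h2 : IsGradientFlow m f (Classical.epsilon fun u : ℝ → Lp ℝ 2 m => IsGradientFlow m f u) :=
    Classical.epsilon_spec ⟨_, h⟩
  exact (isGradientFlow_iff.1 h).unique (isGradientFlow_iff.1 h2) ht

/-- The integral of the positive part of a difference does not increase along the heat flow. -/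
theorem VolumeGrowth.lintegral_sub_heatFlowL2_le (hm : VolumeGrowth m) {t : ℝ} (ht : 0 ≤ t)
    (f g : Lp ℝ 2 m) :
    ∫⁻ x, ENNReal.ofReal ((heatFlowL2 m t f - heatFlowL2 m t g : Lp ℝ 2 m) x) ∂m ≤
      ∫⁻ x, ENNReal.ofReal ((f - g : Lp ℝ 2 m) x) ∂m := by
  have hE := hm.isEnergy_cheeger
  rw [hm.heatFlowL2_eq ht, hm.heatFlowL2_eq ht]
  set R : Set (Lp ℝ 2 m × Lp ℝ 2 m) := {a | ∫⁻ x, ENNReal.ofReal ((a.1 - a.2 : Lp ℝ 2 m) x) ∂m ≤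
    ∫⁻ x, ENNReal.ofReal ((f - g : Lp ℝ 2 m) x) ∂m} with hR
  have hclosed : IsClosed R := by
    refine IsSeqClosed.isClosed fun a b ha hab => ?_
    exact lintegral_ofReal_le_of_tendsto
      (((continuous_fst.tendsto b).comp hab).sub ((continuous_snd.tendsto b).comp hab)) ha
  have hmem : (f, g) ∈ R := by simp only [hR, Set.mem_ofPred_eq, le_refl]
  refine hE.gradFlow_mem hclosed (fun τ hτ f' g' h => ?_) ht hmem
  exact (lintegral_sub_resolvent_le hτ (hE.isSubgrad_resolvent hτ f')
    (hE.isSubgrad_resolvent hτ g')).trans h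

theorem VolumeGrowth.heatFlowL2_zero (hm : VolumeGrowth m) {t : ℝ} (ht : 0 ≤ t) :
    heatFlowL2 m t (0 : Lp ℝ 2 m) = 0 := by
  have hE := hm.isEnergy_cheeger
  rw [hm.heatFlowL2_eq ht]
  rcases ht.eq_or_lt with rfl | ht
  · exact hE.gradFlow_zero 0
  have h := (hE.isEVI_gradFlow 0 0 t le_rfl ht).2 0 (by simp [hE.map_zero])
  rw [hE.gradFlow_zero, hE.map_zero, sub_zero, sub_self, norm_zero, ENNReal.toReal_zero] at h
  have h2 : (0 : ℝ) ≤ (cheeger m (gradFlow (cheeger m) 0 t)).toReal := ENNReal.toReal_nonneg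
  have h3 : ‖gradFlow (cheeger m) 0 t‖ ^ 2 ≤ 0 := by nlinarith
  simpa using le_antisymm h3 (sq_nonneg _)

theorem VolumeGrowth.heatFlowL2_smul (hm : VolumeGrowth m) {t : ℝ} (ht : 0 ≤ t) (c : ℝ)
    (f : Lp ℝ 2 m) : heatFlowL2 m t (c • f) = c • heatFlowL2 m t f := by
  rcases eq_or_ne c 0 with rfl | hc
  · rw [zero_smul, zero_smul, hm.heatFlowL2_zero ht]
  have hE := hm.isEnergy_cheeger
  rw [hm.heatFlowL2_eq ht, hm.heatFlowL2_eq ht]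
  have hclosed : IsClosed {a : Lp ℝ 2 m × Lp ℝ 2 m | a.1 = c • a.2} :=
    isClosed_eq continuous_fst (continuous_snd.const_smul c)
  refine hE.gradFlow_mem (f := c • f) (g := f) hclosed (fun τ hτ f' g' h => ?_) ht rfl
  have h' : f' = c • g' := h
  -- The scaled resolvent of `g'` solves the equation for `c • g'`, because `Ch` is homogeneous of
  -- degree two; the resolvent is unique.
  subst h'
  refine (hE.isSubgrad_resolvent hτ (c • g')).resolvent_unique hτ ?_
  have := isSubgrad_cheeger_smul hc (hE.isSubgrad_resolvent hτ g')
  rwa [smul_comm, smul_sub] at this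

theorem VolumeGrowth.eLpNorm_one_sub_heatFlowL2_le (hm : VolumeGrowth m) {t : ℝ} (ht : 0 ≤ t)
    (f g : Lp ℝ 2 m) : eLpNorm (heatFlowL2 m t f - heatFlowL2 m t g : Lp ℝ 2 m) 1 m ≤
      eLpNorm (f - g : Lp ℝ 2 m) 1 m := by
  have hneg : ∀ a b : Lp ℝ 2 m, ∫⁻ x, ENNReal.ofReal (-(a - b : Lp ℝ 2 m) x) ∂m =
      ∫⁻ x, ENNReal.ofReal ((b - a : Lp ℝ 2 m) x) ∂m := by
    intro a b
    refine lintegral_congr_ae ?_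
    filter_upwards [Lp.coeFn_sub a b, Lp.coeFn_sub b a] with x h1 h2
    rw [h1, h2, Pi.sub_apply, Pi.sub_apply, neg_sub]
  rw [eLpNorm_one_eq_add _ (Lp.aestronglyMeasurable _),
    eLpNorm_one_eq_add _ (Lp.aestronglyMeasurable _), hneg, hneg]
  exact add_le_add (hm.lintegral_sub_heatFlowL2_le ht f g) (hm.lintegral_sub_heatFlowL2_le ht g f)

theorem VolumeGrowth.memLp_one_heatFlowL2 (hm : VolumeGrowth m) {t : ℝ} (ht : 0 ≤ t)
    {f : Lp ℝ 2 m} (hf : MemLp f 1 m) : MemLp (heatFlowL2 m t f) 1 m := by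
  refine ⟨Lp.aestronglyMeasurable _, ?_⟩
  have h := hm.eLpNorm_one_sub_heatFlowL2_le ht f 0
  rw [hm.heatFlowL2_zero ht, sub_zero, sub_zero] at h
  exact h.trans_lt hf.2

/-- On the dense subset `L¹ ∩ L²` the flow is nonexpansive for the `L¹` norm, so it extends by
uniform continuity. -/
theorem VolumeGrowth.exists_isL1Extension (hm : VolumeGrowth m) {t : ℝ} (ht : 0 ≤ t) :
    ∃ T : Lp ℝ 1 m → Lp ℝ 1 m, IsL1Extension m t T := by
  have hM1 : ∀ f : {f : Lp ℝ 1 m // MemLp f 2 m}, MemLp f.2.toLp 1 m := fun f =>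
    (Lp.memLp f.1).ae_eq f.2.coeFn_toLp.symm
  set T₀ : {f : Lp ℝ 1 m // MemLp f 2 m} → Lp ℝ 1 m := fun f =>
    (hm.memLp_one_heatFlowL2 ht (hM1 f)).toLp with hT₀
  have hlip : LipschitzWith 1 T₀ := by
    intro f g
    rw [ENNReal.coe_one, one_mul, edist_eq_enorm_sub, Subtype.edist_eq, edist_eq_enorm_sub,
      Lp.enorm_def, Lp.enorm_def]
    have h := hm.eLpNorm_one_sub_heatFlowL2_le ht f.2.toLp g.2.toLp
    refine (eLpNorm_congr_ae ?_).trans_le (h.trans_eq (eLpNorm_congr_ae ?_))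
    · filter_upwards [Lp.coeFn_sub (T₀ f) (T₀ g),
        Lp.coeFn_sub (heatFlowL2 m t f.2.toLp) (heatFlowL2 m t g.2.toLp),
        (hm.memLp_one_heatFlowL2 ht (hM1 f)).coeFn_toLp,
        (hm.memLp_one_heatFlowL2 ht (hM1 g)).coeFn_toLp] with x h1 h2 h3 h4
      rw [h1, h2, Pi.sub_apply, Pi.sub_apply, h3, h4]
    · filter_upwards [Lp.coeFn_sub f.1 g.1, Lp.coeFn_sub f.2.toLp g.2.toLp,
        f.2.coeFn_toLp, g.2.coeFn_toLp] with x h1 h2 h3 h4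
      rw [h1, h2, Pi.sub_apply, Pi.sub_apply, h3, h4]
  have hui : IsUniformInducing (Subtype.val : {f : Lp ℝ 1 m // MemLp f 2 m} → Lp ℝ 1 m) :=
    isUniformEmbedding_subtype_val.isUniformInducing
  refine ⟨_, (uniformContinuous_uniformly_extend hui denseRange_memLp_two
    hlip.uniformContinuous).continuous, fun f f' hff' => ?_⟩
  have hf2 : MemLp f 2 m := (Lp.memLp f').ae_eq hff'.symm
  have h1 := uniformly_extend_of_ind hui denseRange_memLp_two hlip.uniformContinuous ⟨f, hf2⟩
  have e : hf2.toLp = f' := Lp.ext (hf2.coeFn_toLp.trans hff')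
  simp only at h1
  rw [h1]
  have h2 := (hm.memLp_one_heatFlowL2 ht (hM1 ⟨f, hf2⟩)).coeFn_toLp
  simp only [e] at h2
  simp only [hT₀, e]
  exact h2

theorem VolumeGrowth.isL1Extension_heatFlow (hm : VolumeGrowth m) {t : ℝ} (ht : 0 ≤ t) :
    IsL1Extension m t (heatFlow m t) :=
  Classical.epsilon_spec (hm.exists_isL1Extension ht)

theorem VolumeGrowth.heatFlow_smul (hm : VolumeGrowth m) {t : ℝ} (ht : 0 ≤ t) (c : ℝ)
    (f : Lp ℝ 1 m) : heatFlow m t (c • f) = c • heatFlow m t f := by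
  obtain ⟨hc, hT⟩ := hm.isL1Extension_heatFlow ht
  refine congrFun (denseRange_memLp_two.equalizer (g := fun f => heatFlow m t (c • f))
    (h := fun f => c • heatFlow m t f) (hc.comp (continuous_const_smul c)) (hc.const_smul c)
    (funext fun f => Lp.ext ?_)) f
  have h1 : (c • f.1 : Lp ℝ 1 m) =ᵐ[m] (c • f.2.toLp : Lp ℝ 2 m) := by
    filter_upwards [Lp.coeFn_smul c f.1, Lp.coeFn_smul c f.2.toLp, f.2.coeFn_toLp] with x a b d
    rw [a, b, Pi.smul_apply, Pi.smul_apply, d]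
  have h2 := hT _ _ h1
  rw [hm.heatFlowL2_smul ht] at h2
  filter_upwards [h2, hT f.1 f.2.toLp f.2.coeFn_toLp.symm, Lp.coeFn_smul c (heatFlow m t f.1),
    Lp.coeFn_smul c (heatFlowL2 m t f.2.toLp)] with x a b d e
  simp only [Function.comp_apply]
  rw [a, d, e, Pi.smul_apply, Pi.smul_apply, b]

/-- In `L¹` both sides are norms of positive parts, hence continuous, so it suffices to check the
dense set `L¹ ∩ L²`. -/
theorem VolumeGrowth.lintegral_sub_heatFlow_le (hm : VolumeGrowth m) {t : ℝ} (ht : 0 ≤ t)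
    (f g : Lp ℝ 1 m) :
    ∫⁻ x, ENNReal.ofReal ((heatFlow m t f - heatFlow m t g : Lp ℝ 1 m) x) ∂m ≤
      ∫⁻ x, ENNReal.ofReal ((f - g : Lp ℝ 1 m) x) ∂m := by
  obtain ⟨hc, hT⟩ := hm.isL1Extension_heatFlow ht
  simp only [← enorm_posPart_eq]
  have hd := (denseRange_memLp_two (m := m)).prodMap (denseRange_memLp_two (m := m))
  refine hd.induction_on (p := fun a : Lp ℝ 1 m × Lp ℝ 1 m =>
    ‖Lp.posPart (heatFlow m t a.1 - heatFlow m t a.2)‖ₑ ≤ ‖Lp.posPart (a.1 - a.2)‖ₑ) (f, g) ?_ ?_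
  · refine isClosed_le ?_ ?_
    · exact (Lp.continuous_posPart.comp
        ((hc.comp continuous_fst).sub (hc.comp continuous_snd))).enorm
    · exact (Lp.continuous_posPart.comp (continuous_fst.sub continuous_snd)).enorm
  · rintro ⟨a, b⟩
    simp only [Prod.map, enorm_posPart_eq]
    have h := hm.lintegral_sub_heatFlowL2_le ht a.2.toLp b.2.toLp
    refine (lintegral_congr_ae ?_).trans_le (h.trans_eq (lintegral_congr_ae ?_))
    · filter_upwards [Lp.coeFn_sub (heatFlow m t a.1) (heatFlow m t b.1),
        Lp.coeFn_sub (heatFlowL2 m t a.2.toLp) (heatFlowL2 m t b.2.toLp),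
        hT a.1 a.2.toLp a.2.coeFn_toLp.symm, hT b.1 b.2.toLp b.2.coeFn_toLp.symm] with x h1 h2 h3 h4
      rw [h1, h2, Pi.sub_apply, Pi.sub_apply, h3, h4]
    · filter_upwards [Lp.coeFn_sub a.1 b.1, Lp.coeFn_sub a.2.toLp b.2.toLp,
        a.2.coeFn_toLp, b.2.coeFn_toLp] with x h1 h2 h3 h4
      rw [h1, h2, Pi.sub_apply, Pi.sub_apply, h3, h4]

/-- Comparison with the stationary solution `0`: the positive part of `0 - f` is null, and stays so.
-/
theorem VolumeGrowth.heatFlow_nonneg (hm : VolumeGrowth m) {t : ℝ} (ht : 0 ≤ t) {f : Lp ℝ 1 m}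
    (hf : 0 ≤ f) : 0 ≤ heatFlow m t f := by
  have h0 : heatFlow m t (0 : Lp ℝ 1 m) = 0 := by simpa using hm.heatFlow_smul ht 0 0
  have h := hm.lintegral_sub_heatFlow_le ht 0 f
  rw [h0] at h
  have hz : ∫⁻ x, ENNReal.ofReal ((0 - f : Lp ℝ 1 m) x) ∂m = 0 := by
    rw [lintegral_eq_zero_iff' (Lp.aestronglyMeasurable _).aemeasurable.ennreal_ofReal]
    filter_upwards [(Lp.coeFn_nonneg f).2 hf, Lp.coeFn_neg f] with x h1 h2
    rw [zero_sub, h2]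
    simpa using h1
  rw [hz, nonpos_iff_eq_zero,
    lintegral_eq_zero_iff' (Lp.aestronglyMeasurable _).aemeasurable.ennreal_ofReal] at h
  rw [← Lp.coeFn_nonneg]
  filter_upwards [h, Lp.coeFn_neg (heatFlow m t f)] with x h1 h2
  rw [zero_sub, h2] at h1
  simpa using h1

end HeatFlow

/-! ### Perspective functions as limits of sums of hinges. -/

section Conjugate

/-- `u ↦ c u - β` is an affine minorant of `F`. -/
def IsMinorant (F : ℝ≥0 → ℝ≥0∞) (c β : ℝ) : Prop :=
  ∀ u : ℝ≥0, ENNReal.ofReal (c * u - β) ≤ F u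

/-- The convex conjugate of `F`, where it is finite. -/
noncomputable def conjugate (F : ℝ≥0 → ℝ≥0∞) (c : ℝ) : ℝ := sInf {β | IsMinorant F c β}

variable {F : ℝ≥0 → ℝ≥0∞}

theorem IsMinorant.le (hF : F 1 = 0) {c β : ℝ} (h : IsMinorant F c β) : c ≤ β := by
  have h1 := h 1
  rw [hF, nonpos_iff_eq_zero, ENNReal.ofReal_eq_zero, NNReal.coe_one, mul_one] at h1
  linarith

theorem IsMinorant.mono {c c' β : ℝ} (h : IsMinorant F c β) (hc : c' ≤ c) : IsMinorant F c' β :=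
  fun u => (ENNReal.ofReal_le_ofReal (sub_le_sub_right
    (mul_le_mul_of_nonneg_right hc u.2) _)).trans (h u)

/-- Here `F ≥ 0` enters. Shrinking a minorant lets any slope be rounded towards `0` onto a grid
without any continuity of the conjugate. -/
theorem IsMinorant.scale {c β θ : ℝ} (h : IsMinorant F c β) (h0 : 0 ≤ θ) (h1 : θ ≤ 1) :
    IsMinorant F (θ * c) (θ * β) := by
  intro u
  have e : θ * c * u - θ * β = θ * (c * u - β) := by ring
  rw [e]
  rcases le_total 0 (c * u - β) with hs | hs
  · exact (ENNReal.ofReal_le_ofReal (mul_le_of_le_one_left hs h1)).trans (h u)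
  · rw [ENNReal.ofReal_of_nonpos (mul_nonpos_of_nonneg_of_nonpos h0 hs)]
    exact zero_le

theorem isMinorant_zero : IsMinorant F 0 0 := fun u => by simp

theorem bddBelow_isMinorant (hF : F 1 = 0) (c : ℝ) : BddBelow {β | IsMinorant F c β} :=
  ⟨c, fun _ h => IsMinorant.le hF h⟩

theorem conjugate_le (hF : F 1 = 0) {c β : ℝ} (h : IsMinorant F c β) : conjugate F c ≤ β :=
  csInf_le (bddBelow_isMinorant hF c) h

theorem isMinorant_conjugate {c : ℝ} (h : ∃ β, IsMinorant F c β) :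
    IsMinorant F c (conjugate F c) := by
  intro u
  by_cases hu : F u = ∞
  · rw [hu]; exact le_top
  rw [ENNReal.ofReal_le_iff_le_toReal hu]
  have : c * u - (F u).toReal ≤ conjugate F c := by
    refine le_csInf h fun β hβ => ?_
    have := (ENNReal.ofReal_le_iff_le_toReal hu).1 (hβ u)
    linarith
  linarith

theorem conjugate_zero (hF : F 1 = 0) : conjugate F 0 = 0 :=
  le_antisymm (conjugate_le hF isMinorant_zero)
    (IsMinorant.le hF (isMinorant_conjugate ⟨0, isMinorant_zero⟩))

theorem conjugate_midpoint_le (hF : F 1 = 0) {c d : ℝ} (hc : ∃ β, IsMinorant F c β)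
    (hd : ∃ β, IsMinorant F d β) :
    2 * conjugate F ((c + d) / 2) ≤ conjugate F c + conjugate F d := by
  have h : IsMinorant F ((c + d) / 2) ((conjugate F c + conjugate F d) / 2) := by
    intro u
    have h1 := isMinorant_conjugate hc u
    have h2 := isMinorant_conjugate hd u
    by_cases hu : F u = ∞
    · rw [hu]; exact le_top
    rw [ENNReal.ofReal_le_iff_le_toReal hu] at h1 h2 ⊢
    linarith
  have := conjugate_le hF h
  linarith

/-- Hinge sums: discrete Legendre transforms of the conjugate, with step `d`. -/
noncomputable def hingeSum (F : ℝ≥0 → ℝ≥0∞) (d : ℝ) (N : ℕ) (a b : ℝ) : ℝ≥0∞ :=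
  ∑ k ∈ Finset.range N,
    ENNReal.ofReal (d * a - (conjugate F ((k + 1 : ℕ) * d) - conjugate F (k * d)) * b)

theorem sum_hinge (hF : F 1 = 0) (d a b : ℝ) (j : ℕ) :
    ∑ k ∈ Finset.range j, (d * a - (conjugate F ((k + 1 : ℕ) * d) - conjugate F (k * d)) * b) =
      j * d * a - conjugate F (j * d) * b := by
  induction j with
  | zero => simp [conjugate_zero hF]
  | succ j ih =>
    rw [Finset.sum_range_succ, ih]; push_cast; ring

theorem ofReal_sum_le_sum_ofReal {x : ℕ → ℝ} {j N : ℕ} (hj : j ≤ N) :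
    ENNReal.ofReal (∑ k ∈ Finset.range j, x k) ≤ ∑ k ∈ Finset.range N, ENNReal.ofReal (x k) := by
  refine le_trans ?_ (Finset.sum_le_sum_of_subset (Finset.range_mono hj))
  induction j with
  | zero => simp
  | succ j ih =>
    rw [Finset.sum_range_succ, Finset.sum_range_succ]
    exact ENNReal.ofReal_add_le.trans (add_le_add_left (ih (by omega)) _)

theorem exists_sum_ofReal_eq {x : ℕ → ℝ} {N : ℕ} (hx : ∀ i j, i ≤ j → j < N → x j ≤ x i) :
    ∃ j ≤ N, ∑ k ∈ Finset.range N, ENNReal.ofReal (x k) =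
      ENNReal.ofReal (∑ k ∈ Finset.range j, x k) := by
  induction N with
  | zero => exact ⟨0, le_rfl, by simp⟩
  | succ N ih =>
    rcases le_total (x N) 0 with h | h
    · obtain ⟨j, hj, e⟩ := ih fun i j hij hj => hx i j hij (by omega)
      exact ⟨j, by omega, by rw [Finset.sum_range_succ, e, ENNReal.ofReal_of_nonpos h, add_zero]⟩
    · refine ⟨N + 1, le_rfl, (ENNReal.ofReal_sum_of_nonneg fun i hi => ?_).symm⟩
      exact h.trans (hx i N (by rw [Finset.mem_range] at hi; omega) (by omega))

theorem le_hingeSum (hF : F 1 = 0) {d : ℝ} {N j : ℕ} (hj : j ≤ N) (a b : ℝ) :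
    ENNReal.ofReal (j * d * a - conjugate F (j * d) * b) ≤ hingeSum F d N a b := by
  rw [← sum_hinge hF]
  exact ofReal_sum_le_sum_ofReal hj

/-- Midpoint convexity of the conjugate makes the hinge arguments nonincreasing in `k`. The sum of
their positive parts is then the positive part of an initial partial sum, which telescopes to a
single affine expression of slope `j * d`. -/
theorem hingeSum_eq (hF : F 1 = 0) {d : ℝ} {N : ℕ}
    (hN : ∃ β, IsMinorant F (N * d) β) (a : ℝ) {b : ℝ}
    (hb : 0 ≤ b) : ∃ j ≤ N, (∃ β, IsMinorant F (j * d) β) ∧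
      hingeSum F d N a b = ENNReal.ofReal (j * d * a - conjugate F (j * d) * b) := by
  have hex : ∀ k ≤ N, ∃ β, IsMinorant F ((k : ℝ) * d) β := by
    intro k hk
    rcases Nat.eq_zero_or_pos N with rfl | hN0
    · obtain rfl : k = 0 := by omega
      exact hN
    obtain ⟨β, hβ⟩ := hN
    have hN0' : (0 : ℝ) < N := by exact_mod_cast hN0
    have h := hβ.scale (θ := (k : ℝ) / N) (by positivity)
      ((div_le_one hN0').2 (by exact_mod_cast hk))
    have e : (k : ℝ) / N * (N * d) = k * d := by field_simp
    rw [e] at h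
    exact ⟨_, h⟩
  have hstep : ∀ k, k + 1 < N →
      d * a - (conjugate F ((k + 1 + 1 : ℕ) * d) - conjugate F ((k + 1 : ℕ) * d)) * b ≤
        d * a - (conjugate F ((k + 1 : ℕ) * d) - conjugate F (k * d)) * b := by
    intro k hk
    have h := conjugate_midpoint_le hF (hex k (by omega)) (hex (k + 1 + 1) (by omega))
    have e : ((k : ℝ) * d + ((k + 1 + 1 : ℕ) : ℝ) * d) / 2 = ((k + 1 : ℕ) : ℝ) * d := by
      push_cast; ring
    rw [e] at h
    have := mul_le_mul_of_nonneg_right h hb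
    linarith
  obtain ⟨j, hj, e⟩ := exists_sum_ofReal_eq (N := N)
    (x := fun k => d * a - (conjugate F ((k + 1 : ℕ) * d) - conjugate F (k * d)) * b) (by
      intro i j hij
      induction j, hij using Nat.le_induction with
      | base => intro _; rfl
      | succ j _ ih => intro hj; exact (hstep j hj).trans (ih (by omega)))
  exact ⟨j, hj, hex j hj, by rw [hingeSum, e, sum_hinge hF]⟩

/-- The perspective function of `F`. -/
noncomputable def persp (F : ℝ≥0 → ℝ≥0∞) (a b : ℝ) : ℝ≥0∞ :=
  if b = 0 then recession F * ENNReal.ofReal a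
  else ENNReal.ofReal b * F (a / b).toNNReal

theorem IsMinorant.le_recession {c β : ℝ} (h : IsMinorant F c β) :
    ENNReal.ofReal c ≤ recession F := by
  have hlim : Tendsto (fun r : ℝ≥0 => ENNReal.ofReal (c - β * (r : ℝ)⁻¹)) atTop
      (𝓝 (ENNReal.ofReal (c - β * 0))) :=
    ENNReal.tendsto_ofReal (tendsto_const_nhds.sub
      ((tendsto_inv_atTop_zero.comp (NNReal.tendsto_coe_atTop.2 tendsto_id)).const_mul β))
  rw [mul_zero, sub_zero] at hlim
  rw [← hlim.limsup_eq]
  refine limsup_le_limsup ?_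
  filter_upwards [eventually_gt_atTop 0] with r hr
  have hr' : (0 : ℝ) < r := hr
  rw [ENNReal.le_div_iff_mul_le (Or.inl (by exact_mod_cast hr.ne')) (Or.inl ENNReal.coe_ne_top),
    ← ENNReal.ofReal_coe_nnreal, ← ENNReal.ofReal_mul' hr'.le]
  refine (le_of_eq ?_).trans (h r)
  congr 1
  field_simp

theorem IsMinorant.le_persp {c β a b : ℝ} (h : IsMinorant F c β) (ha : 0 ≤ a) (hb : 0 ≤ b) :
    ENNReal.ofReal (c * a - β * b) ≤ persp F a b := by
  rw [persp]
  split_ifs with h0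
  · rw [h0, mul_zero, sub_zero, ENNReal.ofReal_mul' ha]
    exact mul_le_mul_left h.le_recession _
  · have hb' : 0 < b := lt_of_le_of_ne hb (Ne.symm h0)
    have h1 := h (a / b).toNNReal
    rw [Real.coe_toNNReal _ (by positivity)] at h1
    refine le_trans (le_of_eq ?_) (mul_le_mul_right h1 _)
    rw [← ENNReal.ofReal_mul hb]
    congr 1
    field_simp

theorem hingeSum_le_persp (hF : F 1 = 0) {d : ℝ} {N : ℕ}
    (hN : ∃ β, IsMinorant F (N * d) β) {a b : ℝ}
    (ha : 0 ≤ a) (hb : 0 ≤ b) : hingeSum F d N a b ≤ persp F a b := by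
  obtain ⟨j, -, hj, e⟩ := hingeSum_eq hF hN a hb
  rw [e]
  exact (isMinorant_conjugate hj).le_persp ha hb

/-- Since `F 1 = 0`, the conjugate satisfies `F*(c) ≥ c`, so slopes with the sign opposite to `a -
b` contribute nothing. The two families of `hingeApprox` thus never contribute at the same point. -/
theorem hingeSum_eq_zero (hF : F 1 = 0) {d : ℝ} {N : ℕ} (hN : ∃ β, IsMinorant F (N * d) β) {a b : ℝ}
    (hb : 0 ≤ b) (hd : d * (a - b) ≤ 0) : hingeSum F d N a b = 0 := by
  obtain ⟨j, -, hj, e⟩ := hingeSum_eq hF hN a hb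
  rw [e, ENNReal.ofReal_eq_zero]
  have h1 := mul_le_mul_of_nonneg_right (IsMinorant.le hF (isMinorant_conjugate hj)) hb
  have h2 := mul_nonpos_of_nonneg_of_nonpos (Nat.cast_nonneg (α := ℝ) j) hd
  nlinarith

/-- The number of available steps of size `d`, at most `4 ^ n`. -/
noncomputable def stepCount (F : ℝ≥0 → ℝ≥0∞) (d : ℝ) (n : ℕ) : ℕ :=
  open Classical in Nat.findGreatest (fun k => ∃ β, IsMinorant F (k * d) β) (4 ^ n)

theorem stepCount_spec (d : ℝ) (n : ℕ) : ∃ β, IsMinorant F (stepCount F d n * d) β := by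
  classical
  exact Nat.findGreatest_spec (P := fun k : ℕ => ∃ β, IsMinorant F (k * d) β) (Nat.zero_le _)
    ⟨0, by simpa using isMinorant_zero⟩

theorem le_stepCount {d : ℝ} {n j : ℕ} (hj : j ≤ 4 ^ n) (h : ∃ β, IsMinorant F (j * d) β) :
    j ≤ stepCount F d n := by
  classical
  exact Nat.le_findGreatest hj h

/-- Approximation of the perspective function from below by sums of hinges. -/
noncomputable def hingeApprox (F : ℝ≥0 → ℝ≥0∞) (n : ℕ) (a b : ℝ) : ℝ≥0∞ :=
  hingeSum F ((2 : ℝ) ^ n)⁻¹ (stepCount F ((2 : ℝ) ^ n)⁻¹ n) a b +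
    hingeSum F (-((2 : ℝ) ^ n)⁻¹) (stepCount F (-((2 : ℝ) ^ n)⁻¹) n) a b

theorem hingeApprox_le_persp (hF : F 1 = 0) (n : ℕ) {a b : ℝ} (ha : 0 ≤ a) (hb : 0 ≤ b) :
    hingeApprox F n a b ≤ persp F a b := by
  have hp : (0 : ℝ) < ((2 : ℝ) ^ n)⁻¹ := by positivity
  rw [hingeApprox]
  rcases le_total a b with hab | hab
  · rw [hingeSum_eq_zero hF (stepCount_spec _ n) hb
      (mul_nonpos_of_nonneg_of_nonpos hp.le (by linarith)), zero_add]
    exact hingeSum_le_persp hF (stepCount_spec _ n) ha hb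
  · rw [hingeSum_eq_zero hF (stepCount_spec (-((2 : ℝ) ^ n)⁻¹) n) hb
      (mul_nonpos_of_nonpos_of_nonneg (by linarith) (by linarith)), add_zero]
    exact hingeSum_le_persp hF (stepCount_spec _ n) ha hb

theorem IsMinorant.le_liminf_hingeApprox (hF : F 1 = 0) {c β : ℝ} (h : IsMinorant F c β) (a : ℝ)
    {b : ℝ} (hb : 0 ≤ b) :
    ENNReal.ofReal (c * a - β * b) ≤ liminf (fun n => hingeApprox F n a b) atTop := by
  rcases eq_or_ne c 0 with rfl | hc
  · have h1 := mul_nonneg (IsMinorant.le hF h) hb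
    rw [ENNReal.ofReal_of_nonpos (by linarith)]
    exact zero_le
  have hc0 : 0 < |c| := abs_pos.2 hc
  -- `θ n * c` is `c` rounded towards `0` to a multiple of `2⁻ⁿ`.
  set θ : ℕ → ℝ := fun n => ⌊|c| * 2 ^ n⌋₊ / 2 ^ n / |c| with hθ
  have hθlim : Tendsto θ atTop (𝓝 1) := by
    have h1 := ((tendsto_nat_floor_mul_div_atTop hc0.le).comp
      (tendsto_pow_atTop_atTop_of_one_lt (one_lt_two (α := ℝ)))).div_const |c|
    rwa [div_self hc0.ne'] at h1
  have hlim : Tendsto (fun n => ENNReal.ofReal (θ n * (c * a - β * b))) atTop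
      (𝓝 (ENNReal.ofReal (1 * (c * a - β * b)))) := ENNReal.tendsto_ofReal (hθlim.mul_const _)
  rw [one_mul] at hlim
  rw [← hlim.liminf_eq]
  refine liminf_le_liminf ?_
  filter_upwards [(tendsto_pow_atTop_atTop_of_one_lt (one_lt_two (α := ℝ))).eventually
    (eventually_ge_atTop |c|)] with n hn
  have hp : (0 : ℝ) < 2 ^ n := by positivity
  set j := ⌊|c| * 2 ^ n⌋₊ with hj
  have hfl : (j : ℝ) ≤ |c| * 2 ^ n := Nat.floor_le (by positivity)
  have hθ0 : 0 ≤ θ n := by positivity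
  have hθ1 : θ n ≤ 1 := by
    simp only [hθ]
    rw [div_div, div_le_one (by positivity)]
    linarith
  -- `4 ^ n` steps of size `2⁻ⁿ` reach slope `2 ^ n`, which exceeds `|c|` eventually.
  have hjn : j ≤ 4 ^ n := by
    have h1 : (j : ℝ) ≤ (4 : ℝ) ^ n := by
      calc (j : ℝ) ≤ |c| * 2 ^ n := hfl
        _ ≤ 2 ^ n * 2 ^ n := by gcongr
        _ = 4 ^ n := by rw [← mul_pow]; norm_num
    exact_mod_cast h1
  have hθj : θ n = j / 2 ^ n / |c| := rfl
  have hmin := h.scale hθ0 hθ1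
  have key : ∀ d : ℝ, (j : ℝ) * d = θ n * c →
      ENNReal.ofReal (θ n * (c * a - β * b)) ≤ hingeSum F d (stepCount F d n) a b := by
    intro d hd
    refine le_trans (ENNReal.ofReal_le_ofReal ?_)
      (le_hingeSum hF (le_stepCount hjn ⟨_, by rw [hd]; exact hmin⟩) a b)
    rw [hd]
    have := mul_le_mul_of_nonneg_right (conjugate_le hF hmin) hb
    linarith
  rcases lt_or_gt_of_ne hc with hneg | hpos
  · refine (key (-((2 : ℝ) ^ n)⁻¹) ?_).trans le_add_self
    rw [hθj, abs_of_neg hneg]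
    field_simp
  · refine (key ((2 : ℝ) ^ n)⁻¹ ?_).trans le_self_add
    rw [hθj, abs_of_pos hpos]
    field_simp

end Conjugate

/-! ### Affine minorants by Hahn-Banach separation. -/

section Duality

variable {F : ℝ≥0 → ℝ≥0∞}

/-- A convex lower semicontinuous function is the supremum of its affine minorants. -/
theorem IsCsiszarDensity.exists_isMinorant (hF : IsCsiszarDensity F) (s : ℝ≥0) {t : ℝ}
    (ht : ENNReal.ofReal t < F s) : ∃ c β : ℝ, IsMinorant F c β ∧ t < c * s - β := by
  set E : Set (ℝ × ℝ) := {p | 0 ≤ p.1 ∧ 0 ≤ p.2 ∧ F p.1.toNNReal ≤ ENNReal.ofReal p.2} with hE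
  have hmem : ∀ p : ℝ × ℝ, p ∈ E ↔ 0 ≤ p.1 ∧ 0 ≤ p.2 ∧ F p.1.toNNReal ≤ ENNReal.ofReal p.2 :=
    fun p => Iff.rfl
  have hconv : Convex ℝ E := by
    intro p hp q hq a b ha hb hab
    rw [hmem] at hp hq ⊢
    obtain ⟨hp1, hp2, hp3⟩ := hp
    obtain ⟨hq1, hq2, hq3⟩ := hq
    have h1 : (a • p + b • q).1 = a * p.1 + b * q.1 := rfl
    have h2 : (a • p + b • q).2 = a * p.2 + b * q.2 := rfl
    rw [h1, h2]
    refine ⟨by positivity, by positivity, ?_⟩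
    lift a to ℝ≥0 using ha
    lift b to ℝ≥0 using hb
    have h := hF.convex.2 (Set.mem_univ p.1.toNNReal) (Set.mem_univ q.1.toNNReal)
      (zero_le : 0 ≤ a) (zero_le : 0 ≤ b) (NNReal.eq hab)
    have e : a • p.1.toNNReal + b • q.1.toNNReal = (a * p.1 + b * q.1).toNNReal := by
      apply NNReal.eq
      rw [Real.coe_toNNReal _ (by positivity)]
      simp [Real.coe_toNNReal _ hp1, Real.coe_toNNReal _ hq1]
    rw [e] at h
    refine h.trans ?_
    rw [ENNReal.smul_def, ENNReal.smul_def, smul_eq_mul, smul_eq_mul,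
      ENNReal.ofReal_add (by positivity) (by positivity), ENNReal.ofReal_mul a.coe_nonneg,
      ENNReal.ofReal_mul b.coe_nonneg, ENNReal.ofReal_coe_nnreal, ENNReal.ofReal_coe_nnreal]
    gcongr
  have hclosed : IsClosed E := by
    refine (isClosed_le continuous_const continuous_fst).inter
      ((isClosed_le continuous_const continuous_snd).inter ?_)
    exact hF.lsc.isClosed_epigraph.preimage
      ((continuous_real_toNNReal.comp continuous_fst).prodMk
        (ENNReal.continuous_ofReal.comp continuous_snd))
  have hnot : ((s : ℝ), t) ∉ E := by
    rw [hmem]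
    rintro ⟨-, -, h⟩
    simp only [Real.toNNReal_coe] at h
    exact absurd ht (not_lt.2 h)
  obtain ⟨f, u, hfs, hfE⟩ := geometric_hahn_banach_point_closed hconv hclosed hnot
  set α := f (1, 0) with hα
  set γ := f (0, 1) with hγ
  have hf : ∀ x y : ℝ, f (x, y) = α * x + γ * y := by
    intro x y
    have e : ((x, y) : ℝ × ℝ) = x • ((1, 0) : ℝ × ℝ) + y • ((0, 1) : ℝ × ℝ) := by simp
    rw [e, map_add, map_smul, map_smul, smul_eq_mul, smul_eq_mul, mul_comm, mul_comm y]
  rw [hf] at hfs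
  -- The vertical ray over `1` lies in the epigraph because `F 1 = 0`; this forces `γ ≥ 0`.
  have hup : ∀ y : ℝ, 0 ≤ y → u < α * 1 + γ * y := by
    intro y hy
    rw [← hf]
    refine hfE _ ((hmem _).2 ⟨zero_le_one, hy, ?_⟩)
    simp only [Real.toNNReal_one, hF.map_one]
    exact zero_le
  have hγ0 : 0 ≤ γ := by
    by_contra! hneg
    have h1 := hup ((u - α) / γ ⊔ 0) (le_max_right _ _)
    have h2 : γ * ((u - α) / γ ⊔ 0) ≤ γ * ((u - α) / γ) :=
      mul_le_mul_of_nonpos_left (le_max_left _ _) hneg.le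
    rw [mul_div_cancel₀ _ hneg.ne] at h2
    linarith
  have hdom : ∀ x : ℝ≥0, F x ≠ ∞ → u < α * x + γ * (F x).toReal := by
    intro x hx
    rw [← hf]
    refine hfE _ ((hmem _).2 ⟨x.2, ENNReal.toReal_nonneg, ?_⟩)
    simp only [Real.toNNReal_coe]
    rw [ENNReal.ofReal_toReal hx]
  rcases hγ0.eq_or_lt with h0 | hpos
  -- Vertical separating line: `s` lies outside the domain. Affine functions that are nonpositive on
  -- the domain and positive at `s` are minorants, and a large multiple exceeds `t` at `s`.
  · rw [← h0] at hfs hdom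
    have hgap : 0 < u - α * s := by linarith
    obtain ⟨n, hn⟩ := exists_nat_gt (t / (u - α * s))
    rw [div_lt_iff₀ hgap] at hn
    refine ⟨-(n * α), -(n * u), fun x => ?_, by linarith⟩
    by_cases hx : F x = ∞
    · rw [hx]; exact le_top
    have h1 := hdom x hx
    have h2 : (0 : ℝ) ≤ n * (α * x - u) := mul_nonneg (Nat.cast_nonneg _) (by linarith)
    rw [ENNReal.ofReal_of_nonpos (by linarith)]
    exact zero_le
  · refine ⟨-(α / γ), -(u / γ), fun x => ?_, ?_⟩
    · by_cases hx : F x = ∞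
      · rw [hx]; exact le_top
      rw [ENNReal.ofReal_le_iff_le_toReal hx]
      have h1 := hdom x hx
      have e : -(α / γ) * x - -(u / γ) = (u - α * x) / γ := by ring
      rw [e, div_le_iff₀ hpos]
      linarith
    · have e : -(α / γ) * s - -(u / γ) = (u - α * s) / γ := by ring
      rw [e, lt_div_iff₀ hpos]
      linarith

/-- Some `r > 1` has `c r < F r`, and a minorant exceeds `c r` there. As it is nonpositive at `1`,
its slope must be at least `c`, and lowering the slope to `c` keeps a minorant. -/
theorem IsCsiszarDensity.exists_isMinorant_of_lt_recession (hF : IsCsiszarDensity F) {c : ℝ}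
    (hc0 : 0 ≤ c) (hc : ENNReal.ofReal c < recession F) : ∃ β, IsMinorant F c β := by
  have h1 := frequently_lt_of_lt_limsup (by isBoundedDefault) hc
  obtain ⟨r, hr, hr1⟩ := (h1.and_eventually (eventually_gt_atTop (1 : ℝ≥0))).exists
  have hr0 : (r : ℝ≥0∞) ≠ 0 := by
    have : r ≠ 0 := (zero_lt_one.trans hr1).ne'
    exact_mod_cast this
  rw [ENNReal.lt_div_iff_mul_lt (Or.inl hr0) (Or.inl ENNReal.coe_ne_top),
    ← ENNReal.ofReal_coe_nnreal, ← ENNReal.ofReal_mul hc0] at hr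
  obtain ⟨c', β, h, h2⟩ := hF.exists_isMinorant r hr
  have h3 := h.le hF.map_one
  have hr1' : (1 : ℝ) < r := hr1
  refine ⟨β, h.mono ?_⟩
  by_contra! hlt
  nlinarith

/-- The liminf dominates every affine minorant, and the perspective is their supremum; for `b = 0`
this uses that every nonnegative slope below `F'(∞)` admits a minorant. -/
theorem IsCsiszarDensity.persp_le_liminf (hF : IsCsiszarDensity F) {a b : ℝ} (ha : 0 ≤ a)
    (hb : 0 ≤ b) : persp F a b ≤ liminf (fun n => hingeApprox F n a b) atTop := by
  have key : ∀ {c β : ℝ}, IsMinorant F c β →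
      ENNReal.ofReal (c * a - β * b) ≤ liminf (fun n => hingeApprox F n a b) atTop :=
    fun h => h.le_liminf_hingeApprox hF.map_one a hb
  rw [persp]
  split_ifs with h0
  · subst h0
    rcases ha.eq_or_lt with rfl | ha
    · simp
    refine le_of_forall_lt fun x hx => ?_
    have ha' : ENNReal.ofReal a ≠ 0 := (ENNReal.ofReal_pos.2 ha).ne'
    have hxt : x ≠ ∞ := hx.ne_top
    have hx' : x / ENNReal.ofReal a < recession F :=
      ENNReal.div_lt_of_lt_mul hx
    obtain ⟨c, hc1, hc2⟩ := ENNReal.lt_iff_exists_nnreal_btwn.1 hx'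
    rw [← ENNReal.ofReal_coe_nnreal] at hc1 hc2
    obtain ⟨β, hβ⟩ := hF.exists_isMinorant_of_lt_recession c.2 hc2
    refine lt_of_lt_of_le ?_ (key hβ)
    rw [mul_zero, sub_zero, ENNReal.ofReal_mul c.2]
    exact (ENNReal.div_lt_iff (Or.inl ha') (Or.inl ENNReal.ofReal_ne_top)).1 hc1
  · have hb' : 0 < b := lt_of_le_of_ne hb (Ne.symm h0)
    have hbe : ENNReal.ofReal b ≠ 0 := (ENNReal.ofReal_pos.2 hb').ne'
    refine le_of_forall_lt fun x hx => ?_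
    rw [mul_comm] at hx
    have hx' : x / ENNReal.ofReal b < F (a / b).toNNReal := ENNReal.div_lt_of_lt_mul hx
    obtain ⟨t, ht1, ht2⟩ := ENNReal.lt_iff_exists_nnreal_btwn.1 hx'
    rw [← ENNReal.ofReal_coe_nnreal] at ht1 ht2
    obtain ⟨c, β, h, h2⟩ := hF.exists_isMinorant _ ht2
    rw [Real.coe_toNNReal _ (by positivity)] at h2
    refine lt_of_lt_of_le ((ENNReal.div_lt_iff (Or.inl hbe) (Or.inl ENNReal.ofReal_ne_top)).1 ht1)
      ((le_trans (le_of_eq (ENNReal.ofReal_mul t.2).symm)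
        (ENNReal.ofReal_le_ofReal ?_)).trans (key h))
    have h3 := mul_le_mul_of_nonneg_right h2.le hb
    refine h3.trans_eq ?_
    field_simp

end Duality

/-! ### The divergence as an integral of the perspective function. -/

section Divergence

variable {X : Type*} [MeasurableSpace X] {m : Measure X} {F : ℝ≥0 → ℝ≥0∞}

/-- Functionals with perspective integrands decrease if all hinge functionals do. -/
theorem IsCsiszarDensity.lintegral_persp_le (hF : IsCsiszarDensity F) {f g f' g' : X → ℝ}
    (hfm : AEMeasurable f m) (hgm : AEMeasurable g m)
    (hfm' : AEMeasurable f' m) (hgm' : AEMeasurable g' m)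
    (hf : 0 ≤ᵐ[m] f) (hg : 0 ≤ᵐ[m] g) (hf' : 0 ≤ᵐ[m] f') (hg' : 0 ≤ᵐ[m] g')
    (h : ∀ α β : ℝ, ∫⁻ x, ENNReal.ofReal (α * f' x - β * g' x) ∂m ≤
      ∫⁻ x, ENNReal.ofReal (α * f x - β * g x) ∂m) :
    ∫⁻ x, persp F (f' x) (g' x) ∂m ≤ ∫⁻ x, persp F (f x) (g x) ∂m := by
  have hmeas : ∀ {p q : X → ℝ}, AEMeasurable p m → AEMeasurable q m → ∀ d N,
      AEMeasurable (fun x => hingeSum F d N (p x) (q x)) m := by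
    intro p q hp hq d N
    exact Finset.aemeasurable_fun_sum _ fun k _ =>
      ((hp.const_mul _).sub (hq.const_mul _)).ennreal_ofReal
  have hsum : ∀ d N, ∫⁻ x, hingeSum F d N (f' x) (g' x) ∂m ≤
      ∫⁻ x, hingeSum F d N (f x) (g x) ∂m := by
    intro d N
    have hm1 : ∀ {p q : X → ℝ}, AEMeasurable p m → AEMeasurable q m → ∀ a b : ℝ,
        AEMeasurable (fun x => ENNReal.ofReal (a * p x - b * q x)) m := by
      intro p q hp hq a b
      exact ((hp.const_mul a).sub (hq.const_mul b)).ennreal_ofReal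
    simp only [hingeSum]
    rw [lintegral_finsetSum' _ fun k _ => hm1 hfm' hgm' _ _,
      lintegral_finsetSum' _ fun k _ => hm1 hfm hgm _ _]
    exact Finset.sum_le_sum fun k _ => h _ _
  have happ : ∀ n, ∫⁻ x, hingeApprox F n (f' x) (g' x) ∂m ≤ ∫⁻ x, persp F (f x) (g x) ∂m := by
    intro n
    calc ∫⁻ x, hingeApprox F n (f' x) (g' x) ∂m ≤ ∫⁻ x, hingeApprox F n (f x) (g x) ∂m := by
          simp only [hingeApprox]
          rw [lintegral_add_left' (hmeas hfm' hgm' _ _), lintegral_add_left' (hmeas hfm hgm _ _)]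
          exact add_le_add (hsum _ _) (hsum _ _)
      _ ≤ _ := by
          refine lintegral_mono_ae ?_
          filter_upwards [hf, hg] with x h1 h2 using hingeApprox_le_persp hF.map_one n h1 h2
  calc ∫⁻ x, persp F (f' x) (g' x) ∂m
      ≤ ∫⁻ x, liminf (fun n => hingeApprox F n (f' x) (g' x)) atTop ∂m := by
        refine lintegral_mono_ae ?_
        filter_upwards [hf', hg'] with x h1 h2 using hF.persp_le_liminf h1 h2
    _ ≤ liminf (fun n => ∫⁻ x, hingeApprox F n (f' x) (g' x) ∂m) atTop :=
        lintegral_liminf_le' fun n => (hmeas hfm' hgm' _ _).add (hmeas hfm' hgm' _ _)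
    _ ≤ _ := liminf_le_of_frequently_le' (Frequently.of_forall happ)

/-- The Csiszár divergence of two measures with densities. -/
theorem IsCsiszarDensity.csiszarDiv_withDensity (hF : IsCsiszarDensity F) {f g : X → ℝ}
    (hfm : Measurable f) (hgm : Measurable g) (hg : 0 ≤ᵐ[m] g)
    (hgi : ∫⁻ x, ENNReal.ofReal (g x) ∂m ≠ ∞) :
    csiszarDiv F (m.withDensity fun x => ENNReal.ofReal (f x))
      (m.withDensity fun x => ENNReal.ofReal (g x)) = ∫⁻ x, persp F (f x) (g x) ∂m := by
  set μ := m.withDensity fun x => ENNReal.ofReal (f x) with hμ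
  set ν := m.withDensity fun x => ENNReal.ofReal (g x) with hν
  have hge : Measurable fun x => ENNReal.ofReal (g x) := hgm.ennreal_ofReal
  have hfe : Measurable fun x => ENNReal.ofReal (f x) := hfm.ennreal_ofReal
  have : IsFiniteMeasure ν := isFiniteMeasure_withDensity hgi
  -- The singular part lives on the zero set of `g` and the density is `f / g` off it; uniqueness of
  -- the Lebesgue decomposition identifies both.
  set Z : Set X := {x | ENNReal.ofReal (g x) = 0} with hZ
  have hZm : MeasurableSet Z := hge (measurableSet_singleton 0)
  set ϱ : X → ℝ≥0∞ := fun x => ENNReal.ofReal (f x) / ENNReal.ofReal (g x) with hϱ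
  have hϱm : Measurable ϱ := hfe.div hge
  set s := (m.restrict Z).withDensity fun x => ENNReal.ofReal (f x) with hs
  have hsing : s ⟂ₘ ν := by
    refine ⟨Zᶜ, hZm.compl, ?_, ?_⟩
    · rw [hs]
      refine withDensity_absolutelyContinuous _ _ ?_
      rw [Measure.restrict_apply hZm.compl, Set.compl_inter_self, measure_empty]
    · rw [compl_compl, hν, withDensity_apply _ hZm]
      exact (setLIntegral_congr_fun hZm fun x hx => hx).trans (by simp)
  have hdec : μ = s + ν.withDensity ϱ := by
    have h1 : ν.withDensity ϱ = (m.restrict Zᶜ).withDensity fun x => ENNReal.ofReal (f x) := by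
      rw [hν, ← withDensity_mul _ hge hϱm, ← withDensity_indicator hZm.compl]
      congr 1
      ext x
      by_cases hx : x ∈ Z
      · have hx' : ENNReal.ofReal (g x) = 0 := hx
        rw [Pi.mul_apply, hx', zero_mul, Set.indicator_of_notMem (by simpa using hx)]
      · have hx' : ENNReal.ofReal (g x) ≠ 0 := hx
        rw [Pi.mul_apply, Set.indicator_of_mem (by simpa using hx)]
        exact ENNReal.mul_div_cancel hx' ENNReal.ofReal_ne_top
    rw [h1, hs, ← withDensity_indicator hZm, ← withDensity_indicator hZm.compl,
      ← withDensity_add_left (hfe.indicator hZm)]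
    rw [hμ]
    congr 1
    exact (Set.indicator_self_add_compl Z fun x => ENNReal.ofReal (f x)).symm
  have hrn := Measure.eq_rnDeriv hϱm hsing hdec
  have hsp := Measure.eq_singularPart hϱm hsing hdec
  have hFm : Measurable F := hF.lsc.measurable
  have i1 : ∫⁻ x, F (μ.rnDeriv ν x).toNNReal ∂ν =
      ∫⁻ x, ENNReal.ofReal (g x) * F (ϱ x).toNNReal ∂m := by
    have h1 : ∫⁻ x, F (μ.rnDeriv ν x).toNNReal ∂ν = ∫⁻ x, F (ϱ x).toNNReal ∂ν := by
      refine lintegral_congr_ae ?_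
      filter_upwards [hrn] with x hx
      rw [hx]
    exact h1.trans
      (lintegral_withDensity_eq_lintegral_mul _ hge (hFm.comp hϱm.ennreal_toNNReal))
  have i2 : recession F * s Set.univ =
      ∫⁻ x, Z.indicator (fun x => recession F * ENNReal.ofReal (f x)) x ∂m := by
    rw [hs, withDensity_apply _ MeasurableSet.univ, Measure.restrict_univ,
      lintegral_indicator hZm, lintegral_const_mul _ hfe]
  have hmeas : Measurable fun x => ENNReal.ofReal (g x) * F (ϱ x).toNNReal :=
    hge.mul (hFm.comp hϱm.ennreal_toNNReal)
  rw [csiszarDiv, ← hsp, i1, i2, ← lintegral_add_left hmeas]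
  refine lintegral_congr_ae ?_
  filter_upwards [hg] with x hx
  rw [persp]
  split_ifs with h0
  · have hx' : x ∈ Z := by
      change ENNReal.ofReal (g x) = 0
      rw [h0, ENNReal.ofReal_zero]
    rw [Set.indicator_of_mem hx', h0, ENNReal.ofReal_zero, zero_mul, zero_add]
  · have hpos : 0 < g x := lt_of_le_of_ne hx (Ne.symm h0)
    have hx' : x ∉ Z := (ENNReal.ofReal_pos.2 hpos).ne'
    rw [Set.indicator_of_notMem hx', add_zero, hϱ]
    simp only
    rw [← ENNReal.ofReal_div_of_pos hpos]
    rfl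

theorem isFiniteMeasure_densityMeasure [MetricSpace X] (f : Lp ℝ 1 m) :
    IsFiniteMeasure (densityMeasure m f) := by
  refine isFiniteMeasure_withDensity_ofReal ?_
  exact (memLp_one_iff_integrable.1 (Lp.memLp f)).2

theorem IsCsiszarDensity.csiszarDiv_densityMeasure [MetricSpace X] (hF : IsCsiszarDensity F)
    (f : Lp ℝ 1 m) {g : Lp ℝ 1 m} (hg : 0 ≤ g) :
    csiszarDiv F (densityMeasure m f) (densityMeasure m g) = ∫⁻ x, persp F (f x) (g x) ∂m := by
  refine hF.csiszarDiv_withDensity (Lp.stronglyMeasurable f).measurable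
    (Lp.stronglyMeasurable g).measurable ((Lp.coeFn_nonneg g).2 hg) ?_
  have := (isFiniteMeasure_densityMeasure g).measure_univ_lt_top
  rw [densityMeasure, withDensity_apply _ MeasurableSet.univ, Measure.restrict_univ] at this
  exact this.ne

end Divergence

/-! ### The Kullback-Leibler divergence as a special case. -/

section KullbackLeibler

/-- The entropy density `r log r - r + 1`. -/
noncomputable def klDensity (r : ℝ≥0) : ℝ≥0∞ := ENNReal.ofReal (InformationTheory.klFun r)

theorem isCsiszarDensity_klDensity : IsCsiszarDensity klDensity where
  convex := by
    refine ⟨convex_univ, fun x _ y _ a b ha hb hab => ?_⟩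
    have hab' : (a : ℝ) + b = 1 := by exact_mod_cast hab
    have h := InformationTheory.convexOn_klFun.2 (Set.mem_Ici.2 x.coe_nonneg)
      (Set.mem_Ici.2 y.coe_nonneg) a.coe_nonneg b.coe_nonneg hab'
    have hx := InformationTheory.klFun_nonneg x.coe_nonneg
    have hy := InformationTheory.klFun_nonneg y.coe_nonneg
    refine (ENNReal.ofReal_le_ofReal h).trans_eq ?_
    simp only [smul_eq_mul, klDensity, ENNReal.smul_def]
    rw [ENNReal.ofReal_add (mul_nonneg a.coe_nonneg hx) (mul_nonneg b.coe_nonneg hy),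
      ENNReal.ofReal_mul a.coe_nonneg,
      ENNReal.ofReal_mul b.coe_nonneg]
    simp
  lsc := (ENNReal.continuous_ofReal.comp
    (InformationTheory.continuous_klFun.comp NNReal.continuous_coe)).lowerSemicontinuous
  map_one := by simp [klDensity, InformationTheory.klFun_one]

theorem recession_klDensity : recession klDensity = ∞ := by
  have h1 : Tendsto (fun r : ℝ≥0 => ENNReal.ofReal (Real.log r - 1)) atTop (𝓝 ∞) :=
    ENNReal.tendsto_ofReal_atTop.comp (tendsto_atTop_add_const_right _ (-1)
      (Real.tendsto_log_atTop.comp (NNReal.tendsto_coe_atTop.2 tendsto_id)))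
  rw [← top_le_iff, ← h1.limsup_eq]
  refine limsup_le_limsup ?_
  filter_upwards [eventually_gt_atTop 0] with r hr
  have hr' : (0 : ℝ) < r := hr
  rw [ENNReal.le_div_iff_mul_le (Or.inl (by exact_mod_cast hr.ne')) (Or.inl ENNReal.coe_ne_top),
    ← ENNReal.ofReal_coe_nnreal, ← ENNReal.ofReal_mul' hr'.le, klDensity,
    InformationTheory.klFun_apply]
  refine ENNReal.ofReal_le_ofReal ?_
  linarith

/-- The recession constant is infinite, so a nonzero singular part costs `∞`, while a vanishing one
costs `∞ * 0 = 0`. -/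
theorem klDiv_eq_csiszarDiv {Ω : Type*} [MeasurableSpace Ω] (μ ν : Measure Ω) [IsFiniteMeasure μ]
    [IsFiniteMeasure ν] : InformationTheory.klDiv μ ν = csiszarDiv klDensity μ ν := by
  rw [csiszarDiv, recession_klDensity]
  by_cases h : μ ≪ ν
  · rw [InformationTheory.klDiv_eq_lintegral_klFun_of_ac h, Measure.singularPart_eq_zero_of_ac h]
    simp [klDensity, ENNReal.toReal]
  · rw [InformationTheory.klDiv_of_not_ac h, ENNReal.top_mul, add_top]
    rw [Ne, Measure.measure_univ_eq_zero, Measure.singularPart_eq_zero]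
    exact h

end KullbackLeibler
end MetricHeat

theorem mainTheorem4 {X : Type*} [MetricSpace X] [CompleteSpace X]
    [TopologicalSpace.SeparableSpace X] [MeasurableSpace X] [BorelSpace X]
    (m : Measure X) [m.IsOpenPosMeasure] (hm : MetricHeat.VolumeGrowth m) :
    -- the heat flow is well defined in `L²` and in `L¹`, and preserves nonnegativity
    (∀ f : Lp ℝ 2 m, ∃ u : ℝ → Lp ℝ 2 m, MetricHeat.IsGradientFlow m f u ∧
      ∀ v : ℝ → Lp ℝ 2 m, MetricHeat.IsGradientFlow m f v → Set.EqOn v u (Set.Ici 0)) ∧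
    (∀ t : ℝ, 0 ≤ t → ∃! T : Lp ℝ 1 m → Lp ℝ 1 m, MetricHeat.IsL1Extension m t T) ∧
    (∀ t : ℝ, 0 ≤ t → ∀ f : Lp ℝ 1 m, 0 ≤ f → 0 ≤ MetricHeat.heatFlow m t f) ∧
    -- contraction of every Csiszár divergence
    (∀ F : ℝ≥0 → ℝ≥0∞, MetricHeat.IsCsiszarDensity F →
      ∀ f g : Lp ℝ 1 m, 0 ≤ f → 0 ≤ g → ∀ t : ℝ, 0 ≤ t →
        MetricHeat.csiszarDiv F
            (MetricHeat.densityMeasure m (MetricHeat.heatFlow m t f))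
            (MetricHeat.densityMeasure m (MetricHeat.heatFlow m t g)) ≤
          MetricHeat.csiszarDiv F
            (MetricHeat.densityMeasure m f) (MetricHeat.densityMeasure m g)) ∧
    -- the Kullback-Leibler divergence
    (∀ f g : Lp ℝ 1 m, 0 ≤ f → 0 ≤ g → ∀ t : ℝ, 0 ≤ t →
      InformationTheory.klDiv
          (MetricHeat.densityMeasure m (MetricHeat.heatFlow m t f))
          (MetricHeat.densityMeasure m (MetricHeat.heatFlow m t g)) ≤
        InformationTheory.klDiv
          (MetricHeat.densityMeasure m f) (MetricHeat.densityMeasure m g)) := by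
  have hcs : ∀ F : ℝ≥0 → ℝ≥0∞, MetricHeat.IsCsiszarDensity F →
      ∀ f g : Lp ℝ 1 m, 0 ≤ f → 0 ≤ g → ∀ t : ℝ, 0 ≤ t →
        MetricHeat.csiszarDiv F
            (MetricHeat.densityMeasure m (MetricHeat.heatFlow m t f))
            (MetricHeat.densityMeasure m (MetricHeat.heatFlow m t g)) ≤
          MetricHeat.csiszarDiv F
            (MetricHeat.densityMeasure m f) (MetricHeat.densityMeasure m g) := by
    intro F hF f g hf hg t ht
    have hf' := hm.heatFlow_nonneg ht hf
    have hg' := hm.heatFlow_nonneg ht hg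
    rw [hF.csiszarDiv_densityMeasure _ hg, hF.csiszarDiv_densityMeasure _ hg']
    refine hF.lintegral_persp_le (Lp.stronglyMeasurable _).measurable.aemeasurable
      (Lp.stronglyMeasurable _).measurable.aemeasurable
      (Lp.stronglyMeasurable _).measurable.aemeasurable
      (Lp.stronglyMeasurable _).measurable.aemeasurable ((Lp.coeFn_nonneg f).2 hf)
      ((Lp.coeFn_nonneg g).2 hg) ((Lp.coeFn_nonneg _).2 hf') ((Lp.coeFn_nonneg _).2 hg')
      fun α β => ?_
    -- Homogeneity for scalars of either sign takes `α` and `β` out of the flow, which yields the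
    -- hinge inequality.
    have h := hm.lintegral_sub_heatFlow_le ht (α • f) (β • g)
    rw [hm.heatFlow_smul ht, hm.heatFlow_smul ht] at h
    have e : ∀ p q : Lp ℝ 1 m, ∫⁻ x, ENNReal.ofReal ((α • p - β • q : Lp ℝ 1 m) x) ∂m =
        ∫⁻ x, ENNReal.ofReal (α * p x - β * q x) ∂m := by
      intro p q
      refine lintegral_congr_ae ?_
      filter_upwards [Lp.coeFn_sub (α • p) (β • q), Lp.coeFn_smul α p, Lp.coeFn_smul β q]
        with x h1 h2 h3
      rw [h1, Pi.sub_apply, h2, h3, Pi.smul_apply, Pi.smul_apply, smul_eq_mul, smul_eq_mul]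
    rwa [e, e] at h
  refine ⟨fun f => ⟨_, hm.isGradientFlow_gradFlow f, fun v hv =>
      (MetricHeat.isGradientFlow_iff.1 (hm.isGradientFlow_gradFlow f)).unique
        (MetricHeat.isGradientFlow_iff.1 hv)⟩,
    fun t ht => ?_, fun t ht f hf => hm.heatFlow_nonneg ht hf, hcs, fun f g hf hg t ht => ?_⟩
  · exact ⟨_, hm.isL1Extension_heatFlow ht, fun S hS => hS.unique (hm.isL1Extension_heatFlow ht)⟩
  · have := fun p : Lp ℝ 1 m => MetricHeat.isFiniteMeasure_densityMeasure p
    rw [MetricHeat.klDiv_eq_csiszarDiv, MetricHeat.klDiv_eq_csiszarDiv]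
    exact hcs _ MetricHeat.isCsiszarDensity_klDensity f g hf hg t ht
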